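/- Let $K$ be a field of one of the following two types. (a) $K$ is the function field of a smooth projective (integral) curve $C$ over a henselian valued field $k$. (b) $K$ is a finite extension of $k_0(\!(x,y)\!)=\operatorname{Frac} k_0[\![x,y]\!]$, where $k_0$ is a perfect field. Then $A$ denotes the integral closure of $k_0[\![x,y]\!]$ in $K$, and we put $C=\operatorname{Spec} A[x^{-1}]$ and $k=k_0(\!(x)\!)$ with its $x$-adic valuation, so that $C$ is a $k$-scheme. Let $C^{(1)}$ be the set of closed points of $C$, regarded as places of $K$. For a finite extension $\ell/k$ of fields, give $\ell$ the topology of the unique extension of the valuation of $k$, and let $C(\ell)$ be the set of $k$-morphisms $\operatorname{Spec}\ell\to C$ with the topology glued from the sets $U(\ell)$, $U\subseteq C$ affine open, each with the coarsest topology for which all maps $U(\ell)\to\ell$ induced by functions $f\in\Gamma(U,\mathcal O_C)$ are continuous. A point of $C(\ell)$ is also viewed as a place of $K$ through its image in $C$. Let $L/K$ be a finite Galois extension with group $G$. For a place $v$ of $K$ let $G_v\subseteq G$ be the decomposition group of a place of $L$ above $v$; it is well defined up to conjugation. Let $v_0\in C^{(1)}$ be unramified in $L/K$, and regard it as a point of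 $C(k(v_0))$. Then: 1. There is an open neighbourhood $U$ of $v_0$ in $C(k(v_0))$ such that for every $v\in U$ the groups $G_v$ and $G_{v_0}$ are conjugate in $G$. 2. In type (a) with nontrivially valued $k$, and in type (b) if $k(v_0)/k$ is separable (for instance if $k_0$ has characteristic zero), every neighbourhood of $v_0$ in $C(k(v_0))$ is infinite. 3. In type (a) with nontrivially valued $k$, and in type (b) always, there are infinitely many $v\in C^{(1)}$ such that $G_v$ and $G_{v_0}$ are conjugate in $G$. Moreover, in type (b), for every height one prime $v_0$ of $A$ (equivalently, every closed point of the punctured spectrum of $A$, including those above $x$) that is unramified in $L/K$, there are infinitely many height one primes $v$ of $A$ such that $G_v$ and $G_{v_0}$ are conjugate in $G$. -/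

import Mathlib

universe u v w

noncomputable section

namespace Reocurrence

open CategoryTheory AlgebraicGeometry Topology

/-! ### Places, decomposition groups, ramification -/

section Places

variable {K : Type v} [Field K]

/-- `W`, a valuation ring of `L`, is a place of `L` above the place of `K` whose local ring is
`R`: it contracts to `R`. -/
def LiesOver {L : Type w} [Field L] [Algebra K L] (W : ValuationSubring L) (R : Subring K) :
    Prop :=
  (W.comap (algebraMap K L)).toSubring = R

/-- The decomposition groups in `Gal(L/K)` of the places of `K` with local rings `R` and `R'` are
conjugate. A decomposition group of `R` is the stabiliser of a place of `L` above `R`; it depends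
on the choice of that place up to conjugation, so all choices are compared. -/
def ConjDecomposition (L : Type w) [Field L] [Algebra K L] (R R' : Subring K) : Prop :=
  ∀ W W' : ValuationSubring L, LiesOver W R → LiesOver W' R' →
    ∃ g : L ≃ₐ[K] L, W'.decompositionSubgroup K =
      (W.decompositionSubgroup K).map (MulAut.conj g).toMonoidHom

/-- The place of `K` with local ring `R` is unramified in `L`: the normalisation of `R` in `L`
is unramified over `R`. -/
def UnramifiedIn (L : Type w) [Field L] [Algebra K L] (R : Subring K) : Prop :=
  Algebra.FormallyUnramified R (integralClosure R L)

/-- The local ring `𝒪_{C,p}` as a subring of the function field of `C`, the latter being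
identified with `K` by `i`. -/
def placeRing {C : Scheme.{u}} [IsIntegral C] (i : C.functionField →+* K) (p : C) : Subring K :=
  (i.comp (algebraMap (C.presheaf.stalk p) C.functionField)).range

/-- For a domain `R` and an injective homomorphism `R → K`, the induced embedding into `K` of the
function field of `Spec R`. -/
def functionFieldLift (R : CommRingCat.{u}) [IsDomain R] (g : R →+* K)
    (hg : Function.Injective g) : (Spec R).functionField →+* K :=
  IsFractionRing.lift (A := R) (g := g) hg

/-- For a domain `R` inside `K`, the embedding into `K` of the function field of `Spec R`. -/
def functionFieldMap (R : Type u) [CommRing R] [IsDomain R] [Algebra R K] [FaithfulSMul R K] :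
    (Spec (CommRingCat.of R)).functionField →+* K :=
  functionFieldLift (CommRingCat.of R) (algebraMap R K) (FaithfulSMul.algebraMap_injective R K)

end Places

/-! ### The topology on rational points -/

section Topology

/-- The topology defined on a field by a valuation ring. -/
abbrev valuationTopology {F : Type u} [Field F] (O : ValuationSubring F) : TopologicalSpace F :=
  (Valued.mk' O.valuation).toUniformSpace.toTopologicalSpace

/-- The set `C(ℓ)` of `ℓ`-valued points of a `B`-scheme `s : C ⟶ B`, where `ℓ` is over `B`
through `t`. -/
abbrev Points {B C : Scheme.{u}} (s : C ⟶ B) {ℓ : CommRingCat.{u}} (t : Spec ℓ ⟶ B) : Type u :=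
  {P : Spec ℓ ⟶ C // P ≫ s = t}

/-- The points in `U(ℓ)` for an affine open `U`, as ring homomorphisms `Γ(C, U) ⟶ ℓ`. -/
abbrev AffinePoints {B C : Scheme.{u}} (s : C ⟶ B) {ℓ : CommRingCat.{u}} (t : Spec ℓ ⟶ B)
    (U : C.affineOpens) : Type u :=
  {φ : Γ(C, U.1) ⟶ ℓ // (Spec.map φ ≫ U.2.fromSpec) ≫ s = t}

/-- The inclusion `U(ℓ) ⊆ C(ℓ)`. -/
def AffinePoints.toPoints {B C : Scheme.{u}} (s : C ⟶ B) {ℓ : CommRingCat.{u}} (t : Spec ℓ ⟶ B)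
    (U : C.affineOpens) (φ : AffinePoints s t U) : Points s t :=
  ⟨Spec.map φ.1 ≫ U.2.fromSpec, φ.2⟩

/-- The topology of `C(ℓ)`: each `U(ℓ)` with `U` affine open carries the coarsest topology making
all evaluations `P ↦ f(P)`, `f ∈ Γ(C, U)`, continuous, and `C(ℓ)` is glued from the `U(ℓ)`
(a subset is open if and only if its trace on every `U(ℓ)` is open). -/
abbrev pointsTopology {B C : Scheme.{u}} (s : C ⟶ B) {ℓ : CommRingCat.{u}} (t : Spec ℓ ⟶ B)
    (τ : TopologicalSpace ℓ) : TopologicalSpace (Points s t) :=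
  ⨆ U : C.affineOpens, TopologicalSpace.coinduced (AffinePoints.toPoints s t U)
    (⨅ f : Γ(C, U.1), TopologicalSpace.induced (fun φ : AffinePoints s t U ↦ φ.1.hom f) τ)

end Topology

/-! ### Points with values in the residue field of a given point -/

section ResiduePoints

variable {k : Type u} [Field k] {C : Scheme.{u}} (s : C ⟶ Spec (CommRingCat.of k)) (p : C)

/-- The structure map `k → k(p)` of the residue field of a point of a `k`-scheme. -/
def residueMap : k →+* C.residueField p :=
  (Spec.preimage (C.fromSpecResidueField p ≫ s)).hom

/-- The set `C(k(p))` of `k`-morphisms `Spec k(p) ⟶ C`. -/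
abbrev ResiduePoints : Type u :=
  Points s (C.fromSpecResidueField p ≫ s)

/-- The point `p`, as an element of `C(k(p))`. -/
def ResiduePoints.self : ResiduePoints s p :=
  ⟨C.fromSpecResidueField p, rfl⟩

/-- The point of `C` underlying an element of `C(k(p))`. -/
def ResiduePoints.pt {s : C ⟶ Spec (CommRingCat.of k)} {p : C} (P : ResiduePoints s p) : C :=
  P.1 (IsLocalRing.closedPoint (C.residueField p))

/-- A valuation ring of `k(p)` that extends the valuation ring `O` of `k`. -/
def Extends (O : ValuationSubring k) (O' : ValuationSubring (C.residueField p)) : Prop :=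
  O'.comap (residueMap s p) = O

/-- A subset of `C(k(p))` is open for the topology defined by the valuation ring `O'` of
`k(p)`. -/
def IsOpenFor (O' : ValuationSubring (C.residueField p)) (U : Set (ResiduePoints s p)) : Prop :=
  IsOpen[pointsTopology s (C.fromSpecResidueField p ≫ s) (valuationTopology O')] U

/-- The residue field `k(p)` is a separable extension of `k`. -/
def SeparableResidueField : Prop :=
  letI := (residueMap s p).toAlgebra
  Algebra.IsSeparable k (C.residueField p)

end ResiduePoints

/-! ### Finite extensions of `k₀((x, y))` -/

section Laurent

variable (k₀ : Type u) [Field k₀]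

/-- The ring `k₀[[x, y]]`, as `k₀[[x]][[y]]`. -/
abbrev PowerSeries₂ : Type u := PowerSeries (PowerSeries k₀)

/-- The field `k₀((x, y))` of fractions of `k₀[[x, y]]`. -/
abbrev Laurent₂ : Type u := FractionRing (PowerSeries₂ k₀)

/-- The valuation ring `k₀[[x]]` of `k₀((x))`. -/
def laurentValuationRing : ValuationSubring (LaurentSeries k₀) :=
  (Valued.v : Valuation (LaurentSeries k₀) (WithZero (Multiplicative ℤ))).valuationSubring

variable (K : Type u) [Field K] [Algebra (PowerSeries₂ k₀) K]

/-- The integral closure `A` of `k₀[[x, y]]` in `K`. -/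
abbrev IntRing : Subalgebra (PowerSeries₂ k₀) K := integralClosure (PowerSeries₂ k₀) K

/-- The variable `x`, as an element of `K`. -/
def varX : K := algebraMap (PowerSeries₂ k₀) K (PowerSeries.C PowerSeries.X)

/-- The ring `A[x⁻¹] ⊆ K`. -/
abbrev IntRingX : Subalgebra (IntRing k₀ K) K :=
  Algebra.adjoin (IntRing k₀ K) {(varX k₀ K)⁻¹}

/-- The natural map `k₀[[x]] → A[x⁻¹]`. -/
def powerSeriesToIntRingX : PowerSeries k₀ →+* IntRingX k₀ K :=
  ((algebraMap (IntRing k₀ K) (IntRingX k₀ K)).comp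
    (algebraMap (PowerSeries₂ k₀) (IntRing k₀ K))).comp PowerSeries.C

variable [Algebra (Laurent₂ k₀) K] [IsScalarTower (PowerSeries₂ k₀) (Laurent₂ k₀) K]

theorem isUnit_powerSeriesToIntRingX :
    IsUnit (powerSeriesToIntRingX k₀ K (PowerSeries.X : PowerSeries k₀)) := by
  have hx : varX k₀ K ≠ 0 := by
    have hinj : Function.Injective (algebraMap (PowerSeries₂ k₀) K) := by
      rw [IsScalarTower.algebraMap_eq (PowerSeries₂ k₀) (Laurent₂ k₀) K]
      exact (algebraMap (Laurent₂ k₀) K).injective.comp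
        (IsFractionRing.injective (PowerSeries₂ k₀) (Laurent₂ k₀))
    refine (map_ne_zero_iff _ hinj).2 ?_
    exact (map_ne_zero_iff _ PowerSeries.C_injective).2 PowerSeries.X_ne_zero
  refine IsUnit.of_mul_eq_one
    (⟨(varX k₀ K)⁻¹, Algebra.subset_adjoin rfl⟩ : IntRingX k₀ K) (Subtype.ext ?_)
  exact mul_inv_cancel₀ hx

/-- The natural map `k₀((x)) → A[x⁻¹]`. -/
def laurentToIntRingX : LaurentSeries k₀ →+* IntRingX k₀ K :=
  IsLocalization.Away.lift (PowerSeries.X : PowerSeries k₀) (isUnit_powerSeriesToIntRingX k₀ K)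

/-- The scheme `C = Spec A[x⁻¹]`. -/
abbrev laurentScheme : Scheme.{u} := Spec (CommRingCat.of (IntRingX k₀ K))

/-- The structure of a scheme over `k = k₀((x))` on `C = Spec A[x⁻¹]`. -/
def laurentStructure : laurentScheme k₀ K ⟶ Spec (CommRingCat.of (LaurentSeries k₀)) :=
  Spec.map (CommRingCat.ofHom (laurentToIntRingX k₀ K))

end Laurent

end Reocurrence

end

noncomputable section

namespace Reocurrence

open CategoryTheory AlgebraicGeometry Topology Filter

/-! ### Places of `L` and their centres on the integral closure -/

section Centers

variable {K : Type v} [Field K] {L : Type w} [Field L] [Algebra K L]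

/-! The decomposition group at an unramified point is read off from the Galois action on finitely
many numbers, and Krasner's lemma shows that this action does not change when the point moves a
little. Since `v₀` is unramified with Noetherian local ring, inertia is trivial, so some `α` in the
integral closure of the local ring satisfies `g α ≢ α` at a place above `v₀` for all `g ≠ 1`
(`LiesOver.exists_separating`). Lagrange interpolation (`exists_aeval_eq_mul_prod`) expresses every
conjugate of `α` as a quotient of polynomials in `α` with invariant coefficients and with
denominator nonzero at the point. Hence `g` lies in the decomposition group exactly when some
endomorphism `σ` of an algebraic closure `Ω`, trivial on the values of functions at the point, takes
the value of `α` to that of `g α` (`LiesOver.exists_algHom_of_smul_eq`,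
`LiesOver.IsExtension.algHom_eq`).

When the point moves, the characteristic polynomial of `α` and the interpolating polynomials move
continuously, and so do the values of all conjugates, up to a choice of place above. The base is
henselian, so endomorphisms of `Ω` are isometries (`valuation_algHom_eq`) and permute the values
before and after in the same way. The same lemma of Krasner shows that an endomorphism fixing the
values at a nearby `k(v₀)`-valued point fixes `k(v₀)`. This is `eventually_conjDecomposition`,
stated for an arbitrary filter of points; `exists_isOpenFor_conjDecomposition` turns it into an open
neighbourhood.

Infinitude requires nearby points. On a smooth curve an étale coordinate is perturbed, and the
perturbed values lift by continuity of roots (`exists_tendsto_of_isStandardEtale`). In type (b) the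
substitute is a pair of parameters on the complete ring `A`: for `z` outside the prime, prime
avoidance gives a local uniformiser `u` such that `A` is finite over `k₀⟦z⟧⟦u⟧`
(`IsCompleteSurface.exists_uniformizer`). If the residue field is separable over `k₀((z))`, then `A`
is étale over this base near the prime, and the base points `u ↦ z ^ (n + 1)` lift to points
converging to the given one (`IsCompleteSurface.exists_tendsto`).

With `z = x` this gives the second claim in type (b). For the third, `x` may be a bad parameter, but
the local ring of a height one prime does not depend on the parameter. Over a perfect field any `z`
whose value is not a `p`-th power makes the residue field separable, and such `z` exists
(`IsCompleteSurface.exists_laurent_separable`). The resulting primes are infinitely many, and only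
finitely many contain `x`. That `A` is finite over `k₀⟦x, y⟧` also in positive characteristic
follows from finiteness of Frobenius (`finite_integralClosure`). -/

theorem LiesOver.mem_iff {W : ValuationSubring L} {R : Subring K} (h : LiesOver W R) (x : K) :
    x ∈ R ↔ algebraMap K L x ∈ W := by
  rw [← h]; rfl

/-- The integral closure of a subring of a field is the intersection of the valuation rings
containing it. This proves integrality without exhibiting an equation. -/
theorem mem_of_forall_valuationSubring {R : Subring K} {x : L}
    (h : ∀ V : ValuationSubring L, (∀ r ∈ R, algebraMap K L r ∈ V) → x ∈ V) :
    IsIntegral R x := by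
  let s : Subring L := R.map (algebraMap K L)
  have h1 : x ∈ (integralClosure (Subring.closure (s : Set L)) L).toSubring := by
    rw [← iInf_valuationSubring_superset]
    simp only [Subring.mem_iInf]
    rintro ⟨V, hV⟩
    exact h V fun r hr ↦ hV ⟨r, hr, rfl⟩
  have h2 : IsIntegral s x := by
    have : IsIntegral (Subring.closure (s : Set L)) x := h1
    rwa [Subring.closure_eq] at this
  obtain ⟨p, hp, hpx⟩ := h2
  have hsurj : Function.Surjective ((algebraMap K L).restrict R s fun r hr ↦ ⟨r, hr, rfl⟩) := by
    rintro ⟨_, r, hr, rfl⟩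
    exact ⟨⟨r, hr⟩, rfl⟩
  obtain ⟨q, hq, -, hqm⟩ := Polynomial.lifts_and_natDegree_eq_and_monic
    ((Polynomial.mem_lifts p).2 (Polynomial.map_surjective _ hsurj p)) hp
  refine ⟨q, hqm, ?_⟩
  rw [← hq, Polynomial.eval₂_map] at hpx
  exact hpx

theorem mem_of_isIntegral {W : ValuationSubring L} {R : Subring K} (h : LiesOver W R) {x : L}
    (hx : IsIntegral R x) : x ∈ W := by
  obtain ⟨p, hp, hpx⟩ := hx
  let f : R →+* W := ((algebraMap K L).comp R.subtype).codRestrict W.toSubring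
    fun r ↦ (h.mem_iff r).1 r.2
  have : IsIntegral W x := by
    refine ⟨p.map f, hp.map f, ?_⟩
    rw [Polynomial.eval₂_map]
    exact hpx
  obtain ⟨y, rfl⟩ := IsIntegrallyClosed.isIntegral_iff.1 this
  exact y.2

/-- This says that `W` is the localisation of the integral closure at its centre. Split an algebraic
equation of `x` at the last coefficient of largest value: the two halves express one element `b` as
a polynomial over `R` in `x` and also in `x⁻¹`, so `b` and `x * b` lie in every valuation ring that
contains `R`. -/
theorem exists_isIntegral_mul_eq [Algebra.IsAlgebraic K L] {W : ValuationSubring L}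
    {R : Subring K} (h : LiesOver W R) {x : L} (hx : x ∈ W) :
    ∃ b c : L, IsIntegral R b ∧ IsIntegral R c ∧ b ≠ 0 ∧ b⁻¹ ∈ W ∧ x * b = c := by
  classical
  rcases eq_or_ne x 0 with rfl | hx0
  · exact ⟨1, 0, isIntegral_one, isIntegral_zero, one_ne_zero, by simp, by simp⟩
  obtain ⟨p, hp0, hpx⟩ := Algebra.IsAlgebraic.isAlgebraic (R := K) x
  let v : ℕ → W.ValueGroup := fun j ↦ W.valuation (algebraMap K L (p.coeff j))
  obtain ⟨m, hm, hmax⟩ := p.support.exists_max_image v (Polynomial.nonempty_support_iff.2 hp0)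
  -- The last index of maximal value is taken so that all later coefficients are strictly smaller,
  -- which will make `b` a unit of `W`.
  let T := p.support.filter fun j ↦ v j = v m
  have hT : T.Nonempty := ⟨m, by simp [T, Polynomial.mem_support_iff.1 hm]⟩
  let i := T.max' hT
  have hi : i ∈ T := T.max'_mem hT
  obtain ⟨his, hiv⟩ := Finset.mem_filter.1 hi
  have hci : p.coeff i ≠ 0 := Polynomial.mem_support_iff.1 his
  have hle : ∀ j, v j ≤ v i := fun j ↦ by
    by_cases hj : j ∈ p.support
    · rw [hiv]; exact hmax j hj
    · simp [v, Polynomial.notMem_support_iff.1 hj]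
  have hlt : ∀ j, i < j → v j < v i := fun j hij ↦ by
    refine lt_of_le_of_ne (hle j) fun he ↦ ?_
    have hj : j ∈ p.support := by
      rw [Polynomial.mem_support_iff]
      intro h0
      simp only [v, h0, map_zero] at he
      exact hci (by simpa using he.symm)
    exact absurd (T.le_max' j (by simp [T, he, hiv, Polynomial.mem_support_iff.1 hj])) (not_le.2 hij)
  let a : ℕ → L := fun j ↦ algebraMap K L (p.coeff j / p.coeff i)
  have hvi : v i ≠ 0 := by simpa [v] using hci
  have ha : ∀ j, W.valuation (a j) = v j / v i := fun j ↦ by simp [a, v]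
  have haR : ∀ j, p.coeff j / p.coeff i ∈ R := fun j ↦ by
    rw [h.mem_iff, ← W.valuation_le_one_iff]
    change W.valuation (a j) ≤ 1
    rw [ha]
    exact div_le_one_of_le₀ (hle j) zero_le
  have hai : a i = 1 := by simp [a, hci]
  let N := p.natDegree
  let b : L := ∑ j ∈ Finset.range (N + 1), a (i + j) * x ^ j
  have hiN : i ≤ N := Polynomial.le_natDegree_of_ne_zero hci
  have hrel : x ^ i * b = - ∑ j ∈ Finset.range i, a j * x ^ j := by
    have h0 : ∑ j ∈ Finset.range (i + (N + 1)), a j * x ^ j = 0 := by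
      have : ∑ j ∈ Finset.range (i + (N + 1)), p.coeff j • x ^ j = 0 := by
        rw [← Polynomial.aeval_eq_sum_range' (by omega) x, hpx]
      calc _ = (algebraMap K L (p.coeff i))⁻¹ *
          ∑ j ∈ Finset.range (i + (N + 1)), p.coeff j • x ^ j := by
            rw [Finset.mul_sum]
            refine Finset.sum_congr rfl fun j _ ↦ ?_
            simp only [a, map_div₀, Algebra.smul_def]; ring
        _ = 0 := by rw [this, mul_zero]
    rw [Finset.sum_range_add] at h0
    rw [eq_neg_iff_add_eq_zero, add_comm, ← h0, Finset.mul_sum]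
    congr 1
    refine Finset.sum_congr rfl fun j _ ↦ ?_
    rw [pow_add]; ring
  have hb' : b = - ∑ j ∈ Finset.range i, a j * x⁻¹ ^ (i - j) := by
    have : b = x⁻¹ ^ i * (x ^ i * b) := by
      rw [← mul_assoc, ← mul_pow, inv_mul_cancel₀ hx0, one_pow, one_mul]
    rw [this, hrel, mul_neg, Finset.mul_sum]
    congr 1
    refine Finset.sum_congr rfl fun j hj ↦ ?_
    have hj := Finset.mem_range.1 hj
    have h1 : x⁻¹ ^ j * x ^ j = 1 := by rw [← mul_pow, inv_mul_cancel₀ hx0, one_pow]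
    have h2 : x⁻¹ ^ i = x⁻¹ ^ (i - j) * x⁻¹ ^ j := by rw [← pow_add, Nat.sub_add_cancel hj.le]
    rw [h2]
    linear_combination (a j * x⁻¹ ^ (i - j)) * h1
  have hc' : x * b = - ∑ j ∈ Finset.range i, a j * x⁻¹ ^ (i - j - 1) := by
    rw [hb', mul_neg, Finset.mul_sum]
    congr 1
    refine Finset.sum_congr rfl fun j hj ↦ ?_
    have hj := Finset.mem_range.1 hj
    obtain ⟨t, ht⟩ : ∃ t, i - j = t + 1 := ⟨i - j - 1, by omega⟩
    rw [ht, Nat.add_sub_cancel, pow_succ]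
    field_simp
  have key : ∀ V : ValuationSubring L, (∀ r ∈ R, algebraMap K L r ∈ V) → b ∈ V ∧ x * b ∈ V := by
    intro V hV
    have haV : ∀ j, a j ∈ V := fun j ↦ hV _ (haR j)
    rcases V.mem_or_inv_mem x with hxV | hxV
    · have : b ∈ V := sum_mem fun j _ ↦ mul_mem (haV _) (pow_mem hxV _)
      exact ⟨this, mul_mem hxV this⟩
    · rw [hc', hb']
      exact ⟨neg_mem (sum_mem fun j _ ↦ mul_mem (haV _) (pow_mem hxV _)),
        neg_mem (sum_mem fun j _ ↦ mul_mem (haV _) (pow_mem hxV _))⟩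
  -- The constant term of `b` is `a i = 1`, and the remaining terms have value below `1` by the
  -- choice of `i`.
  have hb1 : W.valuation b = 1 := by
    have : b = 1 + ∑ j ∈ Finset.range N, a (i + (j + 1)) * x ^ (j + 1) := by
      simp only [b]
      rw [Finset.sum_range_succ', add_comm]
      simp [hai]
    rw [this]
    refine Valuation.map_one_add_of_lt _ ?_
    refine Valuation.map_sum_lt _ one_ne_zero fun j _ ↦ ?_
    rw [map_mul, ha]
    have h1 : v (i + (j + 1)) / v i < 1 := by
      rw [div_lt_one₀ (zero_lt_iff.2 hvi)]
      exact hlt _ (by omega)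
    refine lt_of_le_of_lt (mul_le_of_le_one_right' ?_) h1
    rw [W.valuation_le_one_iff]
    exact pow_mem hx _
  refine ⟨b, x * b, mem_of_forall_valuationSubring fun V hV ↦ (key V hV).1,
    mem_of_forall_valuationSubring fun V hV ↦ (key V hV).2, ?_, ?_, rfl⟩
  · rintro h0
    simp [h0] at hb1
  · rw [← W.valuation_le_one_iff, map_inv₀, hb1, inv_one]

/-- The denominator `b` is a unit of `W₁`, so it is outside the centre of `W₁` and hence outside
that of `W₂`: a place is determined by its centre. -/
theorem LiesOver.le_of_center [Algebra.IsAlgebraic K L] {W₁ W₂ : ValuationSubring L}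
    {R : Subring K} (h₁ : LiesOver W₁ R) (h₂ : LiesOver W₂ R)
    (h : ∀ x, IsIntegral R x → x ∈ W₂.nonunits → x ∈ W₁.nonunits) : W₁ ≤ W₂ := by
  intro x hx
  obtain ⟨b, c, hb, hc, hb0, hbi, rfl⟩ := exists_isIntegral_mul_eq h₁ hx
  have hbi₂ : b⁻¹ ∈ W₂ := by
    by_contra hcon
    have := h b hb ((W₂.mem_nonunits_iff_or).2 (Or.inr hcon))
    rcases W₁.mem_nonunits_iff_or.1 this with h0 | h0
    · exact hb0 h0
    · exact h0 hbi
  have : x = x * b * b⁻¹ := by field_simp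
  rw [this]
  exact mul_mem (mem_of_isIntegral h₂ hc) hbi₂

theorem LiesOver.eq_of_center [Algebra.IsAlgebraic K L] {W₁ W₂ : ValuationSubring L}
    {R : Subring K} (h₁ : LiesOver W₁ R) (h₂ : LiesOver W₂ R)
    (h : ∀ x, IsIntegral R x → (x ∈ W₂.nonunits ↔ x ∈ W₁.nonunits)) : W₁ = W₂ :=
  le_antisymm (h₁.le_of_center h₂ fun x hx ↦ (h x hx).1)
    (h₂.le_of_center h₁ fun x hx ↦ (h x hx).2)

end Centers

/-! ### Separating a maximal ideal from its conjugates -/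

section GroupAction

open scoped Pointwise

/-- An element outside `M` all of whose conjugates by elements not stabilising `M` are in `M`. -/
theorem exists_notMem_forall_smul_mem {G S : Type*} [Group G] [Finite G] [CommRing S]
    [MulSemiringAction G S] (M : Ideal S) [M.IsMaximal] :
    ∃ b ∉ M, ∀ g : G, g • M ≠ M → g⁻¹ • b ∈ M := by
  classical
  have := Fintype.ofFinite G
  -- For each `g` moving `M`, take an element of `g • M` outside `M`; the product over all `g` stays
  -- outside the prime `M`.
  have h : ∀ g : G, ∃ e ∉ M, g • M ≠ M → g⁻¹ • e ∈ M := by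
    intro g
    by_cases hg : g • M = M
    · exact ⟨1, (Ideal.ne_top_iff_one M).1 (Ideal.IsMaximal.ne_top ‹_›), fun h ↦ absurd hg h⟩
    · have : (g • M).IsMaximal := by
        rw [Ideal.pointwise_smul_eq_comap]
        exact Ideal.comap_isMaximal_of_equiv _
      have hle : ¬ g • M ≤ M := fun hle ↦ hg (this.eq_of_le (Ideal.IsMaximal.ne_top ‹_›) hle)
      obtain ⟨e, he, heM⟩ := SetLike.not_le_iff_exists.1 hle
      exact ⟨e, heM, fun _ ↦ Ideal.mem_pointwise_smul_iff_inv_smul_mem.1 he⟩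
  choose e he heM using h
  refine ⟨∏ g, e g, ?_, fun g hg ↦ ?_⟩
  · rw [Ideal.IsPrime.prod_mem_iff]
    simpa using he
  · rw [Finset.smul_prod']
    exact Ideal.prod_mem _ (Finset.mem_univ g) (heM g hg)

end GroupAction

/-! ### Centres as maximal ideals and transitivity on places -/

section Center

variable {K : Type v} [Field K] {L : Type w} [Field L] [Algebra K L]

theorem LiesOver.isFractionRing {W : ValuationSubring L} {R : Subring K} (h : LiesOver W R) :
    IsFractionRing R K := by
  subst h
  exact inferInstanceAs (IsFractionRing (W.comap (algebraMap K L)) K)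

theorem LiesOver.isIntegrallyClosed {W : ValuationSubring L} {R : Subring K} (h : LiesOver W R) :
    IsIntegrallyClosed R := by
  subst h
  exact inferInstanceAs (IsIntegrallyClosed (W.comap (algebraMap K L)))

theorem LiesOver.isLocalRing {W : ValuationSubring L} {R : Subring K} (h : LiesOver W R) :
    IsLocalRing R := by
  subst h
  exact inferInstanceAs (IsLocalRing (W.comap (algebraMap K L)))

/-- The inclusion into a valuation ring `W` above `R` of the integral closure of `R`. -/
def LiesOver.inclusion {W : ValuationSubring L} {R : Subring K} (h : LiesOver W R) :
    integralClosure R L →+* W :=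
  (integralClosure R L).val.toRingHom.codRestrict W.toSubring fun x ↦ mem_of_isIntegral h x.2

/-- The centre of `W` on the integral closure of `R`. -/
def LiesOver.center {W : ValuationSubring L} {R : Subring K} (h : LiesOver W R) :
    Ideal (integralClosure R L) :=
  (IsLocalRing.maximalIdeal W).comap h.inclusion

theorem LiesOver.mem_center {W : ValuationSubring L} {R : Subring K} (h : LiesOver W R)
    (x : integralClosure R L) : x ∈ h.center ↔ (x : L) ∈ W.nonunits := by
  rw [LiesOver.center, Ideal.mem_comap, ← ValuationSubring.coe_mem_nonunits_iff]
  rfl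

theorem LiesOver.mem_nonunits_iff {W : ValuationSubring L} {R : Subring K} (h : LiesOver W R)
    (x : K) : algebraMap K L x ∈ W.nonunits ↔ x = 0 ∨ x⁻¹ ∉ R := by
  rw [W.mem_nonunits_iff_or, h.mem_iff, map_inv₀, map_eq_zero]

instance LiesOver.center_isPrime {W : ValuationSubring L} {R : Subring K} (h : LiesOver W R) :
    h.center.IsPrime := Ideal.IsPrime.comap _

theorem LiesOver.under_center {W W' : ValuationSubring L} {R : Subring K} (h : LiesOver W R)
    (h' : LiesOver W' R) : h.center.under R = h'.center.under R := by
  ext x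
  simp only [Ideal.under_def, Ideal.mem_comap, LiesOver.mem_center]
  change algebraMap K L x ∈ _ ↔ algebraMap K L x ∈ _
  rw [h.mem_nonunits_iff, h'.mem_nonunits_iff]

instance LiesOver.center_isMaximal {W : ValuationSubring L} {R : Subring K} (h : LiesOver W R) :
    h.center.IsMaximal := by
  have := h.isLocalRing
  refine Ideal.isMaximal_of_isIntegral_of_isMaximal_comap (R := R) _ ?_
  have : h.center.comap (algebraMap R (integralClosure R L)) = IsLocalRing.maximalIdeal R := by
    ext x
    simp only [Ideal.mem_comap, LiesOver.mem_center]
    change algebraMap K L x ∈ _ ↔ _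
    rw [h.mem_nonunits_iff, IsLocalRing.mem_maximalIdeal, _root_.mem_nonunits_iff, ← not_iff_not, not_or,
      not_not, not_not]
    constructor
    · rintro ⟨h0, hi⟩
      exact IsUnit.of_mul_eq_one (⟨_, hi⟩ : R) (Subtype.ext (mul_inv_cancel₀ h0))
    · intro hu
      obtain ⟨y, hy⟩ := hu.exists_right_inv
      have hy : (x : K) * y = 1 := congrArg Subtype.val hy
      have h0 : (x : K) ≠ 0 := left_ne_zero_of_mul_eq_one hy
      refine ⟨h0, ?_⟩
      rw [inv_eq_of_mul_eq_one_right hy]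
      exact y.2
  rw [this]
  infer_instance

open scoped Pointwise

theorem LiesOver.smul {W : ValuationSubring L} {R : Subring K} (h : LiesOver W R)
    (g : L ≃ₐ[K] L) : LiesOver (g • W) R := by
  rw [← h]
  ext x
  change algebraMap K L x ∈ g • W ↔ algebraMap K L x ∈ W
  rw [ValuationSubring.mem_pointwise_smul_iff_inv_smul_mem, AlgEquiv.smul_def, AlgEquiv.commutes]

/-- Since centres determine places, the action on places can be tested on integral elements. -/
theorem LiesOver.smul_eq_iff [Algebra.IsAlgebraic K L] {W W' : ValuationSubring L} {R : Subring K}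
    (h : LiesOver W R) (h' : LiesOver W' R) (g : L ≃ₐ[K] L) :
    g • W = W' ↔ ∀ x : L, IsIntegral R x → (x ∈ W.nonunits ↔ g x ∈ W'.nonunits) := by
  have key : ∀ x, x ∈ (g • W).nonunits ↔ g⁻¹ x ∈ W.nonunits := fun x ↦ by
    rw [ValuationSubring.mem_nonunits_iff_or, ValuationSubring.mem_nonunits_iff_or,
      ValuationSubring.mem_pointwise_smul_iff_inv_smul_mem, AlgEquiv.smul_def, map_inv₀]
    simp
  have hint : ∀ (g : L ≃ₐ[K] L) (x : L), IsIntegral R x → IsIntegral R (g x) := fun g x hx ↦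
    hx.map (g.restrictScalars R)
  constructor
  · rintro rfl x -
    rw [key]
    simp
  · intro H
    refine (h.smul g).eq_of_center h' fun x hx ↦ ?_
    rw [key, H _ (hint _ _ hx)]
    simp

/-- `R` is the ring of invariants of its integral closure because it is integrally closed in `K`. A
finite group acts transitively on the primes over a prime of the ring of invariants. -/
theorem LiesOver.exists_smul_eq [FiniteDimensional K L] [IsGalois K L] {W W' : ValuationSubring L}
    {R : Subring K} (h : LiesOver W R) (h' : LiesOver W' R) : ∃ g : L ≃ₐ[K] L, g • W = W' := by
  have := h.isFractionRing
  have := h.isIntegrallyClosed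
  have : Algebra.IsInvariant R (integralClosure R L) (L ≃ₐ[K] L) := by
    constructor
    intro x hx
    have : ∀ g : L ≃ₐ[K] L, g (x : L) = x := fun g ↦ congrArg Subtype.val (hx g)
    obtain ⟨y, hy⟩ := (IsGalois.mem_range_algebraMap_iff_fixed (F := K) (x : L)).2 this
    have hy' : IsIntegral R y := by
      rw [← isIntegral_algebraMap_iff (algebraMap K L).injective, hy]
      exact x.2
    obtain ⟨r, rfl⟩ := IsIntegrallyClosed.isIntegral_iff.1 hy'
    exact ⟨r, Subtype.ext hy⟩
  obtain ⟨g, hg⟩ := Algebra.IsInvariant.exists_smul_of_under_eq R (integralClosure R L)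
    (L ≃ₐ[K] L) h.center h'.center (h.under_center h')
  refine ⟨g, (h.smul_eq_iff h' g).2 fun x hx ↦ ?_⟩
  rw [← h.mem_center ⟨x, hx⟩]
  have := (h'.mem_center (g • (⟨x, hx⟩ : integralClosure R L)))
  rw [hg, Ideal.smul_mem_pointwise_smul_iff] at this
  exact this

end Center

/-! ### Uniqueness of extensions of a henselian valuation -/

section Henselian

open scoped Pointwise

variable {K : Type v} [Field K] {L : Type w} [Field L] [Algebra K L]

theorem LiesOver.isInvariant [FiniteDimensional K L] [IsGalois K L] {W : ValuationSubring L}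
    {R : Subring K} (h : LiesOver W R) :
    Algebra.IsInvariant R (integralClosure R L) (L ≃ₐ[K] L) := by
  have := h.isFractionRing
  have := h.isIntegrallyClosed
  constructor
  intro x hx
  have : ∀ g : L ≃ₐ[K] L, g (x : L) = x := fun g ↦ congrArg Subtype.val (hx g)
  obtain ⟨y, hy⟩ := (IsGalois.mem_range_algebraMap_iff_fixed (F := K) (x : L)).2 this
  have hy' : IsIntegral R y := by
    rw [← isIntegral_algebraMap_iff (algebraMap K L).injective, hy]
    exact x.2
  obtain ⟨r, rfl⟩ := IsIntegrallyClosed.isIntegral_iff.1 hy'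
  exact ⟨r, Subtype.ext hy⟩

theorem LiesOver.under_center_eq {W : ValuationSubring L} {R : Subring K} (h : LiesOver W R)
    [IsLocalRing R] :
    h.center.comap (algebraMap R (integralClosure R L)) = IsLocalRing.maximalIdeal R :=
  IsLocalRing.eq_maximalIdeal (Ideal.isMaximal_comap_of_isIntegral_of_isMaximal _)

open Polynomial in
-- If `M` moved, some `b'` would be nonzero at `M` while all its other conjugates vanish there. The
-- monic polynomial with the distinct conjugates of `b'` as roots then reduces to `(X - b̄) * X ^
-- n`, where `b̄` is the residue of `b'`. Hensel lifts the simple root `b̄` to a root in `R`, so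
-- `b'` is invariant, which is absurd.
theorem smul_eq_of_henselian {R S G : Type*} [CommRing R] [HenselianLocalRing R] [CommRing S]
    [IsDomain S] [Algebra R S] [Group G] [Finite G] [MulSemiringAction G S] [SMulCommClass G R S]
    [Algebra.IsInvariant R S G] (M : Ideal S) [M.IsMaximal]
    (hM : M.comap (algebraMap R S) = IsLocalRing.maximalIdeal R) (g₀ : G) : g₀ • M = M := by
  classical
  have := Fintype.ofFinite G
  by_contra hg₀
  obtain ⟨b, hb, hbM⟩ := exists_notMem_forall_smul_mem (G := G) M
  let D := MulAction.stabilizer G M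
  have : Fintype D := Fintype.ofFinite D
  -- The product over the stabiliser makes `b'` invariant under it, so that every conjugate
  -- different from `b'` lies in `M`.
  let b' : S := ∏ d : D, d • b
  have hstab : ∀ g : G, g • M = M → g • b' = b' := by
    intro g hg
    rw [Finset.smul_prod']
    let g' : D := ⟨g, hg⟩
    refine Fintype.prod_equiv (Equiv.mulLeft g') _ _ fun d ↦ ?_
    change g • ((d : G) • b) = ((g' * d : D) : G) • b
    rw [smul_smul]; rfl
  have hb' : b' ∉ M := by
    rw [Ideal.IsPrime.prod_mem_iff]
    rintro ⟨d, -, hd⟩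
    have hd' : (d : G) • b ∈ (d : G) • M := by
      rw [show (d : G) • M = M from d.2]; exact hd
    exact hb (Ideal.smul_mem_pointwise_smul_iff.1 hd')
  have hbM' : ∀ g : G, g • M ≠ M → g⁻¹ • b' ∈ M := by
    intro g hg
    rw [Finset.smul_prod']
    refine Ideal.prod_mem _ (Finset.mem_univ 1) ?_
    rw [one_smul]
    exact hbM g hg
  have hconj : ∀ g : G, g • b' ≠ b' → g • b' ∈ M := by
    intro g hg
    have : g⁻¹ • M ≠ M := fun hgM ↦ hg (hstab g (by
      conv_lhs => rw [← hgM]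
      rw [smul_inv_smul]))
    have h1 := hbM' g⁻¹ this
    rwa [inv_inv] at h1
  -- Only distinct conjugates are used: with repetitions the reduced root would not be simple.
  let Z : Finset S := Finset.univ.image fun g : G ↦ g • b'
  have hZ : ∀ r, r ∈ Z ↔ ∃ g : G, g • b' = r := fun r ↦ by simp [Z]
  have hbZ : b' ∈ Z := (hZ _).2 ⟨1, one_smul _ _⟩
  let fS : S[X] := ∏ r ∈ Z, (X - C r)
  have hinv : ∀ g : G, fS.map (MulSemiringAction.toRingHom G S g) = fS := by
    intro g
    simp only [fS, Polynomial.map_prod, Polynomial.map_sub, map_X, map_C]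
    refine Finset.prod_bij' (fun r _ ↦ g • r) (fun r _ ↦ g⁻¹ • r) ?_ ?_ ?_ ?_ ?_
    · intro r hr
      obtain ⟨x, rfl⟩ := (hZ _).1 hr
      exact (hZ _).2 ⟨g * x, mul_smul _ _ _⟩
    · intro r hr
      obtain ⟨x, rfl⟩ := (hZ _).1 hr
      exact (hZ _).2 ⟨g⁻¹ * x, mul_smul _ _ _⟩
    · intro r _; simp
    · intro r _; simp
    · intro r _; rfl
  have hlift : fS ∈ lifts (algebraMap R S) := by
    rw [lifts_iff_coeff_lifts]
    intro n
    refine Algebra.IsInvariant.isInvariant (A := R) (G := G) _ fun g ↦ ?_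
    conv_rhs => rw [← hinv g]
    rw [coeff_map]; rfl
  obtain ⟨f, hf, -, hfm⟩ := lifts_and_natDegree_eq_and_monic hlift
    (monic_prod_of_monic _ _ fun r _ ↦ monic_X_sub_C r)
  let π := Ideal.Quotient.mk M
  have hπ : fS.map π = (X - C (π b')) * X ^ (Z.erase b').card := by
    rw [show fS = (X - C b') * ∏ r ∈ Z.erase b', (X - C r) from
      (Finset.mul_prod_erase Z _ hbZ).symm, Polynomial.map_mul, Polynomial.map_prod,
      Polynomial.map_sub, map_X, map_C, ← Finset.prod_const]
    congr 1
    refine Finset.prod_congr rfl fun r hr ↦ ?_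
    obtain ⟨hne, hr⟩ := Finset.mem_erase.1 hr
    obtain ⟨g, rfl⟩ := (hZ _).1 hr
    rw [Polynomial.map_sub, map_X, map_C, Ideal.Quotient.eq_zero_iff_mem.2 (hconj g hne), C_0,
      sub_zero]
  let n := (Z.erase b').card
  -- The coefficient of `X ^ n` in `(X - b̄) * X ^ n` is `-b̄`, so `b̄` is the residue of an element
  -- of `R`.
  let a₀ : R := - f.coeff n
  let τ : R →+* S ⧸ M := π.comp (algebraMap R S)
  have hfτ : f.map τ = (X - C (π b')) * X ^ n := by
    rw [← Polynomial.map_map, hf, hπ]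
  have hn : n ≠ 0 := by
    have hne : g₀⁻¹ • b' ∈ M := hbM' g₀ hg₀
    have : g₀⁻¹ • b' ∈ Z.erase b' := Finset.mem_erase.2
      ⟨fun he ↦ hb' (he ▸ hne), (hZ _).2 ⟨_, rfl⟩⟩
    exact Finset.card_ne_zero_of_mem this
  have ha₀ : τ a₀ = π b' := by
    have : (f.map τ).coeff n = - π b' := by
      rw [hfτ, coeff_mul_X_pow', if_pos le_rfl, Nat.sub_self]
      simp
    rw [map_neg, ← coeff_map, this, neg_neg]
  have hker : ∀ x : R, τ x = 0 ↔ x ∈ IsLocalRing.maximalIdeal R := fun x ↦ by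
    rw [← hM, Ideal.mem_comap]
    exact Ideal.Quotient.eq_zero_iff_mem
  have := Ideal.Quotient.nontrivial_iff.2 (Ideal.IsMaximal.ne_top ‹M.IsMaximal›)
  have hπb : π b' ≠ 0 := fun h0 ↦ hb' (Ideal.Quotient.eq_zero_iff_mem.1 h0)
  obtain ⟨a, ha, -⟩ := HenselianLocalRing.is_henselian f hfm a₀ (by
      rw [← hker, ← eval_map_apply, hfτ, ha₀]; simp) (by
      by_contra hu
      have : τ (f.derivative.eval a₀) = 0 := (hker _).2 hu
      rw [← eval_map_apply, ← derivative_map, hfτ, ha₀] at this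
      have hd : (derivative ((X - C (π b')) * X ^ n)).eval (π b') = π b' ^ n := by
        simp [derivative_mul]
      rw [hd] at this
      exact hπb (pow_eq_zero_iff hn |>.1 this))
  have hprod : ∏ r ∈ Z, (algebraMap R S a - r) = 0 := by
    have : (f.map (algebraMap R S)).eval (algebraMap R S a) = 0 := by
      rw [eval_map_apply, ha, map_zero]
    rw [hf] at this
    simpa [fS, eval_prod] using this
  obtain ⟨r, hr, hr0⟩ := Finset.prod_eq_zero_iff.1 hprod
  obtain ⟨g, rfl⟩ := (hZ _).1 hr
  have hga : algebraMap R S a = g • b' := sub_eq_zero.1 hr0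
  have hba : b' = algebraMap R S a := by
    rw [← inv_smul_smul g b', ← hga, smul_algebraMap]
  have : g₀⁻¹ • b' = b' := by rw [hba, smul_algebraMap]
  exact hb' (this ▸ hbM' g₀ hg₀)

theorem LiesOver.smul_center_eq_of_henselian [FiniteDimensional K L] [IsGalois K L]
    {W : ValuationSubring L} {R : Subring K} (h : LiesOver W R) [HenselianLocalRing R]
    (g₀ : L ≃ₐ[K] L) : g₀ • h.center = h.center := by
  have := h.isInvariant
  exact smul_eq_of_henselian _ h.under_center_eq g₀

theorem LiesOver.eq_of_henselian_of_isGalois [FiniteDimensional K L] [IsGalois K L]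
    {W W' : ValuationSubring L} {R : Subring K} (h : LiesOver W R) (h' : LiesOver W' R)
    [HenselianLocalRing R] : W = W' := by
  obtain ⟨g, rfl⟩ := h.exists_smul_eq h'
  have hg := h.smul_center_eq_of_henselian g
  rw [eq_comm, h.smul_eq_iff h]
  intro x hx
  have h1 : g • (⟨x, hx⟩ : integralClosure R L) ∈ h.center ↔ ⟨x, hx⟩ ∈ h.center := by
    conv_lhs => rw [← hg]
    exact Ideal.smul_mem_pointwise_smul_iff
  rw [h.mem_center, h.mem_center] at h1
  exact h1.symm

/-- A separable element lies in a finite Galois extension, where the group fixes the centre. Every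
element has a separable `p`-power, and a valuation ring contains an element as soon as it contains a
positive power of it. -/
theorem LiesOver.eq_of_henselian [Algebra.IsAlgebraic K L] [IsAlgClosed L]
    {W W' : ValuationSubring L} {R : Subring K} (h : LiesOver W R) (h' : LiesOver W' R)
    [HenselianLocalRing R] : W = W' := by
  have hsep : ∀ x : L, IsSeparable K x → (x ∈ W ↔ x ∈ W') := by
    intro x hx
    let F := IntermediateField.adjoin K ((minpoly K x).rootSet L)
    have hsf : (minpoly K x).IsSplittingField K F :=
      IntermediateField.adjoin_rootSet_isSplittingField (IsAlgClosed.splits _)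
    have : IsGalois K F := IsGalois.of_separable_splitting_field (p := minpoly K x) hx
    have : FiniteDimensional K F := Polynomial.IsSplittingField.finiteDimensional F (minpoly K x)
    have hxF : x ∈ F := IntermediateField.subset_adjoin _ _ (by
      rw [Polynomial.mem_rootSet]
      exact ⟨minpoly.ne_zero hx.isIntegral, minpoly.aeval _ _⟩)
    have h1 : LiesOver (W.comap (algebraMap F L)) R := by rw [← h]; rfl
    have h2 : LiesOver (W'.comap (algebraMap F L)) R := by rw [← h']; rfl
    have he := h1.eq_of_henselian_of_isGalois h2
    exact (SetLike.ext_iff.1 he ⟨x, hxF⟩ :)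
  have hpow : ∀ (V : ValuationSubring L) (x : L) (n : ℕ), n ≠ 0 → (x ^ n ∈ V ↔ x ∈ V) := by
    intro V x n hn
    rw [← V.valuation_le_one_iff, ← V.valuation_le_one_iff, map_pow, pow_le_one_iff hn]
  ext x
  obtain ⟨n, y, hy⟩ := (isPurelyInseparable_iff_pow_mem (separableClosure K L) (ringExpChar K)).1
    inferInstance x
  have hq : ringExpChar K ^ n ≠ 0 := pow_ne_zero _ (expChar_pos K (ringExpChar K)).ne'
  rw [← hpow W x _ hq, ← hpow W' x _ hq]
  refine hsep _ ?_
  rw [← hy]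
  exact mem_separableClosure_iff.1 y.2

end Henselian

/-! ### Endomorphisms of an algebraic closure are isometries -/

section Isometry

variable {k : Type u} [Field k] {Ω : Type v} [Field Ω] [Algebra k Ω]

/-- The preimage of `W` under `σ` is another extension of `O`, hence equal to `W`. -/
theorem mem_valuationSubring_algHom_iff [Algebra.IsAlgebraic k Ω] [IsAlgClosed Ω]
    {O : ValuationSubring k} [HenselianLocalRing O] {W : ValuationSubring Ω}
    (hW : W.comap (algebraMap k Ω) = O) (σ : Ω →ₐ[k] Ω) (x : Ω) : σ x ∈ W ↔ x ∈ W := by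
  have h1 : LiesOver W O.toSubring := by rw [← hW]; rfl
  have h2 : LiesOver (W.comap (σ : Ω →+* Ω)) O.toSubring := by
    rw [← h1]
    ext x
    change σ (algebraMap k Ω x) ∈ W ↔ algebraMap k Ω x ∈ W
    rw [σ.commutes]
  have : HenselianLocalRing O.toSubring := inferInstanceAs (HenselianLocalRing O)
  exact SetLike.ext_iff.1 (h2.eq_of_henselian h1) x

/-- Stability of `W` makes `σ` preserve the order of values, and the value group may have any rank.
The iterates of `x` under `σ` are roots of its minimal polynomial, so `x` is periodic; a strict
change of value would persist in the same direction along the iterates. -/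
theorem valuation_algHom_eq [Algebra.IsAlgebraic k Ω] {W : ValuationSubring Ω}
    (σ : Ω →ₐ[k] Ω) (hσ : ∀ x, σ x ∈ W ↔ x ∈ W) (x : Ω) : W.valuation (σ x) = W.valuation x := by
  rcases eq_or_ne x 0 with rfl | hx
  · rw [map_zero]
  have hle : ∀ a b : Ω, W.valuation (σ a) ≤ W.valuation (σ b) ↔ W.valuation a ≤ W.valuation b := by
    intro a b
    rcases eq_or_ne b 0 with rfl | hb
    · simp
    have hb' : σ b ≠ 0 := (map_ne_zero σ).2 hb
    rw [← div_le_one₀ (zero_lt_iff.2 ((W.valuation.ne_zero_iff).2 hb)),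
      ← div_le_one₀ (zero_lt_iff.2 ((W.valuation.ne_zero_iff).2 hb')), ← map_div₀, ← map_div₀,
      ← map_div₀, W.valuation_le_one_iff, W.valuation_le_one_iff, hσ]
  have hlt : ∀ a b : Ω, W.valuation (σ a) < W.valuation (σ b) ↔ W.valuation a < W.valuation b :=
    fun a b ↦ lt_iff_lt_of_le_iff_le (hle b a)
  obtain ⟨m, n, hmn, he⟩ : ∃ m n, m < n ∧ σ^[m] x = σ^[n] x := by
    have hfin : Set.Finite {y : Ω | (minpoly k x).aeval y = 0} := by
      refine ((minpoly k x).rootSet_finite Ω).subset fun y hy ↦ ?_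
      exact (Polynomial.mem_rootSet).2
        ⟨minpoly.ne_zero (Algebra.IsAlgebraic.isAlgebraic x).isIntegral, hy⟩
    have hmem : ∀ n, σ^[n] x ∈ {y : Ω | (minpoly k x).aeval y = 0} := by
      intro n
      induction n with
      | zero => exact minpoly.aeval k x
      | succ n ih =>
        rw [Function.iterate_succ_apply']
        change Polynomial.aeval (σ _) _ = 0
        rw [Polynomial.aeval_algHom_apply, ih, map_zero]
    have : Finite {y : Ω | (minpoly k x).aeval y = 0} := hfin
    obtain ⟨m, n, hmn, he⟩ := Finite.exists_ne_map_eq_of_infinite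
      (fun n ↦ (⟨σ^[n] x, hmem n⟩ : {y : Ω | (minpoly k x).aeval y = 0}))
    have he : σ^[m] x = σ^[n] x := congrArg Subtype.val he
    rcases lt_or_gt_of_ne hmn with h | h
    · exact ⟨m, n, h, he⟩
    · exact ⟨n, m, h, he.symm⟩
  obtain ⟨d, rfl⟩ : ∃ d, n = m + (d + 1) := ⟨n - m - 1, by omega⟩
  have hper : x = σ^[d + 1] x := by
    rw [Function.iterate_add_apply] at he
    exact (Function.Injective.iterate σ.injective m) he
  rcases lt_trichotomy (W.valuation (σ x)) (W.valuation x) with h | h | h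
  · have : ∀ n, W.valuation (σ^[n + 1] x) < W.valuation x := by
      intro n
      induction n with
      | zero => exact h
      | succ n ih =>
        rw [Function.iterate_succ_apply']
        exact ((hlt _ _).2 ih).trans h
    exact absurd (this d) (by rw [← hper]; exact lt_irrefl _)
  · exact h
  · have : ∀ n, W.valuation x < W.valuation (σ^[n + 1] x) := by
      intro n
      induction n with
      | zero => exact h
      | succ n ih =>
        rw [Function.iterate_succ_apply']
        exact h.trans ((hlt _ _).2 ih)
    exact absurd (this d) (by rw [← hper]; exact lt_irrefl _)

end Isometry

/-! ### The valuation topology in algebraic extensions -/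

section Topology

variable {F : Type u} [Field F] {ι : Type*}

/-- Radii are given by elements of the field rather than of the value group, so that they can be
compared in extensions. -/
theorem nhds_valuationTopology_hasBasis (O : ValuationSubring F) (a : F) :
    (@nhds F (valuationTopology O) a).HasBasis (fun c : F ↦ c ≠ 0)
      fun c ↦ {y | O.valuation (y - a) < O.valuation c} := by
  let := Valued.mk' O.valuation
  constructor
  intro s
  change s ∈ nhds a ↔ _
  rw [Valued.mem_nhds]
  constructor
  · rintro ⟨γ, hγ⟩
    obtain ⟨c, hc⟩ := MonoidWithZeroHom.ValueGroup₀.restrict₀_surjective (.ofClass O.valuation) γ.1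
    have hc : O.valuation.restrict c = γ.1 := hc
    refine ⟨c, ?_, fun y hy ↦ hγ ?_⟩
    · rintro rfl
      exact γ.ne_zero (by rw [← hc, map_zero])
    · change O.valuation.restrict (y - a) < _
      rw [← hc]
      exact O.valuation.restrict_lt_iff.2 hy
  · rintro ⟨c, hc, h⟩
    have hc' : O.valuation.restrict c ≠ 0 := by
      rw [Ne, Valuation.restrict_eq_zero_iff]
      exact (O.valuation.ne_zero_iff).2 hc
    refine ⟨Units.mk0 _ hc', fun y hy ↦ h ?_⟩
    exact O.valuation.restrict_lt_iff.1 hy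

theorem tendsto_valuationTopology_iff (O : ValuationSubring F) (f : ι → F) (l : Filter ι) (a : F) :
    Tendsto f l (@nhds F (valuationTopology O) a) ↔
      ∀ c : F, c ≠ 0 → ∀ᶠ i in l, O.valuation (f i - a) < O.valuation c :=
  (nhds_valuationTopology_hasBasis O a).tendsto_right_iff

variable {Ω : Type v} [Field Ω] [Algebra F Ω] {W : ValuationSubring Ω} {O : ValuationSubring F}

theorem valuation_algebraMap_lt_iff (hW : W.comap (algebraMap F Ω) = O) (x y : F) :
    W.valuation (algebraMap F Ω x) < W.valuation (algebraMap F Ω y) ↔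
      O.valuation x < O.valuation y := by
  rcases eq_or_ne x 0 with rfl | hx
  · simp [zero_lt_iff]
  have hx' : algebraMap F Ω x ≠ 0 := (map_ne_zero _).2 hx
  rw [← not_le, ← not_le, not_iff_not,
    ← div_le_one₀ (zero_lt_iff.2 ((W.valuation.ne_zero_iff).2 hx')),
    ← div_le_one₀ (zero_lt_iff.2 ((O.valuation.ne_zero_iff).2 hx)), ← map_div₀, ← map_div₀,
    ← map_div₀, W.valuation_le_one_iff, O.valuation_le_one_iff, ← hW]
  rfl

/-- A nonzero `c` in `O` making `c * d⁻¹` integral has value at most that of `d`. So the values of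
`F` are coinitial and `F` carries the subspace topology. -/
theorem exists_valuation_algebraMap_le [Algebra.IsAlgebraic F Ω]
    (hW : W.comap (algebraMap F Ω) = O) {d : Ω} (hd : d ≠ 0) :
    ∃ c : F, c ≠ 0 ∧ W.valuation (algebraMap F Ω c) ≤ W.valuation d := by
  have hO : LiesOver W O.toSubring := by rw [← hW]; rfl
  have : IsFractionRing O.toSubring F := inferInstanceAs (IsFractionRing O F)
  have halg : IsAlgebraic O.toSubring d⁻¹ :=
    (IsFractionRing.isAlgebraic_iff O.toSubring F Ω).2 (Algebra.IsAlgebraic.isAlgebraic d⁻¹)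
  obtain ⟨c, hc, hint⟩ := halg.exists_integral_multiple
  refine ⟨c, fun h ↦ hc (Subtype.ext h), ?_⟩
  have h1 := (W.valuation_le_one_iff _).2 (mem_of_isIntegral hO hint)
  have h2 : c • d⁻¹ = algebraMap F Ω c * d⁻¹ := Algebra.smul_def _ _
  rw [h2, map_mul, map_inv₀] at h1
  rwa [← div_eq_mul_inv, div_le_one₀ (zero_lt_iff.2 ((W.valuation.ne_zero_iff).2 hd))] at h1

theorem tendsto_algebraMap_valuationTopology_iff [Algebra.IsAlgebraic F Ω]
    (hW : W.comap (algebraMap F Ω) = O) (f : ι → F) (l : Filter ι) (a : F) :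
    Tendsto (fun i ↦ algebraMap F Ω (f i)) l (@nhds Ω (valuationTopology W) (algebraMap F Ω a)) ↔
      Tendsto f l (@nhds F (valuationTopology O) a) := by
  rw [tendsto_valuationTopology_iff, tendsto_valuationTopology_iff]
  constructor
  · intro h c hc
    filter_upwards [h (algebraMap F Ω c) ((map_ne_zero _).2 hc)] with i hi
    rwa [← map_sub, valuation_algebraMap_lt_iff hW] at hi
  · intro h d hd
    obtain ⟨c, hc, hcd⟩ := exists_valuation_algebraMap_le hW hd
    filter_upwards [h c hc] with i hi
    rw [← map_sub]
    exact lt_of_lt_of_le ((valuation_algebraMap_lt_iff hW _ _).2 hi) hcd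

/-- Take a valuation ring dominating `O`. If it contained an element of `F` outside `O`, the inverse
would be a nonunit of `O` that becomes a unit, against domination. -/
theorem exists_valuationSubring_comap_eq (O : ValuationSubring F) (Ω : Type v) [Field Ω]
    [Algebra F Ω] : ∃ W : ValuationSubring Ω, W.comap (algebraMap F Ω) = O := by
  obtain ⟨W, h, hloc⟩ := IsLocalRing.exists_factor_valuationRing
    ((algebraMap F Ω).comp O.subtype)
  refine ⟨W, ?_⟩
  refine le_antisymm (fun x hx ↦ ?_) fun x hx ↦ h ⟨x, hx⟩
  rcases O.mem_or_inv_mem x with hxO | hxO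
  · exact hxO
  rcases eq_or_ne x 0 with rfl | hx0
  · exact O.zero_mem
  have hu : IsUnit ((((algebraMap F Ω).comp O.subtype).codRestrict W.toSubring h) ⟨x⁻¹, hxO⟩) := by
    refine IsUnit.of_mul_eq_one (⟨algebraMap F Ω x, hx⟩ : W.toSubring) (Subtype.ext ?_)
    change algebraMap F Ω x⁻¹ * algebraMap F Ω x = 1
    rw [← map_mul, inv_mul_cancel₀ hx0, map_one]
  obtain ⟨y, hy⟩ := (hloc.map_nonunit _ hu).exists_right_inv
  have hy : x⁻¹ * (y : F) = 1 := congrArg Subtype.val hy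
  have : x = y := by
    have := inv_eq_of_mul_eq_one_right hy
    rwa [inv_inv] at this
  rw [this]; exact y.2

end Topology

/-! ### Continuity of roots and standard étale algebras -/

section Etale

open Polynomial

theorem tendsto_eval₂ {ι E Ω : Type*} [CommRing E] [CommRing Ω] [TopologicalSpace Ω]
    [IsTopologicalRing Ω] {l : Filter ι} {ρ : ι → E →+* Ω} {ρ₀ : E →+* Ω}
    (h : ∀ e, Tendsto (fun i ↦ ρ i e) l (𝓝 (ρ₀ e))) {x : ι → Ω} {x₀ : Ω}
    (hx : Tendsto x l (𝓝 x₀)) (p : E[X]) :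
    Tendsto (fun i ↦ p.eval₂ (ρ i) (x i)) l (𝓝 (p.eval₂ ρ₀ x₀)) := by
  simp only [eval₂_eq_sum, Polynomial.sum]
  exact tendsto_finsetSum _ fun j _ ↦ (h _).mul (hx.pow j)

/-- The value at `x` is the product of the distances to the roots, each at least the distance to the
nearest root. -/
theorem exists_root_pow_le {Ω G₀ : Type*} [Field Ω] [LinearOrderedCommGroupWithZero G₀]
    (v : Valuation Ω G₀) {p : Polynomial Ω} (hp : p.Monic) (hs : p.Splits) (hd : p.natDegree ≠ 0) (x : Ω) :
    ∃ β, p.eval β = 0 ∧ v (β - x) ^ p.natDegree ≤ v (p.eval x) := by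
  classical
  have hcard : p.roots.card = p.natDegree := hs.natDegree_eq_card_roots.symm
  have hne : p.roots.toFinset.Nonempty := by
    rw [Multiset.toFinset_nonempty, ← Multiset.card_pos]
    omega
  obtain ⟨β, hβ, hmin⟩ := p.roots.toFinset.exists_min_image (fun β ↦ v (x - β)) hne
  refine ⟨β, ((mem_roots hp.ne_zero).1 (Multiset.mem_toFinset.1 hβ)), ?_⟩
  have key : ∀ s : Multiset Ω, (∀ γ ∈ s, v (x - β) ≤ v (x - γ)) →
      v (x - β) ^ s.card ≤ v ((s.map fun γ ↦ x - γ).prod) := by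
    intro s
    induction s using Multiset.induction_on with
    | empty => simp
    | cons a s ih =>
      intro h
      rw [Multiset.card_cons, Multiset.map_cons, Multiset.prod_cons, map_mul, pow_succ']
      exact mul_le_mul' (h a (Multiset.mem_cons_self a s))
        (ih fun γ hγ ↦ h γ (Multiset.mem_cons_of_mem hγ))
  have h1 : p.eval x = (p.roots.map fun γ ↦ x - γ).prod := by
    conv_lhs => rw [hs.eq_prod_roots_of_monic hp]
    rw [eval_multiset_prod, Multiset.map_map]
    simp
  rw [h1, Valuation.map_sub_swap, ← hcard]
  exact key _ fun γ hγ ↦ hmin γ (Multiset.mem_toFinset.2 hγ)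

/-- A simple root has a separable minimal polynomial. If no endomorphism moves the root, it has no
other conjugate, so the degree is one. -/
theorem mem_range_algebraMap_of_simple_root {ℓ Ω : Type*} [Field ℓ] [Field Ω] [Algebra ℓ Ω]
    [Algebra.IsAlgebraic ℓ Ω] [IsAlgClosed Ω] {x : Ω} (hx : ∀ σ : Ω →ₐ[ℓ] Ω, σ x = x) (f : ℓ[X])
    (hf : aeval x f = 0) (hf' : aeval x (derivative f) ≠ 0) : ∃ y, algebraMap ℓ Ω y = x := by
  have hint : IsIntegral ℓ x := (Algebra.IsAlgebraic.isAlgebraic x).isIntegral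
  obtain ⟨h, rfl⟩ := minpoly.dvd ℓ x hf
  have hd : derivative (minpoly ℓ x) ≠ 0 := by
    intro h0
    rw [derivative_mul, h0, zero_mul, zero_add, map_mul, minpoly.aeval, zero_mul] at hf'
    exact hf' rfl
  have hsep : (minpoly ℓ x).Separable :=
    (separable_iff_derivative_ne_zero (minpoly.irreducible hint)).2 hd
  have hroot : (minpoly ℓ x).rootSet Ω ⊆ {x} := by
    intro y hy
    have hy : aeval y (minpoly ℓ x) = 0 := (mem_rootSet.1 hy).2
    have hconj : IsConjRoot ℓ x y :=
      (isConjRoot_iff_aeval_eq_zero hint).2 hy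
    have : Normal ℓ Ω := normal_iff.2 fun z ↦
      ⟨(Algebra.IsAlgebraic.isAlgebraic z).isIntegral, IsAlgClosed.splits _⟩
    obtain ⟨σ, hσ⟩ := isConjRoot_iff_exists_algEquiv.1 hconj
    have := hx (σ.symm : Ω →ₐ[ℓ] Ω)
    change σ.symm x = x at this
    rw [← hσ, σ.symm_apply_apply, hσ] at this
    exact this
  have hcard := card_rootSet_eq_natDegree hsep (IsAlgClosed.splits ((minpoly ℓ x).map (algebraMap ℓ Ω)))
  have hle : (minpoly ℓ x).natDegree ≤ 1 := by
    rw [← hcard, ← Nat.card_eq_fintype_card]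
    exact (Nat.card_mono (Set.finite_singleton x) hroot).trans (by simp)
  have h1 : (minpoly ℓ x).degree = 1 := by
    rw [degree_eq_natDegree (minpoly.ne_zero hint)]
    have := minpoly.natDegree_pos hint
    exact_mod_cast (by omega : (minpoly ℓ x).natDegree = 1)
  exact minpoly.mem_range_of_degree_eq_one ℓ x h1

/-- The polynomial `(f(Y) - f(X)) / (Y - X)`. -/
def diffQuot {E : Type*} [CommRing E] (f : E[X]) : E[X][X] := (f.map C) /ₘ (X - C X)

theorem diffQuot_mul {E : Type*} [CommRing E] (f : E[X]) :
    (X - C X) * diffQuot f = f.map C - C f := by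
  rw [diffQuot, X_sub_C_mul_divByMonic_eq_sub_modByMonic, modByMonic_X_sub_C_eq_C_eval]
  congr 2
  rw [Polynomial.eval_map, eval₂_C_X]

/-- Differentiate the factorisation and restrict to the diagonal. A nonzero derivative at the limit
thereby keeps distinct roots apart. -/
theorem eval_diffQuot {E : Type*} [CommRing E] (f : E[X]) :
    (diffQuot f).eval X = derivative f := by
  have h := congrArg (fun p ↦ (derivative p).eval X) (diffQuot_mul f)
  simp only [derivative_mul, derivative_sub, derivative_X, derivative_C, sub_zero, one_mul,
    eval_add, eval_mul, eval_sub, eval_X, eval_C, sub_self, zero_mul, add_zero] at h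
  rw [h, derivative_map, Polynomial.eval_map, eval₂_C_X]

theorem exists_ringHom_of_root {E B ℓ : Type*} [CommRing E] [CommRing B] [Algebra E B]
    [Field ℓ] (P : StandardEtalePresentation E B) (ρ : E →+* ℓ) (x : ℓ)
    (hf : P.f.eval₂ ρ x = 0) (hg : P.g.eval₂ ρ x ≠ 0) :
    ∃ φ : B →+* ℓ, φ.comp (algebraMap E B) = ρ ∧ φ P.x = x := by
  let := ρ.toAlgebra
  have hm : P.P.HasMap x := ⟨hf, hg.isUnit⟩
  let φ : B →ₐ[E] ℓ := (P.P.lift x hm).comp P.equivRing.toAlgHom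
  refine ⟨φ, ?_, ?_⟩
  · ext e; exact φ.commutes e
  · change P.P.lift x hm (P.equivRing P.x) = x
    rw [P.equivRing_x]
    exact P.P.lift_X x hm

/-- Points of a standard étale algebra can be moved along with points of its base. -/
theorem exists_tendsto_of_isStandardEtale {ι : Type*} {E : Type*} {B : Type*} {ℓ : Type u}
    {Ω : Type v} [CommRing E] [CommRing B] [Algebra E B] [Algebra.IsStandardEtale E B] [Field ℓ]
    [Field Ω] [Algebra ℓ Ω] [Algebra.IsAlgebraic ℓ Ω] [IsAlgClosed Ω] (W : ValuationSubring Ω)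
    (hW : ∀ (σ : Ω →ₐ[ℓ] Ω) (x : Ω), σ x ∈ W ↔ x ∈ W) (φ₀ : B →+* ℓ) (l : Filter ι)
    (ρ : ι → E →+* ℓ)
    (hρ : ∀ e, Tendsto (fun i ↦ algebraMap ℓ Ω (ρ i e)) l
      (@nhds Ω (valuationTopology W) (algebraMap ℓ Ω (φ₀ (algebraMap E B e))))) :
    ∃ φ : ι → B →+* ℓ, (∀ᶠ i in l, (φ i).comp (algebraMap E B) = ρ i) ∧
      ∀ b, Tendsto (fun i ↦ algebraMap ℓ Ω (φ i b)) l
        (@nhds Ω (valuationTopology W) (algebraMap ℓ Ω (φ₀ b))) := by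
  classical
  let := Valued.mk' W.valuation
  obtain ⟨⟨P⟩⟩ := ‹Algebra.IsStandardEtale E B›
  let a := algebraMap ℓ Ω
  let r : ι → E →+* Ω := fun i ↦ a.comp (ρ i)
  let r₀ : E →+* Ω := a.comp (φ₀.comp (algebraMap E B))
  replace hρ : ∀ e, Tendsto (fun i ↦ r i e) l (𝓝 (r₀ e)) := hρ
  let x₀ : Ω := a (φ₀ P.x)
  have hr₀ : ∀ p : E[X], p.eval₂ r₀ x₀ = a (φ₀ (aeval P.x p)) := fun p ↦ by
    rw [aeval_def, hom_eval₂, hom_eval₂]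
  have hfB : aeval P.x P.f = 0 := P.hasMap.1
  have hgB : IsUnit (aeval P.x P.g) := P.hasMap.2
  have hf₀ : P.f.eval₂ r₀ x₀ = 0 := by rw [hr₀, hfB, map_zero, map_zero]
  have hg₀ : P.g.eval₂ r₀ x₀ ≠ 0 := by
    rw [hr₀]
    exact (map_ne_zero a).2 (hgB.map φ₀).ne_zero
  have hf'₀ : (derivative P.f).eval₂ r₀ x₀ ≠ 0 := by
    rw [hr₀]
    exact (map_ne_zero a).2 (P.hasMap.isUnit_derivative_f.map φ₀).ne_zero
  have hd : P.f.natDegree ≠ 0 := by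
    intro h0
    simp [P.monic_f.natDegree_eq_zero.1 h0] at hf₀
  -- The root nearest to `x₀`; it converges to `x₀` because the value of the deformed polynomial at
  -- `x₀` tends to zero.
  have hroot : ∀ i, ∃ β, P.f.eval₂ (r i) β = 0 ∧
      W.valuation (β - x₀) ^ P.f.natDegree ≤ W.valuation (P.f.eval₂ (r i) x₀) := by
    intro i
    have h1 := exists_root_pow_le W.valuation (P.monic_f.map (r i)) (IsAlgClosed.splits _)
      (by rwa [P.monic_f.natDegree_map]) x₀
    rw [P.monic_f.natDegree_map] at h1
    simpa only [Polynomial.eval_map] using h1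
  choose β hβ hβle using hroot
  have hlim : ∀ γ : ι → Ω, (∀ i, W.valuation (γ i - x₀) ≤ W.valuation (β i - x₀)) →
      Tendsto γ l (𝓝 x₀) := by
    intro γ hγ
    refine (tendsto_valuationTopology_iff W γ l x₀).2 fun c hc ↦ ?_
    have h0 : Tendsto (fun i ↦ P.f.eval₂ (r i) x₀) l (𝓝 0) := by
      rw [← hf₀]
      exact tendsto_eval₂ hρ tendsto_const_nhds _
    have h1 := (tendsto_valuationTopology_iff W _ l 0).1 h0 (c ^ P.f.natDegree) (pow_ne_zero _ hc)
    filter_upwards [h1] with i hi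
    rw [sub_zero, map_pow] at hi
    refine lt_of_le_of_lt (hγ i) ?_
    by_contra hcon
    exact absurd (lt_of_le_of_lt (hβle i) hi) (not_lt.2 (pow_le_pow_left' (not_lt.1 hcon) _))
  have hβlim : Tendsto β l (𝓝 x₀) := hlim β fun _ ↦ le_rfl
  -- Two families of roots converging to `x₀` eventually agree: the difference quotient at them
  -- tends to the nonzero derivative at `x₀`, while its product with their difference is zero.
  have huniq : ∀ᶠ i in l, ∀ γ, P.f.eval₂ (r i) γ = 0 →
      W.valuation (γ - x₀) ≤ W.valuation (β i - x₀) → γ = β i := by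
    -- A competing root is chosen wherever there is one, with `β i` as default, so that uniqueness
    -- concerns a single family.
    have hγ : ∀ i, ∃ γ, P.f.eval₂ (r i) γ = 0 ∧ W.valuation (γ - x₀) ≤ W.valuation (β i - x₀) ∧
        (γ = β i → ∀ γ', P.f.eval₂ (r i) γ' = 0 →
          W.valuation (γ' - x₀) ≤ W.valuation (β i - x₀) → γ' = β i) := by
      intro i
      by_cases h : ∃ γ, P.f.eval₂ (r i) γ = 0 ∧ W.valuation (γ - x₀) ≤ W.valuation (β i - x₀) ∧
        γ ≠ β i
      · obtain ⟨γ, h1, h2, h3⟩ := h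
        exact ⟨γ, h1, h2, fun h ↦ absurd h h3⟩
      · push Not at h
        exact ⟨β i, hβ i, le_rfl, fun _ ↦ h⟩
    choose γ h1 h2 h3 using hγ
    let R : ι → E[X] →+* Ω := fun i ↦ eval₂RingHom (r i) (β i)
    let R₀ : E[X] →+* Ω := eval₂RingHom r₀ x₀
    have hR : ∀ e, Tendsto (fun i ↦ R i e) l (𝓝 (R₀ e)) := fun e ↦ tendsto_eval₂ hρ hβlim e
    have hq := tendsto_eval₂ hR (hlim γ h2) (diffQuot P.f)
    have hq₀ : (diffQuot P.f).eval₂ R₀ x₀ = (derivative P.f).eval₂ r₀ x₀ := by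
      rw [← eval_diffQuot]
      have hX : x₀ = R₀ X := by simp [R₀]
      conv_lhs => rw [hX, eval₂_hom]
      rfl
    rw [hq₀] at hq
    filter_upwards [hq.eventually_ne hf'₀] with i hi
    refine h3 i ?_
    have h4 := congrArg (eval₂ (R i) (γ i)) (diffQuot_mul P.f)
    have hC : (R i).comp C = r i := by ext e; simp [R]
    rw [eval₂_mul, eval₂_sub, eval₂_sub, eval₂_X, eval₂_C, eval₂_C, eval₂_map, hC, h1 i] at h4
    have h5 : R i P.f = 0 := hβ i
    have h6 : R i X = β i := by simp [R]
    rw [h5, h6, sub_zero] at h4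
    exact sub_eq_zero.1 ((mul_eq_zero.1 h4).resolve_right hi)
  -- Endomorphisms over `ℓ` fix `x₀` and preserve distances, so they take `β i` to a root equally
  -- near to `x₀`, which is `β i` by uniqueness.
  have hx : ∀ᶠ i in l, ∃ y, a y = β i := by
    have hder := tendsto_eval₂ hρ hβlim (derivative P.f)
    filter_upwards [huniq, hder.eventually_ne hf'₀] with i hi hi'
    have hev : ∀ (p : E[X]) (z : Ω), aeval z (p.map (ρ i)) = p.eval₂ (r i) z := fun p z ↦ by
      rw [aeval_def, eval₂_map]
    refine mem_range_algebraMap_of_simple_root (fun σ ↦ ?_) (P.f.map (ρ i)) ?_ ?_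
    · refine hi _ ?_ ?_
      · rw [← hev, aeval_algHom_apply, hev, hβ, map_zero]
      · have : σ (β i) - x₀ = σ (β i - x₀) := by rw [map_sub, show σ x₀ = x₀ from σ.commutes _]
        rw [this, valuation_algHom_eq σ (hW σ)]
    · rw [hev, hβ]
    · rwa [derivative_map, hev]
  have hφ : ∀ᶠ i in l, ∃ φ : B →+* ℓ, φ.comp (algebraMap E B) = ρ i ∧ a (φ P.x) = β i := by
    have hg := tendsto_eval₂ hρ hβlim P.g
    filter_upwards [hx, hg.eventually_ne hg₀] with i ⟨y, hy⟩ hgi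
    have hev : ∀ (p : E[X]), a (p.eval₂ (ρ i) y) = p.eval₂ (r i) (β i) := fun p ↦ by
      rw [hom_eval₂, hy]
    obtain ⟨φ, h1, h2⟩ := exists_ringHom_of_root P (ρ i) y
      ((map_eq_zero a).1 (by rw [hev, hβ])) (fun h ↦ hgi (by rw [← hev, h, map_zero]))
    exact ⟨φ, h1, by rw [h2, hy]⟩
  let φ : ι → B →+* ℓ := fun i ↦
    if h : ∃ φ : B →+* ℓ, φ.comp (algebraMap E B) = ρ i ∧ a (φ P.x) = β i then h.choose else φ₀
  have hφ' : ∀ᶠ i in l, (φ i).comp (algebraMap E B) = ρ i ∧ a (φ i P.x) = β i := by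
    filter_upwards [hφ] with i hi
    simp only [φ, dif_pos hi]
    exact hi.choose_spec
  refine ⟨φ, hφ'.mono fun i hi ↦ hi.1, fun b ↦ ?_⟩
  -- Up to a power of `g`, every element of the algebra is a polynomial in the root, so convergence
  -- at the root is enough.
  obtain ⟨p, n, hpn⟩ := P.exists_mul_aeval_x_g_pow_eq_aeval_x b
  have hlim2 := (tendsto_eval₂ hρ hβlim p).div ((tendsto_eval₂ hρ hβlim P.g).pow n)
    (pow_ne_zero n hg₀)
  have h0 : p.eval₂ r₀ x₀ / (P.g.eval₂ r₀ x₀) ^ n = a (φ₀ b) := by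
    rw [div_eq_iff (pow_ne_zero n hg₀), hr₀, hr₀, ← hpn, map_mul, map_mul, map_pow, map_pow]
  rw [h0] at hlim2
  refine hlim2.congr' ?_
  filter_upwards [hφ', (tendsto_eval₂ hρ hβlim P.g).eventually_ne hg₀] with i ⟨hi1, hi2⟩ hgi
  have hev : ∀ p : E[X], p.eval₂ (r i) (β i) = a (φ i (aeval P.x p)) := fun p ↦ by
    rw [aeval_def, hom_eval₂, hom_eval₂, hi1, hi2]
  rw [Pi.div_apply, div_eq_iff (pow_ne_zero n hgi), hev, hev, ← hpn, map_mul, map_mul, map_pow, map_pow]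

end Etale

/-! ### Trivial inertia and a separating element -/

section Inertia

/-- Formal unramifiedness propagates agreement modulo `M` to all powers of `M`, and Krull's
intersection theorem removes the error. -/
theorem eq_of_formallyUnramified {R S : Type*} [CommRing R] [CommRing S] [Algebra R S]
    [IsDomain S] [IsNoetherianRing S] [Algebra.FormallyUnramified R S] {M : Ideal S} (hM : M ≠ ⊤)
    {f g : S →ₐ[R] S} (h : ∀ x, f x - g x ∈ M) : f = g :=
  Algebra.FormallyUnramified.ext_of_iInf M (Ideal.iInf_pow_eq_bot_of_isDomain M hM) fun x ↦
    Ideal.Quotient.eq.2 (h x)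

open scoped Pointwise

/-- A maximal ideal with trivial inertia has an element separating the whole group. -/
theorem exists_forall_smul_sub_notMem {G S : Type*} [Group G] [Finite G] [CommRing S]
    [MulSemiringAction G S] {M : Ideal S} (hM : M.IsMaximal)
    (h : ∀ g : G, (∀ x : S, g • x - x ∈ M) → g = 1) :
    ∃ α : S, ∀ g : G, g ≠ 1 → g • α - α ∉ M := by
  let := Ideal.Quotient.field M
  let D := MulAction.stabilizer G M
  let f : D →* ((S ⧸ M) ≃ₐ[ℤ ⧸ M.under ℤ] (S ⧸ M)) :=
    Ideal.Quotient.stabilizerHom M (M.under ℤ) G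
  let : MulSemiringAction D (S ⧸ M) := MulSemiringAction.compHom (S ⧸ M) f
  have hsmul : ∀ (g : D) (x : S), g • (Ideal.Quotient.mk M x) =
      Ideal.Quotient.mk M ((g : G) • x) := fun g x ↦ rfl
  let F := FixedPoints.subfield D (S ⧸ M)
  -- A primitive element of the residue field over the fixed field of the stabiliser is moved by
  -- every nontrivial element of the stabiliser, as inertia is trivial.
  obtain ⟨(θ : S ⧸ M), hθ⟩ := Field.exists_primitive_element F (S ⧸ M)
  have hfix : ∀ g : D, g • (θ : S ⧸ M) = θ → g = 1 := by
    intro g hg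
    have h1 : (MulSemiringAction.toAlgHom F (S ⧸ M) g) = AlgHom.id F (S ⧸ M) := by
      have h2 : Algebra.adjoin F {(θ : S ⧸ M)} = ⊤ := by
        rw [← IntermediateField.adjoin_simple_toSubalgebra_of_isAlgebraic
          (Algebra.IsAlgebraic.isAlgebraic θ), hθ, IntermediateField.top_toSubalgebra]
      refine AlgHom.ext_of_adjoin_eq_top h2 ?_
      rintro _ rfl
      exact hg
    refine Subtype.ext (h g fun x ↦ ?_)
    rw [← Ideal.Quotient.eq, ← hsmul]
    exact AlgHom.congr_fun h1 _
  -- A nonzero separating element is needed: for `g` outside the stabiliser the contradiction will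
  -- be that `θ'` vanishes.
  obtain ⟨θ', hθ'0, hθ'⟩ : ∃ θ' : S ⧸ M, θ' ≠ 0 ∧ ∀ g : D, g • θ' = θ' → g = 1 := by
    rcases eq_or_ne θ 0 with h0 | h0
    · exact ⟨1, one_ne_zero, fun g _ ↦ hfix g (by rw [h0, smul_zero])⟩
    · exact ⟨θ, h0, hfix⟩
  obtain ⟨b, hb, hbg⟩ := exists_notMem_forall_smul_mem (G := G) M
  have hb0 : Ideal.Quotient.mk M b ≠ 0 := by rwa [Ne, Ideal.Quotient.eq_zero_iff_mem]
  -- The factor `s` makes the residue of `s * b` equal to `θ'`, while the factor `b` puts the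
  -- translates by `g` outside the stabiliser into `M`.
  obtain ⟨s, hs⟩ := Ideal.Quotient.mk_surjective (θ' / Ideal.Quotient.mk M b)
  have hsb : Ideal.Quotient.mk M (s * b) = θ' := by rw [map_mul, hs, div_mul_cancel₀ _ hb0]
  refine ⟨s * b, fun g hg hmem ↦ ?_⟩
  by_cases hgD : g ∈ D
  · refine hg (congrArg Subtype.val (hθ' ⟨g, hgD⟩ ?_))
    rw [← hsb, hsmul]
    exact Ideal.Quotient.eq.2 hmem
  · have h1 : g • b ∈ M := by
      have := hbg g⁻¹ fun h ↦ hgD ((inv_mem_iff (G := G)).1 h)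
      rwa [inv_inv] at this
    have h2 : s * b ∈ M := by
      rw [smul_mul'] at hmem
      exact (Submodule.sub_mem_iff_right M (M.mul_mem_left _ h1)).1 hmem
    exact hθ'0 (by rw [← hsb, Ideal.Quotient.eq_zero_iff_mem.2 h2])

variable {K : Type v} [Field K] {L : Type w} [Field L] [Algebra K L]

/-- An automorphism trivial modulo the centre is the identity by `eq_of_formallyUnramified`. The
integral closure is Noetherian because `L/K` is separable. -/
theorem LiesOver.exists_separating [FiniteDimensional K L] [IsGalois K L] {W : ValuationSubring L}
    {R : Subring K} (h : LiesOver W R) [IsNoetherianRing R] (hR : UnramifiedIn L R) :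
    ∃ α : integralClosure R L, ∀ g : L ≃ₐ[K] L, g ≠ 1 → g • α - α ∉ h.center := by
  have := h.isFractionRing
  have := h.isIntegrallyClosed
  have : IsNoetherianRing (integralClosure R L) :=
    IsIntegralClosure.isNoetherianRing R K L (integralClosure R L)
  have hR : Algebra.FormallyUnramified R (integralClosure R L) := hR
  refine exists_forall_smul_sub_notMem h.center_isMaximal fun g hg ↦ ?_
  have h1 := eq_of_formallyUnramified (R := R) (M := h.center) (Ideal.IsPrime.ne_top inferInstance)
    (f := MulSemiringAction.toAlgHom R (integralClosure R L) g) (g := AlgHom.id R _) hg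
  have := h.isFractionRing
  ext x
  have : IsFractionRing (integralClosure R L) L :=
    integralClosure.isFractionRing_of_finite_extension K L
  obtain ⟨y, z, -, rfl⟩ := IsFractionRing.div_surjective (A := integralClosure R L) x
  have hfix : ∀ y, IsIntegral R y → g y = y := fun y hy ↦
    congrArg Subtype.val (AlgHom.congr_fun h1 ⟨y, hy⟩)
  rw [map_div₀]
  change g (y : L) / g (z : L) = y / z
  rw [hfix y y.2, hfix z z.2]

end Inertia

/-! ### The local ring of a point and evaluation on it -/

section PointRing

variable {A : Type*} [CommRing A] (K : Type v) [Field K] [Algebra A K] {Ω : Type*} [Field Ω]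

/-- The local ring in `K` of the kernel of a homomorphism from a subring `A` to a field. -/
def pointRing (φ : A →+* Ω) : Subring K where
  carrier := {x | ∃ a b, φ b ≠ 0 ∧ x * algebraMap A K b = algebraMap A K a}
  mul_mem' := by
    rintro x y ⟨a, b, hb, h⟩ ⟨a', b', hb', h'⟩
    refine ⟨a * a', b * b', by rw [map_mul]; exact mul_ne_zero hb hb', ?_⟩
    rw [map_mul, map_mul, ← h, ← h']
    ring
  one_mem' := ⟨1, 1, by rw [map_one]; exact one_ne_zero, by simp⟩
  add_mem' := by
    rintro x y ⟨a, b, hb, h⟩ ⟨a', b', hb', h'⟩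
    refine ⟨a * b' + a' * b, b * b', by rw [map_mul]; exact mul_ne_zero hb hb', ?_⟩
    rw [map_add, map_mul, map_mul, map_mul, ← h, ← h']
    ring
  zero_mem' := ⟨0, 1, by rw [map_one]; exact one_ne_zero, by simp⟩
  neg_mem' := by
    rintro x ⟨a, b, hb, h⟩
    exact ⟨-a, b, hb, by rw [map_neg, ← h, neg_mul]⟩

variable {K}

theorem mem_pointRing {φ : A →+* Ω} {x : K} : x ∈ pointRing K φ ↔
    ∃ a b, φ b ≠ 0 ∧ x * algebraMap A K b = algebraMap A K a := Iff.rfl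

variable (K) in
/-- The inclusion of `A` in the local ring of a point. -/
def toPointRing (φ : A →+* Ω) : A →+* pointRing K φ :=
  (algebraMap A K).codRestrict _ fun a ↦ ⟨a, 1, by rw [map_one]; exact one_ne_zero, by simp⟩

theorem exists_mul_toPointRing {φ : A →+* Ω} (x : pointRing K φ) :
    ∃ a b, φ b ≠ 0 ∧ x * toPointRing K φ b = toPointRing K φ a := by
  obtain ⟨a, b, hb, h⟩ := x.2
  exact ⟨a, b, hb, Subtype.ext h⟩

variable [FaithfulSMul A K]

theorem toPointRing_injective (φ : A →+* Ω) : Function.Injective (toPointRing K φ) := fun _ _ h ↦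
  FaithfulSMul.algebraMap_injective A K (congrArg Subtype.val h)

variable (K) in
/-- The value of a function at a point. -/
def pointEval (φ : A →+* Ω) : pointRing K φ →+* Ω :=
  -- The value is required to be compatible with every presentation as a fraction, which makes it
  -- unique and the choice multiplicative and additive.
  have key : ∀ x : pointRing K φ, ∃ y : Ω, ∀ a b, x * toPointRing K φ b = toPointRing K φ a →
      y * φ b = φ a := by
    intro x
    obtain ⟨a, b, hb, h⟩ := exists_mul_toPointRing x
    refine ⟨φ a / φ b, fun a' b' h' ↦ ?_⟩
    have h1 : a * b' = a' * b := by
      apply toPointRing_injective (K := K) φ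
      rw [map_mul, map_mul, ← h, ← h']
      ring
    rw [div_mul_eq_mul_div, div_eq_iff hb, ← map_mul, ← map_mul, h1]
  have uniq : ∀ x y, (∀ a b, φ b ≠ 0 → x * toPointRing K φ b = toPointRing K φ a →
      y * φ b = φ a) → y = (key x).choose := by
    intro x y hy
    obtain ⟨a, b, hb, h⟩ := exists_mul_toPointRing x
    exact mul_right_cancel₀ hb ((hy a b hb h).trans ((key x).choose_spec a b h).symm)
  have hmap : ∀ x y, ∃ a b a' b', φ b ≠ 0 ∧ φ b' ≠ 0 ∧ x * toPointRing K φ b = toPointRing K φ a ∧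
      y * toPointRing K φ b' = toPointRing K φ a' ∧ (key x).choose * φ b = φ a ∧
      (key y).choose * φ b' = φ a' := by
    intro x y
    obtain ⟨a, b, hb, h⟩ := exists_mul_toPointRing x
    obtain ⟨a', b', hb', h'⟩ := exists_mul_toPointRing y
    exact ⟨a, b, a', b', hb, hb', h, h', (key x).choose_spec a b h, (key y).choose_spec a' b' h'⟩
  { toFun := fun x ↦ (key x).choose
    map_one' := (uniq 1 1 fun a b _ h ↦ by
      rw [one_mul] at h ⊢; rw [toPointRing_injective φ h]).symm
    map_zero' := (uniq 0 0 fun a b _ h ↦ by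
      rw [zero_mul] at h ⊢
      rw [toPointRing_injective (K := K) φ (h.symm.trans (map_zero _).symm), map_zero]).symm
    map_mul' := fun x y ↦ by
      obtain ⟨a, b, a', b', hb, hb', h, h', e, e'⟩ := hmap x y
      refine (uniq (x * y) _ fun a'' b'' _ h'' ↦ ?_).symm
      refine mul_right_cancel₀ (mul_ne_zero hb hb') ?_
      have h1 : a * a' * b'' = a'' * (b * b') := by
        apply toPointRing_injective (K := K) φ
        simp only [map_mul]
        rw [← h'', ← h, ← h']
        ring
      calc _ = φ (a * a' * b'') := by simp only [map_mul]; rw [← e, ← e']; ring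
        _ = _ := by rw [h1, map_mul, map_mul]
    map_add' := fun x y ↦ by
      obtain ⟨a, b, a', b', hb, hb', h, h', e, e'⟩ := hmap x y
      refine (uniq (x + y) _ fun a'' b'' _ h'' ↦ ?_).symm
      refine mul_right_cancel₀ (mul_ne_zero hb hb') ?_
      have h1 : (a * b' + a' * b) * b'' = a'' * (b * b') := by
        apply toPointRing_injective (K := K) φ
        simp only [map_mul, map_add]
        rw [← h'', ← h, ← h']
        ring
      calc _ = φ ((a * b' + a' * b) * b'') := by simp only [map_mul, map_add]; rw [← e, ← e']; ring
        _ = _ := by rw [h1, map_mul, map_mul] }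

theorem pointEval_toPointRing (φ : A →+* Ω) (a : A) : pointEval K φ (toPointRing K φ a) = φ a := by
  have : ∃ y : Ω, ∀ a' b, toPointRing K φ a * toPointRing K φ b = toPointRing K φ a' →
      y * φ b = φ a' := ⟨φ a, fun a' b h ↦ by
    rw [← map_mul] at h ⊢; rw [toPointRing_injective φ h]⟩
  have h := this.choose_spec a 1 (by rw [map_one, mul_one])
  rw [map_one, mul_one] at h
  exact h

theorem isUnit_toPointRing {φ : A →+* Ω} {b : A} (hb : φ b ≠ 0) :
    IsUnit (toPointRing K φ b) := by
  have hb0 : algebraMap A K b ≠ 0 := by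
    rw [Ne, FaithfulSMul.algebraMap_eq_zero_iff]
    rintro rfl
    exact hb (map_zero φ)
  exact IsUnit.of_mul_eq_one (⟨(algebraMap A K b)⁻¹, 1, b, hb, by
    rw [inv_mul_cancel₀ hb0, map_one]⟩ : pointRing K φ) (Subtype.ext (mul_inv_cancel₀ hb0))

theorem ringHom_ext_pointRing {φ : A →+* Ω} {Ω' : Type*} [Field Ω'] {f g : pointRing K φ →+* Ω'}
    (h : f.comp (toPointRing K φ) = g.comp (toPointRing K φ)) : f = g := by
  ext x
  obtain ⟨a, b, hb, hx⟩ := exists_mul_toPointRing x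
  have h1 := congrArg f hx
  have h2 := congrArg g hx
  rw [map_mul] at h1 h2
  have ha := RingHom.congr_fun h a
  have hb' := RingHom.congr_fun h b
  simp only [RingHom.comp_apply] at ha hb'
  refine mul_right_cancel₀ ((isUnit_toPointRing hb).map f).ne_zero ?_
  rw [h1, ha, hb', h2]

theorem pointEval_eq_zero_iff {φ : A →+* Ω} (x : pointRing K φ) :
    pointEval K φ x = 0 ↔ (x : K) = 0 ∨ (x : K)⁻¹ ∉ pointRing K φ := by
  obtain ⟨a, b, hb, hx⟩ := exists_mul_toPointRing x
  have h1 := congrArg (pointEval K φ) hx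
  rw [map_mul, pointEval_toPointRing, pointEval_toPointRing] at h1
  constructor
  · intro h
    by_contra! hcon
    obtain ⟨h0, hi⟩ := hcon
    have : x * ⟨_, hi⟩ = 1 := Subtype.ext (mul_inv_cancel₀ h0)
    have := congrArg (pointEval K φ) this
    rw [map_mul, h, zero_mul, map_one] at this
    exact zero_ne_one this
  · intro h
    by_contra hne
    have ha : φ a ≠ 0 := by rw [← h1]; exact mul_ne_zero hne hb
    have hx0 : (x : K) ≠ 0 := by
      rintro h0
      have : x = 0 := Subtype.ext h0
      rw [this, map_zero] at hne
      exact hne rfl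
    refine (h.resolve_left hx0) ⟨b, a, ha, ?_⟩
    have hx' : (x : K) * algebraMap A K b = algebraMap A K a := congrArg Subtype.val hx
    rw [← hx', inv_mul_cancel_left₀ hx0]

end PointRing

/-! ### The decomposition group seen through values of a separating element -/

section SinglePlace

/-- Algebraic extensions of a field embed in an algebraically closed field. -/
theorem exists_ringHom_comp_eq {N Ω Ω' : Type*} [CommRing N] [IsDomain N] [Field Ω] [Field Ω']
    [IsAlgClosed Ω'] (f : N →+* Ω) (f' : N →+* Ω') (hf : Function.Injective f)
    (hf' : Function.Injective f') (h : ∀ x, ∃ p : Polynomial N, p ≠ 0 ∧ p.eval₂ f x = 0) :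
    ∃ σ : Ω →+* Ω', σ.comp f = f' := by
  let := f.toAlgebra
  let := f'.toAlgebra
  have : FaithfulSMul N Ω := (faithfulSMul_iff_algebraMap_injective N Ω).2 hf
  have : FaithfulSMul N Ω' := (faithfulSMul_iff_algebraMap_injective N Ω').2 hf'
  have : Algebra.IsAlgebraic N Ω := ⟨h⟩
  let σ : Ω →ₐ[N] Ω' := IsAlgClosed.lift
  exact ⟨σ, σ.comp_algebraMap⟩

open Polynomial in
/-- Every `s` is, up to the different of `α`, a polynomial in `α` with invariant coefficients. -/
theorem exists_aeval_eq_mul_prod {R S G : Type*} [CommRing R] [CommRing S] [Algebra R S] [Group G]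
    [Fintype G] [DecidableEq G] [MulSemiringAction G S] [Algebra.IsInvariant R S G] (α s : S) :
    ∃ Q : R[X], aeval α Q = s * ∏ h ∈ Finset.univ.erase (1 : G), (α - h • α) := by
  -- Lagrange interpolation: every translate `g • q` with `g ≠ 1` vanishes at `α`, so the invariant
  -- sum of all translates has the same value at `α` as `q`.
  let q : S[X] := C s * ∏ h ∈ Finset.univ.erase (1 : G), (X - C (h • α))
  let p : S[X] := ∑ g : G, g • q
  have hp : ∀ g : G, g • p = p := by
    intro g
    simp only [p, Finset.smul_sum, smul_smul]
    exact Fintype.sum_equiv (Equiv.mulLeft g) _ _ fun _ ↦ rfl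
  have hlift : p ∈ lifts (algebraMap R S) := by
    rw [lifts_iff_coeff_lifts]
    intro n
    obtain ⟨r, hr⟩ := Algebra.IsInvariant.isInvariant (A := R) (G := G) (p.coeff n) fun g ↦ by
      rw [← Polynomial.coeff_smul, hp]
    exact ⟨r, hr⟩
  obtain ⟨Q, hQ⟩ := (mem_lifts _).1 hlift
  refine ⟨Q, ?_⟩
  rw [aeval_def, ← Polynomial.eval_map, hQ, eval_finsetSum, Finset.sum_eq_single 1]
  · simp [q, eval_prod]
  · intro g _ hg
    have : g • q = C (g • s) * ∏ h ∈ Finset.univ.erase (1 : G), (X - C ((g * h) • α)) := by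
      simp only [q, smul_mul', Finset.smul_prod', smul_sub, smul_X, smul_C, smul_smul]
    rw [this, eval_mul, eval_prod, Finset.prod_eq_zero (i := g⁻¹), mul_zero]
    · simp [hg]
    · simp
  · simp

variable {A : Type*} [CommRing A] {K : Type v} [Field K] [Algebra A K] [FaithfulSMul A K]
  {Ω : Type*} [Field Ω] {L : Type w} [Field L] [Algebra K L] {φ : A →+* Ω}
  {W : ValuationSubring L}

theorem LiesOver.algebraMap_mem_center (h : LiesOver W (pointRing K φ)) (r : pointRing K φ) :
    algebraMap (pointRing K φ) (integralClosure (pointRing K φ) L) r ∈ h.center ↔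
      pointEval K φ r = 0 := by
  rw [LiesOver.mem_center, pointEval_eq_zero_iff]
  exact h.mem_nonunits_iff r

/-- `ψ` extends the point `φ` to the integral closure of its local ring, with the centre of `W` as
its kernel. -/
structure LiesOver.IsExtension (h : LiesOver W (pointRing K φ))
    (ψ : integralClosure (pointRing K φ) L →+* Ω) : Prop where
  map_toPointRing : ∀ a, ψ (algebraMap _ _ (toPointRing K φ a)) = φ a
  eq_zero_iff : ∀ x, ψ x = 0 ↔ x ∈ h.center

/-- The residue ring at the centre is integral over that of the local ring, whose embedding in `Ω`
therefore extends. -/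
theorem LiesOver.exists_extension [IsAlgClosed Ω] (h : LiesOver W (pointRing K φ)) :
    ∃ ψ, h.IsExtension ψ := by
  let e := pointEval K φ
  have : (RingHom.ker e).IsPrime := RingHom.ker_isPrime e
  let := Ideal.Quotient.field h.center
  let m := (Ideal.Quotient.mk h.center).comp (algebraMap (pointRing K φ) _)
  have hm : ∀ r, m r = 0 ↔ e r = 0 := fun r ↦ by
    rw [← h.algebraMap_mem_center]
    exact Ideal.Quotient.eq_zero_iff_mem
  let f : pointRing K φ ⧸ RingHom.ker e →+* integralClosure (pointRing K φ) L ⧸ h.center :=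
    Ideal.Quotient.lift _ m fun r hr ↦ (hm r).2 hr
  let f' : pointRing K φ ⧸ RingHom.ker e →+* Ω := RingHom.kerLift e
  obtain ⟨σ, hσ⟩ := exists_ringHom_comp_eq f f'
    (RingHom.lift_injective_of_ker_le_ideal _ _ fun r hr ↦ (hm r).1 hr)
    (RingHom.kerLift_injective e) fun x ↦ by
      obtain ⟨x, rfl⟩ := Ideal.Quotient.mk_surjective x
      obtain ⟨p, hp, hpx⟩ := (integralClosure.isIntegral x : IsIntegral (pointRing K φ) x)
      refine ⟨p.map (Ideal.Quotient.mk _), (hp.map _).ne_zero, ?_⟩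
      rw [Polynomial.eval₂_map]
      change p.eval₂ ((Ideal.Quotient.mk h.center).comp (algebraMap (pointRing K φ) _)) _ = 0
      rw [← Polynomial.hom_eval₂, hpx, map_zero]
  refine ⟨σ.comp (Ideal.Quotient.mk _), fun a ↦ ?_, fun x ↦ ?_⟩
  · have := RingHom.congr_fun hσ (Ideal.Quotient.mk _ (toPointRing K φ a))
    refine Eq.trans this ?_
    exact pointEval_toPointRing φ a
  · rw [RingHom.comp_apply, map_eq_zero, Ideal.Quotient.eq_zero_iff_mem]

theorem LiesOver.IsExtension.map_algebraMap {h : LiesOver W (pointRing K φ)}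
    {ψ : integralClosure (pointRing K φ) L →+* Ω} (hψ : h.IsExtension ψ) (r : pointRing K φ) :
    ψ (algebraMap _ _ r) = pointEval K φ r := by
  refine RingHom.congr_fun (ringHom_ext_pointRing (f := ψ.comp (algebraMap _ _))
    (g := pointEval K φ) ?_) r
  ext a
  exact (hψ.map_toPointRing a).trans (pointEval_toPointRing φ a).symm

open scoped Pointwise

theorem LiesOver.smul_eq_self_iff [Algebra.IsAlgebraic K L] {R : Subring K} (h : LiesOver W R)
    (g : L ≃ₐ[K] L) : g • W = W ↔ ∀ x, x ∈ h.center ↔ g • x ∈ h.center := by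
  rw [h.smul_eq_iff h]
  constructor
  · intro H x
    rw [h.mem_center, h.mem_center]
    exact H x x.2
  · intro H x hx
    have := H ⟨x, hx⟩
    rw [h.mem_center, h.mem_center] at this
    exact this

variable {k : Type u} [Field k] [Algebra k Ω]

omit [FaithfulSMul A K] in
-- If `g` stabilises `W`, then `ψ` and `ψ ∘ g` have the same kernel and give two embeddings of one
-- residue field. As `Ω` is algebraic over `k`, the second factors through the first by an
-- endomorphism.
theorem LiesOver.exists_algHom_of_smul_eq [Algebra.IsAlgebraic k Ω] [IsAlgClosed Ω]
    [Algebra.IsAlgebraic K L] (h : LiesOver W (pointRing K φ)) (j : k →+* A)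
    (hj : ∀ c, φ (j c) = algebraMap k Ω c) {ψ : integralClosure (pointRing K φ) L →+* Ω}
    (hψ : h.IsExtension ψ) {g : L ≃ₐ[K] L} (hg : g • W = W) :
    ∃ σ : Ω →ₐ[k] Ω, ∀ x, σ (ψ x) = ψ (g • x) := by
  let := Ideal.Quotient.field h.center
  let ψg : integralClosure (pointRing K φ) L →+* Ω :=
    ψ.comp (MulSemiringAction.toRingHom (L ≃ₐ[K] L) (integralClosure (pointRing K φ) L) g)
  have hψg : ∀ x, ψg x = 0 ↔ x ∈ h.center := fun x ↦
    (hψ.eq_zero_iff _).trans ((h.smul_eq_self_iff g).1 hg x).symm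
  let f : integralClosure (pointRing K φ) L ⧸ h.center →+* Ω :=
    Ideal.Quotient.lift _ ψ fun x hx ↦ (hψ.eq_zero_iff x).2 hx
  let f' : integralClosure (pointRing K φ) L ⧸ h.center →+* Ω :=
    Ideal.Quotient.lift _ ψg fun x hx ↦ (hψg x).2 hx
  let m : k →+* integralClosure (pointRing K φ) L ⧸ h.center :=
    (Ideal.Quotient.mk _).comp ((algebraMap _ _).comp ((toPointRing K φ).comp j))
  have hm : f.comp m = algebraMap k Ω := by
    ext c
    exact (hψ.map_toPointRing _).trans (hj c)
  obtain ⟨σ, hσ⟩ := exists_ringHom_comp_eq f f' f.injective f'.injective fun x ↦ by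
    obtain ⟨p, hp, hpx⟩ := Algebra.IsAlgebraic.isAlgebraic (R := k) x
    refine ⟨p.map m, (Polynomial.map_ne_zero_iff m.injective).2 hp, ?_⟩
    rw [Polynomial.eval₂_map, hm]
    exact hpx
  have key : ∀ x, σ (ψ x) = ψ (g • x) := fun x ↦
    RingHom.congr_fun hσ (Ideal.Quotient.mk _ x)
  refine ⟨{ σ with commutes' := fun c ↦ ?_ }, key⟩
  change σ _ = _
  rw [← hj, ← hψ.map_toPointRing, key, smul_algebraMap]

/-- The effect of `σ` on the value of `α` determines everything: by interpolation, `s` times the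
product of the `α - h α` is a polynomial in `α` whose coefficients have values fixed by `σ`. -/
theorem LiesOver.IsExtension.algHom_eq [FiniteDimensional K L] [IsGalois K L]
    {h : LiesOver W (pointRing K φ)} {ψ : integralClosure (pointRing K φ) L →+* Ω}
    (hψ : h.IsExtension ψ) {α : integralClosure (pointRing K φ) L}
    (hα : ∀ g : L ≃ₐ[K] L, g ≠ 1 → ψ (g • α) ≠ ψ α) {g : L ≃ₐ[K] L} {σ : Ω →+* Ω}
    (hσφ : ∀ a, σ (φ a) = φ a) (hσ : σ (ψ α) = ψ (g • α))
    (s : integralClosure (pointRing K φ) L) : σ (ψ s) = ψ (g • s) := by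
  classical
  have := h.isInvariant (L := L)
  let S := integralClosure (pointRing K φ) L
  have hσe : σ.comp (pointEval K φ) = pointEval K φ := ringHom_ext_pointRing <| by
    ext a
    simp only [RingHom.comp_apply, pointEval_toPointRing, hσφ]
  have hψe : ψ.comp (algebraMap _ S) = pointEval K φ := RingHom.ext hψ.map_algebraMap
  have hcomp : ∀ Q : Polynomial (pointRing K φ), σ (ψ (Polynomial.aeval α Q)) =
      ψ (g • Polynomial.aeval α Q) := by
    intro Q
    have h1 : g • Polynomial.aeval α Q = Polynomial.aeval (g • α) Q :=
      (Polynomial.aeval_algHom_apply (MulSemiringAction.toAlgHom (pointRing K φ) S g) α Q).symm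
    rw [h1, Polynomial.aeval_def, Polynomial.aeval_def, Polynomial.hom_eval₂, Polynomial.hom_eval₂,
      Polynomial.hom_eval₂, hψe, hσe, hσ]
  let D : S := ∏ h ∈ Finset.univ.erase (1 : L ≃ₐ[K] L), (α - h • α)
  have hD : ψ D ≠ 0 := by
    rw [map_prod, Finset.prod_ne_zero_iff]
    intro h hh
    rw [map_sub, sub_ne_zero]
    exact (hα h (Finset.ne_of_mem_erase hh)).symm
  -- The case `s = 1` treats the product itself, which is nonzero at the point and can be cancelled.
  obtain ⟨Q₁, hQ₁⟩ := exists_aeval_eq_mul_prod (R := pointRing K φ) (G := L ≃ₐ[K] L) α 1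
  obtain ⟨Q, hQ⟩ := exists_aeval_eq_mul_prod (R := pointRing K φ) (G := L ≃ₐ[K] L) α s
  have h1 := hcomp Q₁
  have h2 := hcomp Q
  rw [hQ₁, one_mul] at h1
  rw [hQ, map_mul, map_mul, smul_mul', map_mul] at h2
  change σ (ψ s) * σ (ψ D) = ψ (g • s) * ψ (g • D) at h2
  change σ (ψ D) = ψ (g • D) at h1
  rw [← h1] at h2
  exact mul_right_cancel₀ ((map_ne_zero σ).2 hD) h2

omit [FaithfulSMul A K] in
-- The converse direction: a field endomorphism is injective, so `g` preserves the kernel of `ψ`,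
-- which is the centre.
theorem LiesOver.IsExtension.smul_eq [FiniteDimensional K L] [IsGalois K L]
    {h : LiesOver W (pointRing K φ)} {ψ : integralClosure (pointRing K φ) L →+* Ω}
    (hψ : h.IsExtension ψ) {g : L ≃ₐ[K] L} {σ : Ω →+* Ω}
    (hσ : ∀ s, σ (ψ s) = ψ (g • s)) : g • W = W := by
  rw [h.smul_eq_self_iff]
  intro x
  rw [← hψ.eq_zero_iff, ← hψ.eq_zero_iff, ← hσ]
  exact (map_eq_zero σ).symm

omit [FaithfulSMul A K] in
theorem LiesOver.IsExtension.comp [FiniteDimensional K L] [IsGalois K L]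
    {h : LiesOver W (pointRing K φ)} {ψ : integralClosure (pointRing K φ) L →+* Ω}
    (hψ : h.IsExtension ψ) (g : L ≃ₐ[K] L) : (h.smul g⁻¹).IsExtension
      (ψ.comp (MulSemiringAction.toRingHom (L ≃ₐ[K] L) (integralClosure (pointRing K φ) L) g)) := by
  constructor
  · intro a
    rw [RingHom.comp_apply, MulSemiringAction.toRingHom_apply, smul_algebraMap,
      hψ.map_toPointRing]
  · intro x
    rw [RingHom.comp_apply, MulSemiringAction.toRingHom_apply, hψ.eq_zero_iff, h.mem_center,
      LiesOver.mem_center]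
    exact (((h.smul g⁻¹).smul_eq_iff h g).1 (smul_inv_smul g W) x x.2).symm

end SinglePlace

/-! ### Data with coefficients in the coordinate ring -/

section Denominators

open Polynomial

variable {A : Type*} [CommRing A] {K : Type v} [Field K] [Algebra A K] {Ω : Type*} [Field Ω]

theorem exists_common_denominator {φ : A →+* Ω} (s : Finset (pointRing K φ)) :
    ∃ b, φ b ≠ 0 ∧ ∀ x ∈ s, ∃ a, toPointRing K φ b * x = toPointRing K φ a := by
  classical
  induction s using Finset.induction_on with
  | empty => exact ⟨1, by rw [map_one]; exact one_ne_zero, by simp⟩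
  | insert x s _ ih =>
    obtain ⟨b, hb, h⟩ := ih
    obtain ⟨a, c, hc, hx⟩ := exists_mul_toPointRing x
    refine ⟨b * c, by rw [map_mul]; exact mul_ne_zero hb hc, ?_⟩
    intro y hy
    rcases Finset.mem_insert.1 hy with rfl | hy
    · exact ⟨b * a, by rw [map_mul, map_mul, ← hx]; ring⟩
    · obtain ⟨a', ha'⟩ := h y hy
      exact ⟨a' * c, by rw [map_mul, map_mul, ← ha']; ring⟩

theorem exists_common_denominator_polynomial {φ : A →+* Ω} (s : Finset (pointRing K φ)[X]) :
    ∃ b, φ b ≠ 0 ∧ ∀ P ∈ s, ∃ Q : A[X],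
      Q.map (toPointRing K φ) = C (toPointRing K φ b) * P := by
  classical
  obtain ⟨b, hb, h⟩ := exists_common_denominator (s.biUnion fun P ↦ P.coeffs)
  refine ⟨b, hb, fun P hP ↦ ?_⟩
  have : C (toPointRing K φ b) * P ∈ lifts (toPointRing K φ) := by
    rw [lifts_iff_coeff_lifts]
    intro n
    rw [coeff_C_mul]
    by_cases h0 : P.coeff n = 0
    · exact ⟨0, by rw [h0, mul_zero, map_zero]⟩
    · obtain ⟨a, ha⟩ := h _ (Finset.mem_biUnion.2 ⟨P, hP, coeff_mem_coeffs h0⟩)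
      exact ⟨a, ha.symm⟩
  exact (mem_lifts _).1 this

variable {L : Type w} [Field L] [Algebra K L] {φ : A →+* Ω}

variable (A K L) in
/-- The embedding of `A` in `L`. -/
abbrev baseMap : A →+* L := (algebraMap K L).comp (algebraMap A K)

theorem eval₂_baseMap (x : integralClosure (pointRing K φ) L) (Q : A[X]) :
    Q.eval₂ (baseMap A K L) (x : L) =
      (aeval x (Q.map (toPointRing K φ)) : integralClosure (pointRing K φ) L) := by
  rw [aeval_def, Polynomial.eval₂_map]
  change _ = (integralClosure (pointRing K φ) L).val.toRingHom _
  rw [hom_eval₂]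
  rfl

theorem LiesOver.IsExtension.eval₂_eq {W : ValuationSubring L} {h : LiesOver W (pointRing K φ)}
    {ψ : integralClosure (pointRing K φ) L →+* Ω} (hψ : h.IsExtension ψ)
    (x : integralClosure (pointRing K φ) L) (Q : A[X]) :
    ψ (aeval x (Q.map (toPointRing K φ))) = Q.eval₂ φ (ψ x) := by
  rw [aeval_def, Polynomial.eval₂_map, hom_eval₂]
  congr 1
  ext a
  exact hψ.map_toPointRing a

variable [FaithfulSMul A K]

/-- Division by `b`, a unit of the local ring, makes the characteristic polynomial monic. This
carries integrality of `α` over to every point at which `b` is nonzero. -/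
theorem isIntegral_of_map_eq [FiniteDimensional K L] [IsGalois K L] {b : A} (hb : φ b ≠ 0)
    {F : A[X]} {α : L}
    (hF : F.map (baseMap A K L) = C (baseMap A K L b) * ∏ g : L ≃ₐ[K] L, (X - C (g α))) :
    IsIntegral (pointRing K φ) α := by
  obtain ⟨u, hu⟩ := isUnit_toPointRing (K := K) hb
  let i : pointRing K φ →+* L := algebraMap _ _
  have hi : i.comp (toPointRing K φ) = baseMap A K L := rfl
  have hub : i (↑u⁻¹ : pointRing K φ) * baseMap A K L b = 1 := by
    rw [← hi, RingHom.comp_apply, ← map_mul, ← hu, Units.inv_mul, map_one]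
  have hmap : (C (↑u⁻¹ : pointRing K φ) * F.map (toPointRing K φ)).map i =
      ∏ g : L ≃ₐ[K] L, (X - C (g α)) := by
    rw [Polynomial.map_mul, Polynomial.map_map, hi, hF, map_C, ← mul_assoc, ← C_mul, hub, C_1,
      one_mul]
  refine ⟨C (↑u⁻¹ : pointRing K φ) * F.map (toPointRing K φ), ?_, ?_⟩
  · refine Polynomial.monic_of_injective (f := i) (FaithfulSMul.algebraMap_injective _ _) ?_
    rw [hmap]
    exact monic_prod_of_monic _ _ fun g _ ↦ monic_X_sub_C _
  · change eval₂ i α _ = 0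
    rw [← Polynomial.eval_map, hmap, eval_prod]
    exact Finset.prod_eq_zero (Finset.mem_univ 1) (by simp)

omit [FaithfulSMul A K] in
/-- The data at a point that control the decomposition groups at nearby points: an element `α`
with its conjugates `g α`, expressed as polynomials in `α` over `A`. -/
theorem LiesOver.IsExtension.exists_polynomials [FiniteDimensional K L] [IsGalois K L]
    {W : ValuationSubring L} {h : LiesOver W (pointRing K φ)}
    {ψ : integralClosure (pointRing K φ) L →+* Ω} (hψ : h.IsExtension ψ)
    {α : integralClosure (pointRing K φ) L}
    (hα : ∀ g : L ≃ₐ[K] L, g ≠ 1 → ψ (g • α) ≠ ψ α) :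
    ∃ (b : A) (F D : A[X]) (Q : (L ≃ₐ[K] L) → A[X]), φ b ≠ 0 ∧
      F.map (baseMap A K L) = C (baseMap A K L b) * ∏ g : L ≃ₐ[K] L, (X - C (g α)) ∧
      D.eval₂ φ (ψ α) ≠ 0 ∧ ∀ g : L ≃ₐ[K] L, (Q g).eval₂ (baseMap A K L) α =
        g α * D.eval₂ (baseMap A K L) α := by
  classical
  have := h.isInvariant (L := L)
  let S := integralClosure (pointRing K φ) L
  -- `F₀` is the characteristic polynomial of `α`, `D₀` interpolates the product of the `α - h α`,
  -- and `Q₀ g` interpolates that product times `g α`; `b` clears all denominators.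
  obtain ⟨F₀, hF₀⟩ := (mem_lifts _).1
    (Algebra.IsInvariant.charpoly_mem_lifts (pointRing K φ) S (L ≃ₐ[K] L) α)
  obtain ⟨D₀, hD₀⟩ := exists_aeval_eq_mul_prod (R := pointRing K φ) (G := L ≃ₐ[K] L) α 1
  have hQ := fun g : L ≃ₐ[K] L ↦
    exists_aeval_eq_mul_prod (R := pointRing K φ) (G := L ≃ₐ[K] L) α (g • α)
  choose Q₀ hQ₀ using hQ
  obtain ⟨b, hb, hs⟩ := exists_common_denominator_polynomial
    (insert F₀ (insert D₀ (Finset.univ.image Q₀)))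
  obtain ⟨F, hF⟩ := hs F₀ (by simp)
  obtain ⟨D, hD⟩ := hs D₀ (by simp)
  have hQ' := fun g ↦ hs (Q₀ g) (by simp)
  choose Q hQ using hQ'
  refine ⟨b, F, D, Q, hb, ?_, ?_, fun g ↦ ?_⟩
  · let i : S →+* L := S.val.toRingHom
    have h1 : baseMap A K L = (i.comp (algebraMap (pointRing K φ) S)).comp (toPointRing K φ) := rfl
    rw [h1, ← Polynomial.map_map, hF, Polynomial.map_mul, map_C, ← Polynomial.map_map, hF₀,
      MulSemiringAction.charpoly_eq, Polynomial.map_prod]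
    congr 1
    refine Finset.prod_congr rfl fun g _ ↦ ?_
    rw [Polynomial.map_sub, map_X, map_C]
    rfl
  · rw [← hψ.eval₂_eq, hD, map_mul, aeval_C, map_mul, hψ.map_toPointRing, hD₀, one_mul, map_prod]
    refine mul_ne_zero hb (Finset.prod_ne_zero_iff.2 fun g hg ↦ ?_)
    rw [map_sub, sub_ne_zero]
    exact (hα g (Finset.ne_of_mem_erase hg)).symm
  · rw [eval₂_baseMap, eval₂_baseMap, hQ, hD, map_mul, map_mul, hQ₀, hD₀, aeval_C, one_mul]
    push_cast
    rw [← mul_assoc, ← mul_assoc, mul_comm (g (α : L))]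
    rfl

end Denominators

/-! ### Local constancy by Krasner's lemma -/

section LocalConstancy

theorem exists_valuation_le {Ω : Type*} [Field Ω] (V : ValuationSubring Ω) (s : Finset Ω)
    (hs : ∀ x ∈ s, x ≠ 0) : ∃ c ≠ 0, ∀ x ∈ s, V.valuation c ≤ V.valuation x := by
  classical
  induction s using Finset.induction_on with
  | empty => exact ⟨1, one_ne_zero, by simp⟩
  | insert y s _ ih =>
    obtain ⟨c, hc, h⟩ := ih fun x hx ↦ hs x (Finset.mem_insert_of_mem hx)
    rcases le_total (V.valuation c) (V.valuation y) with hle | hle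
    · exact ⟨c, hc, Finset.forall_mem_insert _ _ _ |>.2 ⟨hle, h⟩⟩
    · exact ⟨y, hs y (Finset.mem_insert_self _ _),
        Finset.forall_mem_insert _ _ _ |>.2 ⟨le_rfl, fun x hx ↦ hle.trans (h x hx)⟩⟩

variable {k : Type u} [Field k] {Ω : Type*} [Field Ω] [Algebra k Ω] {V : ValuationSubring Ω}
  {ι : Type*} {l : Filter ι} {A : Type*} [CommRing A]

/-- Krasner's lemma: an isometry fixing an approximation of `y` moves `y` by less than its distance
to any other conjugate, hence not at all. A basis of `ℓ` leaves only finitely many `y` to consider.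
-/
theorem eventually_forall_algHom_eq [Algebra.IsAlgebraic k Ω] {φ₀ : A →+* Ω} {φ : ι → A →+* Ω}
    (hV : ∀ (σ : Ω →ₐ[k] Ω) x, V.valuation (σ x) = V.valuation x)
    (hφ : ∀ a, Tendsto (fun i ↦ φ i a) l (@nhds Ω (valuationTopology V) (φ₀ a)))
    (ℓ : IntermediateField k Ω) [FiniteDimensional k ℓ]
    (hℓ : ∀ y ∈ ℓ, ∃ a b, φ₀ b ≠ 0 ∧ y * φ₀ b = φ₀ a) :
    ∀ᶠ i in l, ∀ σ : Ω →ₐ[k] Ω, (∀ a, σ (φ i a) = φ i a) → ∀ y ∈ ℓ, σ y = y := by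
  classical
  let := Valued.mk' V.valuation
  have single : ∀ y ∈ ℓ, ∀ᶠ i in l, ∀ σ : Ω →ₐ[k] Ω, (∀ a, σ (φ i a) = φ i a) → σ y = y := by
    intro y hy
    obtain ⟨a, b, hb, hab⟩ := hℓ y hy
    have hint : IsIntegral k y := (Algebra.IsAlgebraic.isAlgebraic y).isIntegral
    obtain ⟨c, hc, hle⟩ := exists_valuation_le V
      (((((minpoly k y).rootSet_finite Ω).toFinset.erase y)).image fun z ↦ z - y) (by
        intro x hx
        obtain ⟨z, hz, rfl⟩ := Finset.mem_image.1 hx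
        exact sub_ne_zero.2 (Finset.ne_of_mem_erase hz))
    have ha : Tendsto (fun i ↦ φ i a) l (𝓝 (φ₀ a)) := hφ a
    have hlim : Tendsto (fun i ↦ φ i a / φ i b) l (𝓝 (φ₀ a / φ₀ b)) := ha.div (hφ b) hb
    have hy' : φ₀ a / φ₀ b = y := by rw [← hab, mul_div_cancel_right₀ _ hb]
    rw [hy'] at hlim
    filter_upwards [(tendsto_valuationTopology_iff V _ l y).1 hlim c hc] with i hi σ hσ
    by_contra hne
    have hroot : σ y ∈ (minpoly k y).rootSet Ω := by
      rw [Polynomial.mem_rootSet]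
      exact ⟨minpoly.ne_zero hint, by rw [Polynomial.aeval_algHom_apply, minpoly.aeval, map_zero]⟩
    have h1 := hle (σ y - y) (Finset.mem_image.2 ⟨σ y, by simp [hne, hroot], rfl⟩)
    have h2 : σ y - y = (φ i a / φ i b - y) - σ (φ i a / φ i b - y) := by
      rw [map_sub, map_div₀, hσ, hσ]
      ring
    rw [h2] at h1
    refine absurd (V.valuation.map_sub_lt hi ?_) (not_lt.2 h1)
    rwa [hV]
  let B := Module.finBasis k ℓ
  filter_upwards [eventually_all.2 fun t ↦ single (B t) (B t).2] with i hi σ hσ y hy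
  have h1 : σ.toLinearMap ∘ₗ ℓ.val.toLinearMap = ℓ.val.toLinearMap :=
    B.ext fun t ↦ hi t σ hσ
  exact LinearMap.congr_fun h1 ⟨y, hy⟩

open Polynomial

variable {K : Type v} [Field K] [Algebra A K] [FaithfulSMul A K] {L : Type w} [Field L]
  [Algebra K L] [FiniteDimensional K L] [IsGalois K L]

omit [FaithfulSMul A K] [IsGalois K L] in
theorem LiesOver.IsExtension.map_eq {φ : A →+* Ω} {W : ValuationSubring L}
    {h : LiesOver W (pointRing K φ)} {ψ : integralClosure (pointRing K φ) L →+* Ω}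
    (hψ : h.IsExtension ψ) {b : A} {F : A[X]} {α : integralClosure (pointRing K φ) L}
    (hF : F.map (baseMap A K L) = C (baseMap A K L b) * ∏ g : L ≃ₐ[K] L, (X - C (g (α : L)))) :
    F.map φ = C (φ b) * ∏ g : L ≃ₐ[K] L, (X - C (ψ (g • α))) := by
  let S := integralClosure (pointRing K φ) L
  have h1 : (F.map (toPointRing K φ)).map (algebraMap (pointRing K φ) S) =
      C (algebraMap (pointRing K φ) S (toPointRing K φ b)) *
        ∏ g : L ≃ₐ[K] L, (X - C (g • α)) := by
    refine map_injective (S.val.toRingHom) Subtype.val_injective ?_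
    rw [Polynomial.map_map, Polynomial.map_map, Polynomial.map_mul, map_C, Polynomial.map_prod]
    refine hF.trans ?_
    congr 1
    refine Finset.prod_congr rfl fun g _ ↦ ?_
    rw [Polynomial.map_sub, map_X, map_C]
    rfl
  have h2 := congrArg (Polynomial.map ψ) h1
  rw [Polynomial.map_map, Polynomial.map_map, Polynomial.map_mul, map_C, Polynomial.map_prod,
    hψ.map_toPointRing] at h2
  have h3 : (ψ.comp (algebraMap (pointRing K φ) S)).comp (toPointRing K φ) = φ :=
    RingHom.ext hψ.map_toPointRing
  rw [h3] at h2
  rw [h2]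
  congr 1
  refine Finset.prod_congr rfl fun g _ ↦ ?_
  rw [Polynomial.map_sub, map_X, map_C]

omit [FaithfulSMul A K] [IsGalois K L] in
-- The characteristic polynomial at the point has coefficients fixed by `σ`, so `σ` permutes its
-- roots, which are the values of the conjugates of `α`.
theorem LiesOver.IsExtension.exists_smul_eq {φ : A →+* Ω} {W : ValuationSubring L}
    {h : LiesOver W (pointRing K φ)} {ψ : integralClosure (pointRing K φ) L →+* Ω}
    (hψ : h.IsExtension ψ) {b : A} (hb : φ b ≠ 0) {F : A[X]}
    {α : integralClosure (pointRing K φ) L}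
    (hF : F.map (baseMap A K L) = C (baseMap A K L b) * ∏ g : L ≃ₐ[K] L, (X - C (g (α : L))))
    {σ : Ω →+* Ω} (hσ : ∀ a, σ (φ a) = φ a) : ∃ g : L ≃ₐ[K] L, σ (ψ α) = ψ (g • α) := by
  have h1 := hψ.map_eq hF
  have h2 : (F.map φ).eval (ψ α) = 0 := by
    rw [h1, eval_mul, eval_prod, Finset.prod_eq_zero (Finset.mem_univ 1), mul_zero]
    simp
  have h3 : (F.map φ).map σ = F.map φ := by
    rw [Polynomial.map_map]
    congr 1
    exact RingHom.ext hσ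
  have h4 : (F.map φ).eval (σ (ψ α)) = 0 := by
    rw [← h3, eval_map_apply, h2, map_zero]
  rw [h1, eval_mul, eval_C, mul_eq_zero, eval_prod, Finset.prod_eq_zero_iff] at h4
  obtain ⟨g, -, hg⟩ := h4.resolve_left hb
  exact ⟨g, by simpa [sub_eq_zero] using hg⟩

open scoped Pointwise

/-- Points at which the conjugates of a separating element have nearby values have the same
decomposition groups. -/
theorem decompositionSubgroup_eq_of_close [Algebra.IsAlgebraic k Ω] [IsAlgClosed Ω]
    (hV : ∀ (σ : Ω →ₐ[k] Ω) x, V.valuation (σ x) = V.valuation x) {j : k →+* A}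
    {φ φ' : A →+* Ω} (hj : ∀ c, φ (j c) = algebraMap k Ω c) (hj' : ∀ c, φ' (j c) = algebraMap k Ω c)
    (hφφ' : ∀ σ : Ω →ₐ[k] Ω, (∀ a, σ (φ a) = φ a) ↔ ∀ a, σ (φ' a) = φ' a)
    {W W' : ValuationSubring L} {h : LiesOver W (pointRing K φ)} {h' : LiesOver W' (pointRing K φ')}
    {ψ : integralClosure (pointRing K φ) L →+* Ω} {ψ' : integralClosure (pointRing K φ') L →+* Ω}
    (hψ : h.IsExtension ψ) (hψ' : h'.IsExtension ψ') {α : integralClosure (pointRing K φ) L}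
    {α' : integralClosure (pointRing K φ') L} (hαα' : (α : L) = α')
    (hα : ∀ g : L ≃ₐ[K] L, g ≠ 1 → ψ (g • α) ≠ ψ α) {b : A} (hb : φ b ≠ 0) (hb' : φ' b ≠ 0)
    {F : A[X]}
    (hF : F.map (baseMap A K L) = C (baseMap A K L b) * ∏ g : L ≃ₐ[K] L, (X - C (g (α : L))))
    {c : Ω} (hc : ∀ g g' : L ≃ₐ[K] L, ψ (g • α) ≠ ψ (g' • α) →
      V.valuation c ≤ V.valuation (ψ (g • α) - ψ (g' • α)))
    (hclose : ∀ g : L ≃ₐ[K] L, V.valuation (ψ' (g • α') - ψ (g • α)) < V.valuation c) :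
    W'.decompositionSubgroup K = W.decompositionSubgroup K := by
  -- Distinct values at the first point are at least `c` apart, so a value at the second point is
  -- near to at most one of them.
  have hsep : ∀ g g' : L ≃ₐ[K] L,
      V.valuation (ψ' (g • α') - ψ (g' • α)) < V.valuation c → ψ (g • α) = ψ (g' • α) := by
    intro g g' hlt
    by_contra hne
    refine absurd (V.valuation.map_sub_lt hlt (hclose g)) (not_lt.2 ?_)
    rw [sub_sub_sub_cancel_left]
    exact hc g g' hne
  have hα' : ∀ g : L ≃ₐ[K] L, g ≠ 1 → ψ' (g • α') ≠ ψ' α' := by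
    intro g hg heq
    refine hα g hg ?_
    have := hsep g 1 (by rw [heq]; simpa using hclose 1)
    rwa [one_smul] at this
  have hF' : F.map (baseMap A K L) = C (baseMap A K L b) *
      ∏ g : L ≃ₐ[K] L, (X - C (g (α' : L))) := by rw [← hαα', hF]
  have hdiff : ∀ σ : Ω →ₐ[k] Ω, V.valuation (σ (ψ' α') - σ (ψ α)) < V.valuation c := by
    intro σ
    rw [← map_sub, hV]
    simpa using hclose 1
  ext g
  change g • W' = W' ↔ g • W = W
  constructor
  · intro hg
    obtain ⟨σ, hσ⟩ := h'.exists_algHom_of_smul_eq j hj' hψ' hg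
    have hfix' : ∀ a, σ (φ' a) = φ' a := fun a ↦ by
      rw [← hψ'.map_toPointRing, hσ, smul_algebraMap]
    have hfix := (hφφ' σ).2 hfix'
    obtain ⟨g', hg'⟩ := hψ.exists_smul_eq hb hF (σ := (σ : Ω →+* Ω)) hfix
    have hg' : σ (ψ α) = ψ (g' • α) := hg'
    have h2 := hdiff σ
    rw [hσ, hg'] at h2
    have h3 := hsep g g' h2
    refine hψ.smul_eq (σ := (σ : Ω →+* Ω)) (hψ.algHom_eq hα hfix ?_)
    change σ (ψ α) = _
    rw [hg', h3]
  · intro hg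
    obtain ⟨σ, hσ⟩ := h.exists_algHom_of_smul_eq j hj hψ hg
    have hfix : ∀ a, σ (φ a) = φ a := fun a ↦ by
      rw [← hψ.map_toPointRing, hσ, smul_algebraMap]
    have hfix' := (hφφ' σ).1 hfix
    obtain ⟨g', hg'⟩ := hψ'.exists_smul_eq hb' hF' (σ := (σ : Ω →+* Ω)) hfix'
    have hg' : σ (ψ' α') = ψ' (g' • α') := hg'
    have h2 := hdiff σ
    rw [hσ, hg'] at h2
    have h3 := hsep g' g h2
    have h4 : ∀ s, σ (ψ s) = ψ (g' • s) :=
      hψ.algHom_eq hα (σ := (σ : Ω →+* Ω)) hfix (by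
        change σ (ψ α) = _
        rw [hσ, h3])
    -- Separation is only assumed relative to `α` itself, so the two descriptions of `σ` are
    -- compared at `g⁻¹ • α`.
    have h5 : g' = g := by
      by_contra hne
      refine hα (g' * g⁻¹) (fun h ↦ hne (mul_inv_eq_one.1 h)) ?_
      have h6 := h4 (g⁻¹ • α)
      rw [hσ, smul_inv_smul, smul_smul] at h6
      exact h6.symm
    refine hψ'.smul_eq (σ := (σ : Ω →+* Ω)) (hψ'.algHom_eq hα' hfix' ?_)
    change σ (ψ' α') = _
    rw [hg', h5]

/-- Local constancy of decomposition groups along a convergent family of points. -/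
theorem eventually_conjDecomposition [Algebra.IsAlgebraic k Ω] [IsAlgClosed Ω]
    (hV : ∀ (σ : Ω →ₐ[k] Ω) x, V.valuation (σ x) = V.valuation x) {j : k →+* A}
    {φ₀ : A →+* Ω} {φ : ι → A →+* Ω} (hj₀ : ∀ c, φ₀ (j c) = algebraMap k Ω c)
    (hj : ∀ i c, φ i (j c) = algebraMap k Ω c)
    (hφ : ∀ a, Tendsto (fun i ↦ φ i a) l (@nhds Ω (valuationTopology V) (φ₀ a)))
    (ℓ : IntermediateField k Ω) [FiniteDimensional k ℓ]
    (hℓ : ∀ y ∈ ℓ, ∃ a b, φ₀ b ≠ 0 ∧ y * φ₀ b = φ₀ a) (hℓ₀ : ∀ a, φ₀ a ∈ ℓ)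
    (hℓφ : ∀ i a, φ i a ∈ ℓ) [IsNoetherianRing (pointRing K φ₀)]
    (hR : UnramifiedIn L (pointRing K φ₀)) :
    ∀ᶠ i in l, ConjDecomposition L (pointRing K φ₀) (pointRing K (φ i)) := by
  classical
  by_cases hex : ∃ W : ValuationSubring L, LiesOver W (pointRing K φ₀)
  swap
  · exact Eventually.of_forall fun i W W' hW _ ↦ absurd ⟨W, hW⟩ hex
  obtain ⟨W₀, h₀⟩ := hex
  obtain ⟨ψ₀, hψ₀⟩ := h₀.exists_extension
  obtain ⟨α, hα⟩ := h₀.exists_separating hR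
  replace hα : ∀ g : L ≃ₐ[K] L, g ≠ 1 → ψ₀ (g • α) ≠ ψ₀ α := by
    intro g hg heq
    refine hα g hg ?_
    rw [← hψ₀.eq_zero_iff, map_sub, heq, sub_self]
  obtain ⟨b, F, D, Q, hb, hF, hD, hQ⟩ := hψ₀.exists_polynomials hα
  let := Valued.mk' V.valuation
  replace hφ : ∀ a, Tendsto (fun i ↦ φ i a) l (𝓝 (φ₀ a)) := hφ
  let x₀ := ψ₀ α
  obtain ⟨c, hc, hsep⟩ := exists_valuation_le V
    ((Finset.univ.image fun p : (L ≃ₐ[K] L) × (L ≃ₐ[K] L) ↦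
      ψ₀ (p.1 • α) - ψ₀ (p.2 • α)).erase 0) fun x hx ↦ Finset.ne_of_mem_erase hx
  have hfix := eventually_forall_algHom_eq hV hφ ℓ hℓ
  have hbne : ∀ᶠ i in l, φ i b ≠ 0 := (hφ b).eventually_ne hb
  have hQ₀ : ∀ g : L ≃ₐ[K] L, (Q g).eval₂ φ₀ x₀ = ψ₀ (g • α) * D.eval₂ φ₀ x₀ := by
    intro g
    rw [← hψ₀.eval₂_eq, ← hψ₀.eval₂_eq, ← map_mul]
    congr 1
    refine Subtype.ext ?_
    rw [MulMemClass.coe_mul, ← eval₂_baseMap, ← eval₂_baseMap, hQ]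
    rfl
  -- Joint continuity in the point and in the argument: once one root is near to `x₀`, the quotients
  -- `Q g / D` at that root are near to the values of all conjugates.
  have hpair : ∀ᶠ p in l ×ˢ 𝓝 x₀, D.eval₂ (φ p.1) p.2 ≠ 0 ∧ ∀ g : L ≃ₐ[K] L,
      V.valuation ((Q g).eval₂ (φ p.1) p.2 / D.eval₂ (φ p.1) p.2 - ψ₀ (g • α)) <
        V.valuation c := by
    have hφ' : ∀ a, Tendsto (fun p : ι × Ω ↦ φ p.1 a) (l ×ˢ 𝓝 x₀) (𝓝 (φ₀ a)) :=
      fun a ↦ (hφ a).comp tendsto_fst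
    have hx' : Tendsto (fun p : ι × Ω ↦ p.2) (l ×ˢ 𝓝 x₀) (𝓝 x₀) := tendsto_snd
    have hDlim := tendsto_eval₂ (ρ := fun p : ι × Ω ↦ φ p.1) hφ' hx' D
    refine (hDlim.eventually_ne hD).and (eventually_all.2 fun g ↦ ?_)
    have hlim := (tendsto_eval₂ (ρ := fun p : ι × Ω ↦ φ p.1) hφ' hx' (Q g)).div hDlim hD
    have h1 : (Q g).eval₂ φ₀ x₀ / D.eval₂ φ₀ x₀ = ψ₀ (g • α) := by
      rw [hQ₀, mul_div_cancel_right₀ _ hD]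
    rw [h1] at hlim
    exact (tendsto_valuationTopology_iff V _ _ _).1 hlim c hc
  obtain ⟨pa, hpa, pb, hpb, H⟩ := eventually_prod_iff.1 hpair
  obtain ⟨d, hd, hdpb⟩ := (nhds_valuationTopology_hasBasis V x₀).mem_iff.1 hpb
  have hFlim : Tendsto (fun i ↦ F.eval₂ (φ i) x₀ / φ i b) l (𝓝 0) := by
    have h1 : F.eval₂ φ₀ x₀ / φ₀ b = 0 := by
      rw [← Polynomial.eval_map, hψ₀.map_eq hF, eval_mul, eval_prod,
        Finset.prod_eq_zero (Finset.mem_univ 1), mul_zero, zero_div]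
      simp [x₀]
    rw [← h1]
    exact (tendsto_eval₂ hφ tendsto_const_nhds F).div (hφ b) hb
  -- At `x₀` the quotient `F / b` is a product of as many linear factors as the group has elements.
  -- If it is smaller than the corresponding power of `d`, some factor is smaller than `d`.
  have hFsmall := (tendsto_valuationTopology_iff V _ l 0).1 hFlim
    (d ^ Fintype.card (L ≃ₐ[K] L)) (pow_ne_zero _ hd)
  filter_upwards [hfix, hbne, hpa, hFsmall] with i hfix hbi hpai hFi W W' hW hW'
  obtain ⟨ψ', hψ'⟩ := hW'.exists_extension
  have hint : IsIntegral (pointRing K (φ i)) (α : L) := isIntegral_of_map_eq hbi hF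
  let α' : integralClosure (pointRing K (φ i)) L := ⟨α, hint⟩
  obtain ⟨g₁, hg₁⟩ : ∃ g₁ : L ≃ₐ[K] L, V.valuation (ψ' (g₁ • α') - x₀) < V.valuation d := by
    by_contra! hcon
    rw [sub_zero, ← Polynomial.eval_map, hψ'.map_eq (α := α') hF, eval_mul, eval_C,
      mul_div_cancel_left₀ _ hbi, eval_prod, map_prod, map_pow] at hFi
    refine absurd hFi (not_lt.2 ?_)
    rw [← Finset.card_univ, ← Finset.prod_const]
    refine Finset.prod_le_prod' fun g _ ↦ ?_
    rw [eval_sub, eval_X, eval_C, Valuation.map_sub_swap]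
    exact hcon g
  -- Passing to `g₁⁻¹ • W'` brings the value of `α` itself near to `x₀`. The groups become equal
  -- there, and are conjugate for `W'`.
  have hψ'' := hψ'.comp g₁
  obtain ⟨hDi, hQi⟩ := H hpai (hdpb hg₁)
  have hdec : (g₁⁻¹ • W').decompositionSubgroup K = W₀.decompositionSubgroup K := by
    refine decompositionSubgroup_eq_of_close hV hj₀ (hj i) (fun σ ↦ ⟨fun h a ↦ ?_, fun h a ↦ ?_⟩)
      hψ₀ hψ'' (α := α) (α' := α') rfl hα hb hbi hF (c := c) (fun g g' hne ↦ ?_) (fun g ↦ ?_)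
    -- The values at the nearby point lie in `ℓ`, and `ℓ` consists of quotients of values at the
    -- base point. The converse is the Krasner statement `hfix`.
    · obtain ⟨a', b', hb', hab⟩ := hℓ _ (hℓφ i a)
      refine mul_right_cancel₀ hb' ?_
      rw [hab]
      conv_lhs => rw [← h b', ← map_mul, hab, h]
    · exact hfix σ h _ (hℓ₀ a)
    · exact hsep _ (Finset.mem_erase.2 ⟨sub_ne_zero.2 hne,
        Finset.mem_image.2 ⟨(g, g'), Finset.mem_univ _, rfl⟩⟩)
    · have h1 := hQi g
      have h2 : (Q g).eval₂ (φ i) (ψ' (g₁ • α')) =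
          ψ' (g₁ • g • α') * D.eval₂ (φ i) (ψ' (g₁ • α')) := by
        have h3 := hψ''.eval₂_eq α' (Q g)
        have h4 := hψ''.eval₂_eq α' D
        simp only [RingHom.comp_apply, MulSemiringAction.toRingHom_apply] at h3 h4
        rw [← h3, ← h4, ← map_mul, ← smul_mul']
        congr 2
        refine Subtype.ext ?_
        rw [MulMemClass.coe_mul, ← eval₂_baseMap, ← eval₂_baseMap]
        exact hQ g
      rw [h2, mul_div_cancel_right₀ _ hDi] at h1
      exact h1
  obtain ⟨γ, rfl⟩ := hW.exists_smul_eq h₀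
  refine ⟨g₁ * γ, ?_⟩
  have h1 : W' = g₁ • g₁⁻¹ • W' := (smul_inv_smul _ _).symm
  rw [h1]
  change MulAction.stabilizer _ _ = _
  rw [MulAction.stabilizer_smul_eq_stabilizer_map_conj]
  change ((g₁⁻¹ • W').decompositionSubgroup K).map _ = _
  rw [hdec]
  change (MulAction.stabilizer _ _).map _ = _
  rw [MulAction.stabilizer_smul_eq_stabilizer_map_conj, Subgroup.map_map,
    map_mul]
  rfl

end LocalConstancy

/-! ### Scheme-valued points as ring homomorphisms -/

section Points

variable {k : Type u} [Field k] {C : Scheme.{u}} {s : C ⟶ Spec (CommRingCat.of k)} {p : C}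

variable (s p) in
/-- Points with values in the residue field of `p`, on an affine open. -/
abbrev AffineResiduePoints (V : C.affineOpens) : Type u :=
  AffinePoints s (C.fromSpecResidueField p ≫ s) V

/-- The point of `C(k(p))` given by a point on an affine open. -/
abbrev AffineResiduePoints.toResiduePoint {V : C.affineOpens} (φ : AffineResiduePoints s p V) :
    ResiduePoints s p := AffinePoints.toPoints s _ V φ

variable (s) in
/-- The structure map `k → Γ(C, V)`. -/
def affineMap (V : C.affineOpens) : k →+* Γ(C, V.1) := (Spec.preimage (V.2.fromSpec ≫ s)).hom

theorem affinePoint_iff {V : C.affineOpens} (φ : Γ(C, V.1) ⟶ C.residueField p) :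
    (Spec.map φ ≫ V.2.fromSpec) ≫ s = C.fromSpecResidueField p ≫ s ↔
      ∀ c, φ.hom (affineMap s V c) = residueMap s p c := by
  have h1 : (Spec.map φ ≫ V.2.fromSpec) ≫ s = Spec.map (Spec.preimage (V.2.fromSpec ≫ s) ≫ φ) := by
    rw [Spec.map_comp, Spec.map_preimage, Category.assoc]
  have h2 : C.fromSpecResidueField p ≫ s =
      Spec.map (Spec.preimage (C.fromSpecResidueField p ≫ s)) := (Spec.map_preimage _).symm
  rw [h1]
  conv_lhs => rw [h2]
  rw [Spec.map_inj]
  constructor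
  · intro h c
    exact congrArg (fun f ↦ f.hom c) h
  · intro h
    ext c
    exact h c

theorem AffineResiduePoints.toResiduePoint_injective {V : C.affineOpens} :
    Function.Injective (AffineResiduePoints.toResiduePoint (s := s) (p := p) (V := V)) := by
  intro φ φ' h
  have h : Spec.map φ.1 ≫ V.2.fromSpec = Spec.map φ'.1 ≫ V.2.fromSpec := congrArg Subtype.val h
  have hV : IsAffineOpen V.1 := V.2
  exact Subtype.ext (Spec.map_inj.1 ((cancel_mono hV.fromSpec).1 h))

theorem AffineResiduePoints.pt_eq {V : C.affineOpens} (φ : AffineResiduePoints s p V) :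
    φ.toResiduePoint.pt = V.2.fromSpec
      (Spec.map φ.1 (IsLocalRing.closedPoint (C.residueField p))) := rfl

theorem AffineResiduePoints.pt_mem {V : C.affineOpens} (φ : AffineResiduePoints s p V) :
    φ.toResiduePoint.pt ∈ V.1 := by
  rw [φ.pt_eq, ← SetLike.mem_coe, ← V.2.range_fromSpec]
  exact Set.mem_range_self _

theorem AffineResiduePoints.pt_mem_basicOpen_iff {V : C.affineOpens}
    (φ : AffineResiduePoints s p V) (b : Γ(C, V.1)) :
    φ.toResiduePoint.pt ∈ C.basicOpen b ↔ φ.1.hom b ≠ 0 := by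
  have h1 : φ.toResiduePoint.pt ∈ C.basicOpen b ↔
      Spec.map φ.1 (IsLocalRing.closedPoint (C.residueField p)) ∈
        V.2.fromSpec ⁻¹ᵁ C.basicOpen b := Iff.rfl
  rw [h1, V.2.fromSpec_preimage_basicOpen]
  change ¬ (φ.1.hom b ∈ IsLocalRing.maximalIdeal (C.residueField p)) ↔ _
  rw [IsLocalRing.maximalIdeal_eq_bot, Ideal.mem_bot]

theorem ResiduePoints.exists_affine (P : ResiduePoints s p) {V : C.affineOpens}
    (hP : P.pt ∈ V.1) : ∃ φ : AffineResiduePoints s p V, φ.toResiduePoint = P := by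
  have hV : IsAffineOpen V.1 := V.2
  have hrange : Set.range P.1 ⊆ Set.range hV.fromSpec := by
    rintro _ ⟨x, rfl⟩
    rw [hV.range_fromSpec, Subsingleton.elim x (IsLocalRing.closedPoint (C.residueField p))]
    exact hP
  obtain ⟨φ, hφ⟩ := Spec.map_surjective (IsOpenImmersion.lift hV.fromSpec P.1 hrange)
  have h : Spec.map φ ≫ hV.fromSpec = P.1 := by rw [hφ, IsOpenImmersion.lift_fac]
  exact ⟨⟨φ, by rw [h]; exact P.2⟩, Subtype.ext h⟩

theorem ResiduePoints.pt_self : (ResiduePoints.self s p).pt = p :=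
  Scheme.fromSpecResidueField_apply _ _

/-- Both sides consist of the fractions of sections over `V` with denominator not vanishing at `q`.
-/
theorem placeRing_eq_pointRing [IsIntegral C] {K : Type v} [Field K] (i : C.functionField →+* K)
    {V : C.affineOpens} [Nonempty V.1] [Algebra Γ(C, V.1) K]
    (halg : algebraMap Γ(C, V.1) K = i.comp (C.germToFunctionField V.1).hom) {q : C}
    (hq : q ∈ V.1) {Ω : Type*} [Field Ω] {φ : Γ(C, V.1) →+* Ω}
    (hφ : ∀ b, φ b ≠ 0 ↔ q ∈ C.basicOpen b) : placeRing i q = pointRing K φ := by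
  have hloc := V.2.isLocalization_stalk ⟨q, hq⟩
  let := C.presheaf.algebra_section_stalk (⟨q, hq⟩ : V.1)
  have hgerm : ∀ a : Γ(C, V.1), i (algebraMap (C.presheaf.stalk q) C.functionField
      (C.presheaf.germ V.1 q hq a)) = algebraMap Γ(C, V.1) K a := by
    intro a
    rw [Scheme.algebraMap_germ_eq_germToFunctionField, halg]
    rfl
  have hunit : ∀ b, IsUnit (C.presheaf.germ V.1 q hq b) ↔ φ b ≠ 0 := by
    intro b
    rw [hφ, C.mem_basicOpen b q hq]
  ext x
  constructor
  · rintro ⟨y, rfl⟩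
    obtain ⟨⟨a, b⟩, hab⟩ := IsLocalization.surj (V.2.primeIdealOf ⟨q, hq⟩).asIdeal.primeCompl y
    have hb : IsUnit (C.presheaf.germ V.1 q hq b.1) :=
      IsLocalization.map_units (C.presheaf.stalk q) b
    refine ⟨a, b.1, (hunit _).1 hb, ?_⟩
    rw [← hgerm, ← hgerm, RingHom.comp_apply, ← map_mul, ← map_mul]
    exact congrArg _ (congrArg _ hab)
  · rintro ⟨a, b, hb, hx⟩
    obtain ⟨u, hu⟩ := (hunit b).2 hb
    refine ⟨C.presheaf.germ V.1 q hq a * ↑u⁻¹, ?_⟩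
    have hne : algebraMap Γ(C, V.1) K b ≠ 0 := by
      rw [← hgerm, ← hu]
      exact (u.isUnit.map (i.comp (algebraMap (C.presheaf.stalk q) C.functionField))).ne_zero
    refine mul_right_cancel₀ hne ?_
    rw [hx, ← hgerm, ← hgerm, RingHom.comp_apply, ← map_mul, ← map_mul, ← hu, mul_assoc,
      Units.inv_mul, mul_one]

end Points

/-! ### The glued topology on affine opens -/

section PointsTopology

variable {k : Type u} [Field k] {C : Scheme.{u}} {s : C ⟶ Spec (CommRingCat.of k)} {p : C}

/-- The topology on the points of an affine open. -/
abbrev affineTopology (O : ValuationSubring (C.residueField p)) (V : C.affineOpens) :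
    TopologicalSpace (AffineResiduePoints s p V) :=
  ⨅ f : Γ(C, V.1), TopologicalSpace.induced (fun φ ↦ φ.1.hom f) (valuationTopology O)

theorem tendsto_affineTopology_iff (O : ValuationSubring (C.residueField p)) {V : C.affineOpens}
    {ι : Type*} {l : Filter ι} {Φ : ι → AffineResiduePoints s p V} {φ : AffineResiduePoints s p V} :
    Tendsto Φ l (@nhds _ (affineTopology O V) φ) ↔ ∀ h, Tendsto (fun i ↦ (Φ i).1.hom h) l
      (@nhds _ (valuationTopology O) (φ.1.hom h)) := by
  let := valuationTopology O
  rw [nhds_iInf, tendsto_iInf]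
  refine forall_congr' fun h ↦ ?_
  rw [nhds_induced, tendsto_comap_iff]
  rfl

theorem IsOpenFor.preimage {O : ValuationSubring (C.residueField p)} {U : Set (ResiduePoints s p)}
    (hU : IsOpenFor s p O U) (V : C.affineOpens) :
    IsOpen[affineTopology O V] (AffineResiduePoints.toResiduePoint ⁻¹' U) := by
  have h := isOpen_iSup_iff.1 hU V
  rwa [isOpen_coinduced] at h

theorem AffineResiduePoints.exists_restrict {V V' W : C.affineOpens} (hW : W.1 ≤ V.1)
    (hW' : W.1 ≤ V'.1) {φ : AffineResiduePoints s p V} {φ' : AffineResiduePoints s p V'}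
    (h : φ.toResiduePoint = φ'.toResiduePoint) (hpt : φ.toResiduePoint.pt ∈ W.1) :
    ∃ χ : Γ(C, W.1) →+* C.residueField p,
      (∀ a, χ ((C.presheaf.map (homOfLE hW).op).hom a) = φ.1.hom a) ∧
      ∀ a, χ ((C.presheaf.map (homOfLE hW').op).hom a) = φ'.1.hom a := by
  obtain ⟨χ, hχ⟩ := φ.toResiduePoint.exists_affine hpt
  have key : ∀ {V : C.affineOpens} (hW : W.1 ≤ V.1) {φ : AffineResiduePoints s p V},
      φ.toResiduePoint = χ.toResiduePoint →
      ∀ a, χ.1.hom ((C.presheaf.map (homOfLE hW).op).hom a) = φ.1.hom a := by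
    intro V hW φ hφ a
    have hV : IsAffineOpen V.1 := V.2
    have hWa : IsAffineOpen W.1 := W.2
    have h1 : Spec.map φ.1 ≫ hV.fromSpec = Spec.map χ.1 ≫ hWa.fromSpec := congrArg Subtype.val hφ
    have h2 : Spec.map φ.1 ≫ hV.fromSpec =
        Spec.map (C.presheaf.map (homOfLE hW).op ≫ χ.1) ≫ hV.fromSpec := by
      rw [Spec.map_comp, Category.assoc, hV.map_fromSpec hWa]
      exact h1
    rw [Spec.map_inj.1 ((cancel_mono hV.fromSpec).1 h2)]
    rfl
  exact ⟨χ.1.hom, key hW hχ.symm, key hW' (h.symm.trans hχ.symm)⟩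

/-- The points of an affine open form an open subspace of the set of all points. -/
theorem isOpenFor_image {O : ValuationSubring (C.residueField p)} {V : C.affineOpens}
    {N : Set (AffineResiduePoints s p V)} (hN : IsOpen[affineTopology O V] N) :
    IsOpenFor s p O (AffineResiduePoints.toResiduePoint '' N) := by
  classical
  refine isOpen_iSup_iff.2 fun V' ↦ ?_
  rw [isOpen_coinduced]
  let := affineTopology (s := s) O V'
  let := Valued.mk' O.valuation
  change IsOpen (AffineResiduePoints.toResiduePoint ⁻¹' _)
  rw [isOpen_iff_mem_nhds]
  rintro φ' ⟨φ, hφN, hφ⟩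
  have hφ : φ.toResiduePoint = φ'.toResiduePoint := hφ
  obtain ⟨f, g, hfg, hx⟩ := exists_basicOpen_le_affine_inter V.2 V'.2 φ.toResiduePoint.pt
    ⟨φ.pt_mem, by rw [hφ]; exact φ'.pt_mem⟩
  let W : C.affineOpens := ⟨C.basicOpen g, V'.2.basicOpen g⟩
  have hWV' : W.1 ≤ V'.1 := C.basicOpen_le g
  have hWV : W.1 ≤ V.1 := by
    change C.basicOpen g ≤ _
    rw [← hfg]
    exact C.basicOpen_le f
  have hgφ' : φ'.1.hom g ≠ 0 := by
    rw [← φ'.pt_mem_basicOpen_iff, ← hφ, ← hfg]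
    exact hx
  have hex : ∀ φ'' : AffineResiduePoints s p V', φ''.1.hom g ≠ 0 →
      ∃ φ : AffineResiduePoints s p V, φ.toResiduePoint = φ''.toResiduePoint := by
    intro φ'' h
    exact φ''.toResiduePoint.exists_affine (hWV ((φ''.pt_mem_basicOpen_iff g).2 h))
  -- On the basic open set of `g`, a function from `V` is a function from `V'` divided by a power of
  -- `g`. This makes the transition map continuous.
  have hval : ∀ h : Γ(C, V.1), ∃ (a : Γ(C, V'.1)) (n : ℕ), ∀ (φ : AffineResiduePoints s p V)
      (φ'' : AffineResiduePoints s p V'), φ''.1.hom g ≠ 0 →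
      φ.toResiduePoint = φ''.toResiduePoint → φ.1.hom h = φ''.1.hom a / φ''.1.hom g ^ n := by
    intro h
    have hloc := V'.2.isLocalization_basicOpen g
    obtain ⟨⟨a, ⟨_, n, rfl⟩⟩, ha⟩ := IsLocalization.surj (Submonoid.powers g)
      ((C.presheaf.map (homOfLE hWV).op).hom h : Γ(C, W.1))
    refine ⟨a, n, fun φ φ'' hg heq ↦ ?_⟩
    obtain ⟨χ, h1, h2⟩ := AffineResiduePoints.exists_restrict hWV hWV' heq (by
      rw [heq]; exact (φ''.pt_mem_basicOpen_iff g).2 hg)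
    have h3 := congrArg χ ha
    rw [eq_div_iff (pow_ne_zero n hg), ← h1, ← h2, ← h2, ← map_pow, ← map_pow, ← map_mul]
    exact h3
  -- The transition map; the default `φ` occurs only where `g` vanishes, away from a neighbourhood
  -- of `φ'`.
  let Φ : AffineResiduePoints s p V' → AffineResiduePoints s p V := fun φ'' ↦
    if h : φ''.1.hom g ≠ 0 then (hex φ'' h).choose else φ
  have hΦ : ∀ φ'', φ''.1.hom g ≠ 0 → (Φ φ'').toResiduePoint = φ''.toResiduePoint := by
    intro φ'' h
    simp only [Φ, dif_pos h]
    exact (hex φ'' h).choose_spec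
  have hev : ∀ a : Γ(C, V'.1), Tendsto (fun φ'' : AffineResiduePoints s p V' ↦ φ''.1.hom a) (𝓝 φ')
      (𝓝 (φ'.1.hom a)) := (tendsto_affineTopology_iff O).1 tendsto_id
  have hne : ∀ᶠ φ'' in 𝓝 φ', φ''.1.hom g ≠ 0 := (hev g).eventually_ne hgφ'
  have hlim : Tendsto Φ (𝓝 φ') (@nhds _ (affineTopology O V) φ) := by
    refine (tendsto_affineTopology_iff O).2 fun h ↦ ?_
    obtain ⟨a, n, han⟩ := hval h
    rw [han φ φ' hgφ' hφ]
    refine Tendsto.congr' ?_ ((hev a).div ((hev g).pow n) (pow_ne_zero n hgφ'))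
    filter_upwards [hne] with φ'' h''
    exact (han _ _ h'' (hΦ φ'' h'')).symm
  have hmem : ∀ᶠ φ'' in 𝓝 φ', Φ φ'' ∈ N := by
    let := affineTopology (s := s) O V
    exact hlim (IsOpen.mem_nhds hN hφN)
  filter_upwards [hmem, hne] with φ'' h1 h2
  exact ⟨Φ φ'', h1, hΦ φ'' h2⟩

theorem exists_isOpenFor_of_eventually {O : ValuationSubring (C.residueField p)}
    {V : C.affineOpens} {φ : AffineResiduePoints s p V} {q : AffineResiduePoints s p V → Prop}
    (h : ∀ᶠ φ' in @nhds _ (affineTopology O V) φ, q φ') :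
    ∃ U : Set (ResiduePoints s p), IsOpenFor s p O U ∧ φ.toResiduePoint ∈ U ∧
      ∀ P ∈ U, ∃ φ' : AffineResiduePoints s p V, φ'.toResiduePoint = P ∧ q φ' := by
  let := affineTopology (s := s) O V
  obtain ⟨N, hN, hNo, hφ⟩ := eventually_nhds_iff.1 h
  refine ⟨_, isOpenFor_image hNo, ⟨φ, hφ, rfl⟩, ?_⟩
  rintro _ ⟨φ', hφ', rfl⟩
  exact ⟨φ', rfl, hN φ' hφ'⟩

/-- The family eventually enters `U`. On a finite `U` the function `f` would have finitely many
values, all of which the family eventually avoids. -/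
theorem infinite_of_tendsto {O : ValuationSubring (C.residueField p)} {V : C.affineOpens}
    {φ : AffineResiduePoints s p V} {ι : Type*} {l : Filter ι} [l.NeBot]
    {Φ : ι → AffineResiduePoints s p V} (hΦ : Tendsto Φ l (@nhds _ (affineTopology O V) φ))
    {f : Γ(C, V.1)} (hf : ∀ c, ∀ᶠ i in l, (Φ i).1.hom f ≠ c) {U : Set (ResiduePoints s p)}
    (hU : IsOpenFor s p O U) (hφ : φ.toResiduePoint ∈ U) : U.Infinite := by
  intro hfin
  have h1 : ∀ᶠ i in l, (Φ i).toResiduePoint ∈ U := by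
    let := affineTopology (s := s) O V
    exact hΦ (IsOpen.mem_nhds (hU.preimage V) hφ)
  have hfin' : ((fun φ : AffineResiduePoints s p V ↦ φ.1.hom f) ''
      (AffineResiduePoints.toResiduePoint ⁻¹' U)).Finite :=
    (hfin.preimage AffineResiduePoints.toResiduePoint_injective.injOn).image _
  have h2 := (Set.Finite.eventually_all hfin').2 fun c _ ↦ hf c
  obtain ⟨i, h3, h4⟩ := (h1.and h2).exists
  exact h4 _ ⟨Φ i, h3, rfl⟩ rfl

end PointsTopology

/-! ### Passage to an algebraic closure of the residue field -/

section FiniteExtension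

/-- Any valuation ring above the prescribed `O'` is also above `O`, and uniqueness over `k` makes it
stable. -/
theorem exists_valuationSubring_isometry {k : Type*} {ℓ : Type*} [Field k] [Field ℓ] [Algebra k ℓ]
    {O : ValuationSubring k} [HenselianLocalRing O] {O' : ValuationSubring ℓ}
    (h : O'.comap (algebraMap k ℓ) = O) (Ω : Type*) [Field Ω] [IsAlgClosed Ω] [Algebra ℓ Ω]
    [Algebra k Ω] [IsScalarTower k ℓ Ω] [Algebra.IsAlgebraic k Ω] :
    ∃ V : ValuationSubring Ω, V.comap (algebraMap ℓ Ω) = O' ∧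
      (∀ (σ : Ω →ₐ[k] Ω) (x : Ω), σ x ∈ V ↔ x ∈ V) ∧
      ∀ (σ : Ω →ₐ[k] Ω) (x : Ω), V.valuation (σ x) = V.valuation x := by
  obtain ⟨V, hV⟩ := exists_valuationSubring_comap_eq O' Ω
  have hVk : V.comap (algebraMap k Ω) = O := by
    rw [← h, ← hV, IsScalarTower.algebraMap_eq k ℓ Ω]
    rfl
  have hmem : ∀ (σ : Ω →ₐ[k] Ω) (x : Ω), σ x ∈ V ↔ x ∈ V :=
    fun σ x ↦ mem_valuationSubring_algHom_iff hVk σ x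
  exact ⟨V, hV, hmem, fun σ x ↦ valuation_algHom_eq σ (hmem σ) x⟩

theorem pointRing_comp {A : Type*} [CommRing A] {K : Type*} [Field K] [Algebra A K]
    {Ω Ω' : Type*} [Field Ω] [Field Ω'] (φ : A →+* Ω) (f : Ω →+* Ω') :
    pointRing K (f.comp φ) = pointRing K φ := by
  ext x
  simp only [mem_pointRing, RingHom.comp_apply, map_ne_zero]

/-- Local constancy of decomposition groups along a convergent family of points with values in a
finite extension of a henselian field. -/
theorem eventually_conjDecomposition_of_finite {k : Type*} {ℓ : Type*} [Field k] [Field ℓ]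
    [Algebra k ℓ] [FiniteDimensional k ℓ] {O : ValuationSubring k} [HenselianLocalRing O]
    {O' : ValuationSubring ℓ} (h : O'.comap (algebraMap k ℓ) = O) {A : Type*} [CommRing A]
    {K : Type v} [Field K] [Algebra A K] [FaithfulSMul A K] {L : Type w} [Field L] [Algebra K L]
    [FiniteDimensional K L] [IsGalois K L] {j : k →+* A} {φ₀ : A →+* ℓ} {ι : Type*} {l : Filter ι}
    {φ : ι → A →+* ℓ} (hj₀ : ∀ c, φ₀ (j c) = algebraMap k ℓ c)
    (hj : ∀ i c, φ i (j c) = algebraMap k ℓ c)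
    (hφ : ∀ a, Tendsto (fun i ↦ φ i a) l (@nhds ℓ (valuationTopology O') (φ₀ a)))
    (hℓ : ∀ y, ∃ a b, φ₀ b ≠ 0 ∧ y * φ₀ b = φ₀ a) [IsNoetherianRing (pointRing K φ₀)]
    (hR : UnramifiedIn L (pointRing K φ₀)) :
    ∀ᶠ i in l, ConjDecomposition L (pointRing K φ₀) (pointRing K (φ i)) := by
  let Ω := AlgebraicClosure ℓ
  have : Algebra.IsAlgebraic k Ω := Algebra.IsAlgebraic.trans k ℓ Ω
  obtain ⟨V, hV, -, hiso⟩ := exists_valuationSubring_isometry h Ω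
  let e := algebraMap ℓ Ω
  have h1 := pointRing_comp (K := K) φ₀ e
  have : IsNoetherianRing (pointRing K (e.comp φ₀)) := by rw [h1]; infer_instance
  have hfin : FiniteDimensional k (IsScalarTower.toAlgHom k ℓ Ω).fieldRange :=
    Module.Finite.equiv (AlgEquiv.ofInjectiveField (IsScalarTower.toAlgHom k ℓ Ω)).toLinearEquiv
  have key := eventually_conjDecomposition (K := K) (L := L) (j := j) (φ₀ := e.comp φ₀)
    (φ := fun i ↦ e.comp (φ i)) (l := l) hiso (fun c ↦ by
      rw [RingHom.comp_apply, hj₀, ← IsScalarTower.algebraMap_apply]) (fun i c ↦ by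
      rw [RingHom.comp_apply, hj, ← IsScalarTower.algebraMap_apply])
    (fun a ↦ (tendsto_algebraMap_valuationTopology_iff hV _ _ _).2 (hφ a))
    (IsScalarTower.toAlgHom k ℓ Ω).fieldRange (by
      rintro _ ⟨y, rfl⟩
      obtain ⟨a, b, hb, hab⟩ := hℓ y
      refine ⟨a, b, (map_ne_zero e).2 hb, ?_⟩
      rw [RingHom.comp_apply, RingHom.comp_apply, ← hab, map_mul]
      rfl) (fun a ↦ ⟨φ₀ a, rfl⟩) (fun i a ↦ ⟨φ i a, rfl⟩) (by rwa [h1])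
  simpa only [pointRing_comp] using key

end FiniteExtension

/-! ### The neighbourhood of constancy and the underlying closed points -/

section ConstancyOnPoints

variable {k : Type u} [Field k] {C : Scheme.{u}} {s : C ⟶ Spec (CommRingCat.of k)} {p : C}

variable (s) in
/-- The point `p` as a point of an affine open. -/
def affineSelf (V : C.affineOpens) (hp : p ∈ V.1) : AffineResiduePoints s p V :=
  ⟨C.evaluation V.1 p hp, by
    have hV : IsAffineOpen V.1 := V.2
    rw [← C.germ_residue, Spec.map_comp, Category.assoc]
    change (_ ≫ hV.fromSpecStalk hp) ≫ s = _
    rw [hV.fromSpecStalk_eq_fromSpecStalk]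
    rfl⟩

theorem affineSelf_toResiduePoint (V : C.affineOpens) (hp : p ∈ V.1) :
    (affineSelf s V hp).toResiduePoint = ResiduePoints.self s p := by
  have hV : IsAffineOpen V.1 := V.2
  refine Subtype.ext ?_
  change Spec.map (C.evaluation V.1 p hp) ≫ hV.fromSpec = _
  rw [← C.germ_residue, Spec.map_comp, Category.assoc]
  change _ ≫ hV.fromSpecStalk hp = _
  rw [hV.fromSpecStalk_eq_fromSpecStalk]
  rfl

theorem affineSelf_surjective (V : C.affineOpens) (hp : p ∈ V.1) (y : C.residueField p) :
    ∃ a b, (affineSelf s V hp).1.hom b ≠ 0 ∧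
      y * (affineSelf s V hp).1.hom b = (affineSelf s V hp).1.hom a := by
  obtain ⟨z, rfl⟩ := C.residue_surjective p y
  have hloc := V.2.isLocalization_stalk ⟨p, hp⟩
  let := C.presheaf.algebra_section_stalk (⟨p, hp⟩ : V.1)
  obtain ⟨⟨a, b⟩, hab⟩ := IsLocalization.surj (V.2.primeIdealOf ⟨p, hp⟩).asIdeal.primeCompl z
  have hb : IsUnit (C.presheaf.germ V.1 p hp b.1) :=
    IsLocalization.map_units (C.presheaf.stalk p) b
  refine ⟨a, b.1, (hb.map (C.residue p).hom).ne_zero, ?_⟩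
  have h1 := congrArg (C.residue p).hom hab
  rw [map_mul] at h1
  exact h1

variable {K : Type v} [Field K] {L : Type w} [Field L] [Algebra K L] [FiniteDimensional K L]
  [IsGalois K L]

/-- The decomposition group is locally constant on the rational points. -/
theorem exists_isOpenFor_conjDecomposition [IsIntegral C] (i : C.functionField →+* K)
    {O : ValuationSubring k} [HenselianLocalRing O] {O' : ValuationSubring (C.residueField p)}
    (h : Extends s p O O') (hfin : (residueMap s p).Finite) [IsNoetherianRing (placeRing i p)]
    (hR : UnramifiedIn L (placeRing i p)) :
    ∃ U : Set (ResiduePoints s p), IsOpenFor s p O' U ∧ ResiduePoints.self s p ∈ U ∧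
      ∀ P ∈ U, ConjDecomposition L (placeRing i p) (placeRing i P.pt) := by
  obtain ⟨_, ⟨V, hV, rfl⟩, hpV, -⟩ :=
    C.isBasis_affineOpens.exists_subset_of_mem_open (Set.mem_univ p) isOpen_univ
  let V : C.affineOpens := ⟨V, hV⟩
  have hp : p ∈ V.1 := hpV
  have : Nonempty V.1 := ⟨⟨p, hp⟩⟩
  let := (residueMap s p).toAlgebra
  have : FiniteDimensional k (C.residueField p) := hfin
  let : Algebra Γ(C, V.1) K := (i.comp (C.germToFunctionField V.1).hom).toAlgebra
  have : FaithfulSMul Γ(C, V.1) K := (faithfulSMul_iff_algebraMap_injective _ _).2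
    (i.injective.comp (C.germToFunctionField_injective V.1))
  have hself : (affineSelf s V hp).toResiduePoint.pt = p := by
    rw [affineSelf_toResiduePoint, ResiduePoints.pt_self]
  have hpr : ∀ φ : AffineResiduePoints s p V,
      placeRing i φ.toResiduePoint.pt = pointRing K φ.1.hom := fun φ ↦
    placeRing_eq_pointRing i rfl φ.pt_mem fun b ↦ (φ.pt_mem_basicOpen_iff b).symm
  have hpr₀ : placeRing i p = pointRing K (affineSelf s V hp).1.hom := by rw [← hpr, hself]
  have : IsNoetherianRing (pointRing K (affineSelf s V hp).1.hom) := by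
    rw [← hpr₀]; infer_instance
  let := affineTopology (s := s) O' V
  have key := eventually_conjDecomposition_of_finite (K := K) (L := L) (O := O) (O' := O') h
    (j := affineMap s V) (φ₀ := (affineSelf s V hp).1.hom)
    (φ := fun φ : AffineResiduePoints s p V ↦ φ.1.hom) (l := 𝓝 (affineSelf s V hp))
    ((affinePoint_iff _).1 (affineSelf s V hp).2) (fun φ ↦ (affinePoint_iff _).1 φ.2)
    ((tendsto_affineTopology_iff O').1 tendsto_id) (affineSelf_surjective V hp) (by rwa [← hpr₀])
  obtain ⟨U, hU, hmem, hUq⟩ := exists_isOpenFor_of_eventually key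
  refine ⟨U, hU, by rwa [← affineSelf_toResiduePoint V hp], fun P hP ↦ ?_⟩
  obtain ⟨φ, rfl, hφ⟩ := hUq P hP
  rwa [hpr, hpr₀]

/-- On each affine open the functions take values in a subring of `k(p)` integral over `k`, which is
a field; so the kernel is maximal and has no proper specialisation. -/
theorem ResiduePoints.isClosed_pt (hint : (residueMap s p).IsIntegral) (P : ResiduePoints s p) :
    IsClosed {P.pt} := by
  have key : ∀ y, P.pt ⤳ y → y = P.pt := by
    intro y hy
    obtain ⟨_, ⟨V, hV, rfl⟩, hyV, -⟩ :=
      C.isBasis_affineOpens.exists_subset_of_mem_open (Set.mem_univ y) isOpen_univ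
    let V : C.affineOpens := ⟨V, hV⟩
    have hyV : y ∈ V.1 := hyV
    have hPV : P.pt ∈ V.1 := hy.mem_open V.1.isOpen hyV
    obtain ⟨φ, rfl⟩ := P.exists_affine hPV
    let := (residueMap s p).toAlgebra
    let := (affineMap s V).toAlgebra
    have : Algebra.IsIntegral k (C.residueField p) := ⟨hint⟩
    let f : Γ(C, V.1) →ₐ[k] C.residueField p :=
      { φ.1.hom with commutes' := (affinePoint_iff _).1 φ.2 }
    have hfield : IsField f.range := Subalgebra.isField_of_algebraic f.range
    have hmax : (RingHom.ker φ.1.hom).IsMaximal := by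
      have hfield' : IsField φ.1.hom.range := hfield
      exact Ideal.Quotient.maximal_of_isField _
        (MulEquiv.isField hfield' (RingHom.quotientKerEquivRange φ.1.hom).toMulEquiv)
    have hV' : IsAffineOpen V.1 := V.2
    obtain ⟨z, rfl⟩ : y ∈ Set.range hV'.fromSpec := by rw [hV'.range_fromSpec]; exact hyV
    rw [φ.pt_eq, hV'.fromSpec.isOpenEmbedding.isInducing.specializes_iff] at hy
    replace hy := (PrimeSpectrum.le_iff_specializes _ z).2 hy
    rw [φ.pt_eq]
    congr 1
    refine PrimeSpectrum.ext ?_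
    have h1 : (Spec.map φ.1 (IsLocalRing.closedPoint (C.residueField p))).asIdeal =
        RingHom.ker φ.1.hom := by
      change Ideal.comap φ.1.hom (IsLocalRing.maximalIdeal (C.residueField p)) = _
      rw [IsLocalRing.maximalIdeal_eq_bot]
      rfl
    have h2 : RingHom.ker φ.1.hom ≤ z.asIdeal := by rw [← h1]; exact hy
    rw [h1]
    exact (hmax.eq_of_le z.2.ne_top h2).symm
  rw [← closure_subset_iff_isClosed]
  intro y hy
  exact key y (specializes_iff_mem_closure.2 hy)

/-- Several elements of `C(k(p))` may have one underlying point, but `f` satisfies the same monic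
equation over `k` at all of them. So only finitely many values of `f` occur over each point. -/
theorem infinite_setOf_pt (hint : (residueMap s p).IsIntegral) {V : C.affineOpens} {ι : Type*}
    {l : Filter ι} [l.NeBot] {Φ : ι → AffineResiduePoints s p V} {f : Γ(C, V.1)}
    (hf : ∀ c, ∀ᶠ i in l, (Φ i).1.hom f ≠ c) {T : Set C}
    (hT : ∀ᶠ i in l, (Φ i).toResiduePoint.pt ∈ T) : T.Infinite := by
  classical
  intro hfin
  have h1 : ∀ q ∈ T, ∀ᶠ i in l, (Φ i).toResiduePoint.pt ≠ q := by
    intro q _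
    by_cases hq : ∃ φ : AffineResiduePoints s p V, φ.toResiduePoint.pt = q
    · obtain ⟨φ, rfl⟩ := hq
      obtain ⟨P, hP, hPf⟩ := hint (φ.1.hom f)
      have hroot : ∀ φ' : AffineResiduePoints s p V,
          φ'.toResiduePoint.pt = φ.toResiduePoint.pt →
          φ'.1.hom f ∈ ((P.map (residueMap s p)).roots.toFinset : Set (C.residueField p)) := by
        intro φ' hφ'
        have hcomp : ∀ φ : AffineResiduePoints s p V, φ.1.hom (P.eval₂ (affineMap s V) f) =
            P.eval₂ (residueMap s p) (φ.1.hom f) := by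
          intro φ
          rw [Polynomial.hom_eval₂]
          congr 1
          exact RingHom.ext ((affinePoint_iff _).1 φ.2)
        have h0 : φ'.1.hom (P.eval₂ (affineMap s V) f) = 0 := by
          by_contra hne
          rw [← ne_eq, ← φ'.pt_mem_basicOpen_iff, hφ', φ.pt_mem_basicOpen_iff, hcomp] at hne
          exact hne hPf
        rw [hcomp, ← Polynomial.eval_map] at h0
        simp only [Finset.mem_coe, Multiset.mem_toFinset]
        exact (Polynomial.mem_roots (hP.map _).ne_zero).2 h0
      have h2 := (Set.Finite.eventually_all
        (P.map (residueMap s p)).roots.toFinset.finite_toSet).2 fun c _ ↦ hf c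
      filter_upwards [h2] with i hi heq
      exact hi _ (hroot _ heq) rfl
    · exact Eventually.of_forall fun i h ↦ hq ⟨_, h⟩
  obtain ⟨i, h2, h3⟩ := (hT.and ((Set.Finite.eventually_all hfin).2 h1)).exists
  exact h3 _ h2 rfl

end ConstancyOnPoints

/-! ### Lifting convergent families along étale maps -/

section EtaleLift

/-- Points of an algebra étale at a point can be moved along with points of its base. -/
theorem exists_tendsto_of_isEtaleAt {k : Type*} {ℓ : Type*} [Field k] [Field ℓ] [Algebra k ℓ]
    [Algebra.IsAlgebraic k ℓ] {O : ValuationSubring k} [HenselianLocalRing O]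
    {O' : ValuationSubring ℓ} (h : O'.comap (algebraMap k ℓ) = O) {E B : Type*} [CommRing E]
    [CommRing B] [Algebra E B] [Algebra.FinitePresentation E B] (φ₀ : B →+* ℓ)
    [(RingHom.ker φ₀).IsPrime] [Algebra.IsEtaleAt E (RingHom.ker φ₀)] {ι : Type*} {l : Filter ι}
    {ρ : ι → E →+* ℓ} (hρ : ∀ e, Tendsto (fun i ↦ ρ i e) l
      (@nhds _ (valuationTopology O') (φ₀ (algebraMap E B e)))) :
    ∃ φ : ι → B →+* ℓ, (∀ᶠ i in l, (φ i).comp (algebraMap E B) = ρ i) ∧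
      ∀ b, Tendsto (fun i ↦ φ i b) l (@nhds _ (valuationTopology O') (φ₀ b)) := by
  let Ω := AlgebraicClosure ℓ
  have : Algebra.IsAlgebraic k Ω := Algebra.IsAlgebraic.trans k ℓ Ω
  obtain ⟨V, hV, hmem, -⟩ := exists_valuationSubring_isometry h Ω
  obtain ⟨f, hf, hst⟩ := Algebra.IsEtaleAt.exists_isStandardEtale (R := E) (RingHom.ker φ₀)
  have hf : IsUnit (φ₀ f) := IsUnit.mk0 _ hf
  let φ₁ : Localization.Away f →+* ℓ := IsLocalization.Away.lift f hf
  have hφ₁ : ∀ b, φ₁ (algebraMap B _ b) = φ₀ b := IsLocalization.Away.lift_eq f hf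
  obtain ⟨φ, h1, h2⟩ := exists_tendsto_of_isStandardEtale V
    (fun (σ : Ω →ₐ[ℓ] Ω) x ↦ hmem (σ.restrictScalars k) x) φ₁ l ρ (fun e ↦ by
      rw [IsScalarTower.algebraMap_apply E B (Localization.Away f), hφ₁]
      exact (tendsto_algebraMap_valuationTopology_iff hV _ _ _).2 (hρ e))
  refine ⟨fun i ↦ (φ i).comp (algebraMap B _), h1.mono fun i hi ↦ ?_, fun b ↦ ?_⟩
  · rw [← hi, IsScalarTower.algebraMap_eq E B (Localization.Away f), RingHom.comp_assoc]
  · rw [← hφ₁]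
    exact (tendsto_algebraMap_valuationTopology_iff hV _ _ _).1 (h2 _)

/-- Dividing by an element of value above `1` produces nonzero elements arbitrarily near to zero.
This is where nontriviality of the valuation enters. -/
theorem neBot_nhdsNE_zero {k : Type*} {ℓ : Type*} [Field k] [Field ℓ] [Algebra k ℓ]
    {O : ValuationSubring k} {O' : ValuationSubring ℓ} (h : O'.comap (algebraMap k ℓ) = O)
    (hO : O ≠ ⊤) : (@nhdsWithin ℓ (valuationTopology O') 0 {0}ᶜ).NeBot := by
  let := Valued.mk' O'.valuation
  obtain ⟨x, hx⟩ : ∃ x, x ∉ O := by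
    by_contra! hcon
    exact hO (eq_top_iff.2 fun x _ ↦ hcon x)
  have hx' : algebraMap k ℓ x ∉ O' := by rwa [← h] at hx
  have hlt : 1 < O'.valuation (algebraMap k ℓ x) := by
    rw [← not_le, O'.valuation_le_one_iff]
    exact hx'
  have hx0 : algebraMap k ℓ x ≠ 0 := fun h ↦ hx' (h ▸ O'.zero_mem)
  refine (((nhds_valuationTopology_hasBasis O' 0).inf_principal _).neBot_iff).2 ?_
  intro c hc
  refine ⟨c / algebraMap k ℓ x, ?_, div_ne_zero hc hx0⟩
  change O'.valuation (c / _ - 0) < _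
  rw [sub_zero, map_div₀, div_lt_iff₀ (zero_lt_one.trans hlt)]
  exact lt_mul_of_one_lt_right (zero_lt_iff.2 ((O'.valuation.ne_zero_iff).2 hc)) hlt

end EtaleLift

/-! ### Nearby points on smooth curves -/

section SmoothCurves

variable {k : Type u} [Field k] {C : Scheme.{u}} {s : C ⟶ Spec (CommRingCat.of k)} {p : C}

/-- Zariski's lemma: the residue field of a closed point is of finite type over `k`. -/
theorem residueMap_finite [LocallyOfFiniteType s] (hp : IsClosed {p}) :
    (residueMap s p).Finite := by
  have := isClosed_singleton_iff_isClosedImmersion.mp hp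
  have : LocallyOfFiniteType (C.fromSpecResidueField p ≫ s) := inferInstance
  have h1 := (HasRingHomProperty.Spec_iff (P := @LocallyOfFiniteType)
    (φ := Spec.preimage (C.fromSpecResidueField p ≫ s))).1 (by rwa [Spec.map_preimage])
  let := (residueMap s p).toAlgebra
  have : Algebra.FiniteType k (C.residueField p) := h1
  exact finite_of_finite_type_of_isJacobsonRing k (C.residueField p)

theorem isNoetherianRing_placeRing [IsIntegral C] [IsLocallyNoetherian C] {K : Type v} [Field K]
    (i : C.functionField →+* K) (p : C) : IsNoetherianRing (placeRing i p) :=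
  isNoetherianRing_of_surjective _ _ _ (RingHom.rangeRestrict_surjective
    (i.comp (algebraMap (C.presheaf.stalk p) C.functionField)))

open MvPolynomial in
theorem tendsto_eval₂_mvPolynomial {ι σ R ℓ : Type*} [CommRing R] [CommRing ℓ] [TopologicalSpace ℓ]
    [IsTopologicalRing ℓ] {l : Filter ι} (f : R →+* ℓ) {x : ι → σ → ℓ} {x₀ : σ → ℓ}
    (hx : ∀ t, Tendsto (fun i ↦ x i t) l (𝓝 (x₀ t))) (P : MvPolynomial σ R) :
    Tendsto (fun i ↦ eval₂ f (x i) P) l (𝓝 (eval₂ f x₀ P)) := by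
  induction P using MvPolynomial.induction_on with
  | C r => simpa using tendsto_const_nhds
  | add P Q hP hQ => simpa using hP.add hQ
  | mul_X P t hP => simpa using hP.mul (hx t)

/-- A point of a smooth curve is the limit of a family of other points with values in its residue
field. -/
theorem exists_tendsto_affineSelf [SmoothOfRelativeDimension 1 s] {O : ValuationSubring k}
    [HenselianLocalRing O] {O' : ValuationSubring (C.residueField p)} (h : Extends s p O O')
    (hint : (residueMap s p).IsIntegral) :
    ∃ (V : C.affineOpens) (hp : p ∈ V.1) (f : Γ(C, V.1))
      (Φ : C.residueField p → AffineResiduePoints s p V),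
      Tendsto Φ (@nhdsWithin _ (valuationTopology O') 0 {0}ᶜ)
        (@nhds _ (affineTopology O' V) (affineSelf s V hp)) ∧
      ∀ c, ∀ᶠ i in @nhdsWithin _ (valuationTopology O') 0 {0}ᶜ, (Φ i).1.hom f ≠ c := by
  obtain ⟨U, hU, V, hV, hpV, e, hs⟩ :=
    SmoothOfRelativeDimension.exists_isStandardSmoothOfRelativeDimension (n := 1) (f := s) p
  let V : C.affineOpens := ⟨V, hV⟩
  have hp : p ∈ V.1 := hpV
  let := (residueMap s p).toAlgebra
  have : Algebra.IsIntegral k (C.residueField p) := ⟨hint⟩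
  -- An étale coordinate: near `p` the curve is étale over an affine line.
  obtain ⟨g, hg, het⟩ := hs.exists_etale_mvPolynomial
  let := g.toAlgebra
  have : Algebra.Etale (MvPolynomial (Fin 1) Γ(Spec (CommRingCat.of k), U)) Γ(C, V.1) := het
  let ι : k →+* Γ(Spec (CommRingCat.of k), U) := (Spec.preimage hU.fromSpec).hom
  have hι : ∀ c, affineMap s V c = g (MvPolynomial.C (ι c)) := by
    have h1 : hV.fromSpec ≫ s = Spec.map (Spec.preimage hU.fromSpec ≫ s.appLE U V.1 e) := by
      rw [Spec.map_comp, Spec.map_preimage, IsAffineOpen.SpecMap_appLE_fromSpec]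
    intro c
    have h2 : affineMap s V = (Spec.preimage hU.fromSpec ≫ s.appLE U V.1 e).hom := by
      change (Spec.preimage (hV.fromSpec ≫ s)).hom = _
      rw [h1, Spec.preimage_map]
    rw [h2]
    exact (RingHom.congr_fun hg (ι c)).symm
  let φ₀ : Γ(C, V.1) →+* C.residueField p := (affineSelf s V hp).1.hom
  let x := g (MvPolynomial.X 0)
  -- The coordinate of `p` is translated by `η`, and the point of the line so obtained will be
  -- lifted for small `η`.
  let ρ : C.residueField p → MvPolynomial (Fin 1) Γ(Spec (CommRingCat.of k), U) →+*
      C.residueField p := fun η ↦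
    MvPolynomial.eval₂Hom ((φ₀.comp g).comp MvPolynomial.C) fun _ ↦ φ₀ x + η
  let := Valued.mk' O'.valuation
  have hlim0 : Tendsto (fun η : C.residueField p ↦ φ₀ x + η) (𝓝[≠] 0) (𝓝 (φ₀ x)) := by
    have : Tendsto (fun η : C.residueField p ↦ φ₀ x + η) (𝓝 0) (𝓝 (φ₀ x + 0)) :=
      tendsto_const_nhds.add tendsto_id
    rw [add_zero] at this
    exact this.mono_left nhdsWithin_le_nhds
  have : (RingHom.ker φ₀).IsPrime := RingHom.ker_isPrime φ₀
  obtain ⟨φ, h1, h2⟩ := exists_tendsto_of_isEtaleAt (O := O) (O' := O') h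
    (E := MvPolynomial (Fin 1) Γ(Spec (CommRingCat.of k), U)) φ₀ (l := 𝓝[≠] 0) (ρ := ρ) (fun P ↦ by
      have hP := tendsto_eval₂_mvPolynomial ((φ₀.comp g).comp MvPolynomial.C)
        (x := fun η _ ↦ φ₀ x + η) (x₀ := fun _ : Fin 1 ↦ φ₀ x) (fun _ ↦ hlim0) P
      have h0 : MvPolynomial.eval₂Hom ((φ₀.comp g).comp MvPolynomial.C) (fun _ : Fin 1 ↦ φ₀ x) =
          φ₀.comp g := by
        refine MvPolynomial.ringHom_ext (fun r ↦ by simp) fun t ↦ ?_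
        rw [Subsingleton.elim t 0]
        simp [x]
      have h0 := RingHom.congr_fun h0 P
      simp only [MvPolynomial.coe_eval₂Hom] at h0
      rw [h0] at hP
      exact hP)
  have hvalid : ∀ᶠ η in 𝓝[≠] (0 : C.residueField p), ∀ c, φ η (affineMap s V c) =
      residueMap s p c := by
    filter_upwards [h1] with η hη c
    have h4 : ρ η (MvPolynomial.C (ι c)) = φ₀ (g (MvPolynomial.C (ι c))) := by simp [ρ]
    rw [hι]
    exact (RingHom.congr_fun hη (MvPolynomial.C (ι c))).trans
      (h4.trans ((congrArg φ₀ (hι c).symm).trans ((affinePoint_iff _).1 (affineSelf s V hp).2 c)))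
  classical
  let Φ : C.residueField p → AffineResiduePoints s p V := fun η ↦
    if hη : ∀ c, φ η (affineMap s V c) = residueMap s p c then
      ⟨CommRingCat.ofHom (φ η), (affinePoint_iff _).2 hη⟩ else affineSelf s V hp
  have hΦ : ∀ᶠ η in 𝓝[≠] (0 : C.residueField p), (Φ η).1.hom = φ η := by
    filter_upwards [hvalid] with η hη
    simp only [Φ, dif_pos hη]
    rfl
  refine ⟨V, hp, x, Φ, (tendsto_affineTopology_iff O').2 fun b ↦ ?_, fun c ↦ ?_⟩
  · refine (h2 b).congr' ?_
    filter_upwards [hΦ] with η hη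
    rw [hη]
  · have hval : ∀ᶠ η in 𝓝[≠] (0 : C.residueField p), (Φ η).1.hom x = φ₀ x + η := by
      filter_upwards [hΦ, h1] with η hη h1η
      rw [hη]
      have h3 := RingHom.congr_fun h1η (MvPolynomial.X 0)
      have h4 : ρ η (MvPolynomial.X 0) = φ₀ x + η := by simp [ρ]
      exact h3.trans h4
    by_cases hc : φ₀ x = c
    · filter_upwards [hval, self_mem_nhdsWithin] with η hη hη0
      rw [hη, hc]
      simpa using hη0
    · filter_upwards [hval, hlim0.eventually_ne hc] with η hη hη'
      rwa [hη]

end SmoothCurves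

/-! ### Infinitude for smooth curves -/

section Curves

variable {k : Type u} [Field k] {C : Scheme.{u}} {s : C ⟶ Spec (CommRingCat.of k)} {p : C}

theorem exists_extends (O : ValuationSubring k) :
    ∃ O' : ValuationSubring (C.residueField p), Extends s p O O' := by
  let := (residueMap s p).toAlgebra
  exact exists_valuationSubring_comap_eq O (C.residueField p)

theorem infinite_of_isOpenFor_of_smooth [SmoothOfRelativeDimension 1 s] {O : ValuationSubring k}
    [HenselianLocalRing O] (hO : O ≠ ⊤) {O' : ValuationSubring (C.residueField p)}
    (h : Extends s p O O') (hint : (residueMap s p).IsIntegral) {U : Set (ResiduePoints s p)}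
    (hU : IsOpenFor s p O' U) (hp : ResiduePoints.self s p ∈ U) : U.Infinite := by
  obtain ⟨V, hpV, f, Φ, hΦ, hf⟩ := exists_tendsto_affineSelf h hint
  let := (residueMap s p).toAlgebra
  have := neBot_nhdsNE_zero h hO
  exact infinite_of_tendsto hΦ hf hU (by rwa [affineSelf_toResiduePoint])

theorem infinite_setOf_conjDecomposition [SmoothOfRelativeDimension 1 s] [IsIntegral C]
    [IsLocallyNoetherian C] {K : Type v} [Field K] (i : C.functionField →+* K) {L : Type w}
    [Field L] [Algebra K L] [FiniteDimensional K L] [IsGalois K L] {O : ValuationSubring k}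
    [HenselianLocalRing O] (hO : O ≠ ⊤) (hfin : (residueMap s p).Finite)
    (hR : UnramifiedIn L (placeRing i p)) :
    {v : C | IsClosed {v} ∧ ConjDecomposition L (placeRing i p) (placeRing i v)}.Infinite := by
  obtain ⟨O', h⟩ := exists_extends (s := s) (p := p) O
  have := isNoetherianRing_placeRing i p
  obtain ⟨U, hU, hpU, hUc⟩ := exists_isOpenFor_conjDecomposition i h hfin hR
  have hint : (residueMap s p).IsIntegral := hfin.to_isIntegral
  obtain ⟨V, hpV, f, Φ, hΦ, hf⟩ := exists_tendsto_affineSelf h hint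
  let := (residueMap s p).toAlgebra
  have := neBot_nhdsNE_zero h hO
  refine infinite_setOf_pt hint hf ?_
  have h1 : ∀ᶠ φ in @nhds _ (affineTopology O' V) (affineSelf s V hpV), φ.toResiduePoint ∈ U := by
    let := affineTopology (s := s) O' V
    exact IsOpen.mem_nhds (hU.preimage V) (by
      change (affineSelf s V hpV).toResiduePoint ∈ U
      rwa [affineSelf_toResiduePoint])
  exact (hΦ.eventually h1).mono fun _ hη ↦ ⟨ResiduePoints.isClosed_pt hint _, hUc _ hη⟩

end Curves

/-! ### Substitution and finiteness over adically complete rings -/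

section AdicRings

open PowerSeries in
/-- Substitution of an element of the ideal of definition of an adically complete ring in a power
series. -/
theorem exists_powerSeries_ringHom {R B : Type*} [CommRing R] [CommRing B] (f : R →+* B)
    (J : Ideal B) [IsAdicComplete J B] {u : B} (hu : u ∈ J) :
    ∃ F : PowerSeries R →+* B, (∀ r, F (C r) = f r) ∧ F X = u := by
  let q : ∀ n, B →+* B ⧸ J ^ n := fun n ↦ Ideal.Quotient.mk (J ^ n)
  have hq : ∀ n b, b ∈ J ^ n → q n b = 0 := fun n b hb ↦ Ideal.Quotient.eq_zero_iff_mem.2 hb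
  have htrunc : ∀ (n : ℕ) (P Q : Polynomial R), (∀ i < n, P.coeff i = Q.coeff i) →
      q n (P.eval₂ f u) = q n (Q.eval₂ f u) := by
    intro n P Q h
    obtain ⟨S, hS⟩ : Polynomial.X ^ n ∣ P - Q := by
      rw [Polynomial.X_pow_dvd_iff]
      intro i hi
      rw [Polynomial.coeff_sub, h i hi, sub_self]
    rw [← sub_eq_zero, ← map_sub, ← Polynomial.eval₂_sub, hS, Polynomial.eval₂_mul,
      Polynomial.eval₂_X_pow]
    exact hq _ _ (Ideal.mul_mem_right _ _ (Ideal.pow_mem_pow hu n))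
  -- Modulo `J ^ n` the truncation at order `n` determines the substitution; these compatible
  -- homomorphisms are glued by completeness.
  let φ : ∀ n, PowerSeries R →+* B ⧸ J ^ n := fun n ↦
    { toFun := fun p ↦ q n ((trunc n p).eval₂ f u)
      map_one' := by
        rw [← map_one (q n), ← Polynomial.eval₂_one f u]
        refine htrunc n _ _ fun i hi ↦ ?_
        rw [coeff_trunc, if_pos hi, coeff_one, Polynomial.coeff_one]
      map_zero' := by simp
      map_add' := fun p p' ↦ by rw [map_add, Polynomial.eval₂_add, map_add]
      map_mul' := fun p p' ↦ by
        rw [← map_mul, ← Polynomial.eval₂_mul]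
        refine htrunc n _ _ fun i hi ↦ ?_
        rw [← trunc_trunc_mul_trunc, coeff_trunc, if_pos hi, ← Polynomial.coe_mul,
          Polynomial.coeff_coe] }
  have hφ : ∀ {m n : ℕ} (hle : m ≤ n), (Ideal.Quotient.factorPow J hle).comp (φ n) = φ m := by
    intro m n hle
    refine RingHom.ext fun p ↦ ?_
    change q m ((trunc n p).eval₂ f u) = q m ((trunc m p).eval₂ f u)
    refine htrunc m _ _ fun i hi ↦ ?_
    rw [coeff_trunc, coeff_trunc, if_pos hi, if_pos (hi.trans_le hle)]
  have key : ∀ (p : PowerSeries R) (b : B), (∀ n, φ n p = q n b) →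
      IsAdicComplete.liftRingHom J φ hφ p = b := by
    intro p b h
    refine (IsHausdorff.eq_iff_smodEq (I := J)).2 fun n ↦ ?_
    rw [SModEq.sub_mem, smul_eq_mul, Ideal.mul_top, ← Ideal.Quotient.eq,
      IsAdicComplete.mk_liftRingHom]
    exact h n
  refine ⟨IsAdicComplete.liftRingHom J φ hφ, fun r ↦ key _ _ fun n ↦ ?_, key _ _ fun n ↦ ?_⟩
  · rw [← Polynomial.eval₂_C f u]
    refine htrunc n _ _ fun i hi ↦ ?_
    rw [coeff_trunc, if_pos hi, coeff_C, Polynomial.coeff_C]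
  · conv_rhs => rw [← Polynomial.eval₂_X f u]
    refine htrunc n _ _ fun i hi ↦ ?_
    rw [coeff_trunc, if_pos hi, coeff_X, Polynomial.coeff_X]
    simp [eq_comm]

/-- A finite module over an adically complete ring is precomplete. -/
theorem isPrecomplete_of_finite {R : Type*} [CommRing R] (I : Ideal R) [IsAdicComplete I R]
    (M : Type*) [AddCommGroup M] [Module R M] [Module.Finite R M] : IsPrecomplete I M := by
  rw [← AdicCompletion.of_surjective_iff]
  intro y
  -- For a finite module every element of the completion comes from the tensor product with the
  -- completed ring, which here is `R` itself.
  obtain ⟨t, rfl⟩ := AdicCompletion.ofTensorProduct_surjective_of_finite I M y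
  induction t with
  | zero => exact ⟨0, by simp⟩
  | tmul a m =>
    obtain ⟨r, rfl⟩ := AdicCompletion.of_surjective I R a
    refine ⟨r • m, ?_⟩
    rw [map_smul, AdicCompletion.ofTensorProduct_tmul]
    rfl
  | add s t hs ht =>
    obtain ⟨a, ha⟩ := hs
    obtain ⟨b, hb⟩ := ht
    exact ⟨a + b, by rw [map_add, map_add, ha, hb]⟩

theorem isAdicComplete_of_finite {R : Type*} [CommRing R] [IsNoetherianRing R] (I : Ideal R)
    [IsAdicComplete I R] (M : Type*) [AddCommGroup M] [Module R M] [Module.Finite R M] :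
    IsAdicComplete I M :=
  { IsHausdorff.of_le_jacobson I M (IsAdicComplete.le_jacobson_bot I),
    isPrecomplete_of_finite I M with }

theorem isAdicComplete_map_of_finite {R : Type*} [CommRing R] [IsNoetherianRing R] (I : Ideal R)
    [IsAdicComplete I R] (B : Type*) [CommRing B] [Algebra R B] [Module.Finite R B] :
    IsAdicComplete (I.map (algebraMap R B)) B := by
  have := isAdicComplete_of_finite I B
  exact { IsHausdorff.map_algebraMap_iff.2 ‹IsAdicComplete I B›.toIsHausdorff,
    IsPrecomplete.map_algebraMap_iff.2 ‹IsAdicComplete I B›.toIsPrecomplete with }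

/-- A separated module over an adically complete ring is finite if its reduction is. -/
theorem finite_of_finite_quotient {R : Type*} [CommRing R] (I : Ideal R) [IsAdicComplete I R]
    (M : Type*) [AddCommGroup M] [Module R M] [IsHausdorff I M]
    [Module.Finite R (M ⧸ (I • ⊤ : Submodule R M))] : Module.Finite R M := by
  obtain ⟨n, f, hf⟩ := Module.Finite.exists_fin' R (M ⧸ (I • ⊤ : Submodule R M))
  have := isPrecomplete_of_finite I (Fin n → R)
  obtain ⟨g, hg⟩ := Module.projective_lifting_property (Submodule.mkQ (I • ⊤ : Submodule R M)) f
    (Submodule.mkQ_surjective _)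
  exact Module.Finite.of_surjective g
    (surjective_of_mkQ_comp_surjective (I := I) (by rw [hg]; exact hf))

/-- A finite module killed by a power of `J` is finite over any base over which the quotient by
`J` is finite. -/
theorem finite_of_pow_smul_eq_bot {F A : Type*} [CommRing F] [CommRing A] [Algebra F A]
    (J : Ideal A) [Module.Finite F (A ⧸ J)] [IsNoetherianRing A] (n : ℕ) :
    ∀ (M : Type v) [AddCommGroup M] [Module A M] [Module F M] [IsScalarTower F A M]
      [Module.Finite A M], (J ^ n • ⊤ : Submodule A M) = ⊥ → Module.Finite F M := by
  induction n with
  | zero =>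
    intro M _ _ _ _ _ h
    have : Subsingleton M := (Submodule.subsingleton_iff A).1
      (subsingleton_of_bot_eq_top (by rw [← h]; simp))
    infer_instance
  | succ n ih =>
    intro M _ _ _ _ _ h
    -- Dévissage: `J M` is killed by `J ^ n`, and `M / J M` is finite over `A / J`.
    have h1 : Module.Finite F (J • ⊤ : Submodule A M) := by
      refine ih _ ?_
      rw [eq_bot_iff]
      have h2 := h.le
      rw [pow_succ, mul_smul] at h2
      rw [← Submodule.map_le_map_iff_of_injective (J • ⊤ : Submodule A M).injective_subtype,
        Submodule.map_smul'', Submodule.map_top, Submodule.range_subtype, Submodule.map_bot]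
      exact h2
    have : Module.IsTorsionBySet A (M ⧸ (J • ⊤ : Submodule A M)) J :=
      Module.isTorsionBySet_quotient_ideal_smul M J
    have h3 : Module.Finite F (M ⧸ (J • ⊤ : Submodule A M)) := by
      let := Module.IsTorsionBySet.module this
      have : Module.Finite (A ⧸ J) (M ⧸ (J • ⊤ : Submodule A M)) :=
        Module.Finite.of_restrictScalars_finite A _ _
      have : IsScalarTower F (A ⧸ J) (M ⧸ (J • ⊤ : Submodule A M)) := ⟨fun c a m ↦ by
        obtain ⟨a, rfl⟩ := Ideal.Quotient.mk_surjective a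
        exact smul_assoc c a m⟩
      exact Module.Finite.trans (A ⧸ J) _
    have : Module.Finite F ((J • ⊤ : Submodule A M).restrictScalars F) := h1
    have : Module.Finite F (M ⧸ (J • ⊤ : Submodule A M).restrictScalars F) := h3
    exact Module.Finite.of_submodule_quotient ((J • ⊤ : Submodule A M).restrictScalars F)

end AdicRings

/-! ### Adic completeness of power series rings -/

section PowerSeriesCompleteness

open PowerSeries

variable {R : Type*} [CommRing R] (I : Ideal R)

/-- The ideal of `R⟦X⟧` generated by an ideal of `R` and the variable. -/
def powerSeriesIdeal : Ideal (PowerSeries R) :=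
  I.map (C : R →+* PowerSeries R) ⊔ Ideal.span {X}

/-- Both `I` and `X` have weight one, so the coefficient of `X ^ i` must supply the missing weight
`n - i`. Completeness can then be checked coefficientwise. -/
theorem mem_powerSeriesIdeal_pow {n : ℕ} {f : PowerSeries R} :
    f ∈ powerSeriesIdeal I ^ n ↔ ∀ i < n, coeff i f ∈ I ^ (n - i) := by
  constructor
  · have hmul : ∀ (m n : ℕ) (f g : PowerSeries R), (∀ i, coeff i f ∈ I ^ (m - i)) →
        (∀ i, coeff i g ∈ I ^ (n - i)) → ∀ i, coeff i (f * g) ∈ I ^ (m + n - i) := by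
      intro m n f g hf hg i
      rw [coeff_mul]
      refine Ideal.sum_mem _ fun ⟨a, b⟩ hab ↦ ?_
      have := Ideal.mul_mem_mul (hf a) (hg b)
      rw [← pow_add] at this
      refine Ideal.pow_le_pow_right ?_ this
      have : a + b = i := Finset.HasAntidiagonal.mem_antidiagonal.1 hab
      omega
    have hone : ∀ f ∈ powerSeriesIdeal I, ∀ i, coeff i f ∈ I ^ (1 - i) := by
      intro f hf
      have h0 : coeff 0 f ∈ I := by
        have h1 : powerSeriesIdeal I ≤ I.comap (constantCoeff (R := R)) := by
          refine sup_le (Ideal.map_le_iff_le_comap.2 fun r hr ↦ ?_)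
            ((Ideal.span_singleton_le_iff_mem _).2 ?_)
          · simpa using hr
          · simp
        simpa using h1 hf
      intro i
      rcases i with _ | i
      · simpa using h0
      · simp
    have key : ∀ n, ∀ f ∈ powerSeriesIdeal I ^ n, ∀ i, coeff i f ∈ I ^ (n - i) := by
      intro n
      induction n with
      | zero => simp
      | succ n ih =>
        intro f hf
        rw [pow_succ] at hf
        induction hf using Submodule.mul_induction_on' with
        | mem_mul_mem f hf g hg => exact hmul n 1 f g (ih f hf) (hone g hg)
        | add f _ g _ hf hg => intro i; rw [map_add]; exact add_mem (hf i) (hg i)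
    exact fun hf i _ ↦ key n f hf i
  · intro h
    rw [eq_X_pow_mul_shift_add_trunc n f]
    refine add_mem (Ideal.mul_mem_right _ _ (Ideal.pow_mem_pow (Ideal.mem_sup_right
      (Ideal.mem_span_singleton_self X)) n)) ?_
    rw [trunc_apply, ← Polynomial.coeToPowerSeries.ringHom_apply, map_sum]
    refine Ideal.sum_mem _ fun i hi ↦ ?_
    have hi : i < n := by simpa using hi
    rw [Polynomial.coeToPowerSeries.ringHom_apply, Polynomial.coe_monomial,
      monomial_eq_C_mul_X_pow, ← Nat.sub_add_cancel hi.le, pow_add]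
    refine Ideal.mul_mem_mul ?_ (Ideal.pow_mem_pow (Ideal.mem_sup_right
      (Ideal.mem_span_singleton_self X)) i)
    have h2 := Ideal.mem_map_of_mem (C : R →+* PowerSeries R) (h i hi)
    rw [Ideal.map_pow] at h2
    exact Ideal.pow_right_mono le_sup_left _ h2

theorem isAdicComplete_powerSeriesIdeal [IsAdicComplete I R] :
    IsAdicComplete (powerSeriesIdeal I) (PowerSeries R) := by
  refine { haus' := fun f hf ↦ ?_, prec' := fun f hf ↦ ?_ }
  · ext i
    refine IsHausdorff.haus' (I := I) _ fun n ↦ ?_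
    have := hf (n + i + 1)
    rw [SModEq.zero, smul_eq_mul, Ideal.mul_top, mem_powerSeriesIdeal_pow] at this
    have := this i (by omega)
    rw [SModEq.zero, smul_eq_mul, Ideal.mul_top]
    exact Ideal.pow_le_pow_right (by omega) this
  · have hf' : ∀ {m n : ℕ}, m ≤ n → ∀ i < m, coeff i (f m) - coeff i (f n) ∈ I ^ (m - i) := by
      intro m n hmn i hi
      have := hf hmn
      rw [SModEq.sub_mem, smul_eq_mul, Ideal.mul_top, mem_powerSeriesIdeal_pow] at this
      simpa using this i hi
    have h1 : ∀ i, ∃ L : R, ∀ n, coeff i (f (n + i)) - L ∈ I ^ n := by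
      intro i
      -- The `i`-th coefficients are controlled only with a loss of `i`, so the sequence is shifted
      -- by `i`.
      obtain ⟨L, hL⟩ := IsPrecomplete.prec' (I := I) (fun n ↦ coeff i (f (n + i))) (by
        intro m n hmn
        rw [SModEq.sub_mem, smul_eq_mul, Ideal.mul_top]
        rcases m with _ | m
        · simp
        have := hf' (m := m + 1 + i) (n := n + i) (by omega) i (by omega)
        rwa [Nat.add_sub_cancel] at this)
      refine ⟨L, fun n ↦ ?_⟩
      have := hL n
      rwa [SModEq.sub_mem, smul_eq_mul, Ideal.mul_top] at this
    choose L hL using h1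
    refine ⟨mk L, fun n ↦ ?_⟩
    rw [SModEq.sub_mem, smul_eq_mul, Ideal.mul_top, mem_powerSeriesIdeal_pow]
    intro i hi
    rw [map_sub, coeff_mk]
    have := hL i (n - i)
    rwa [Nat.sub_add_cancel hi.le] at this

end PowerSeriesCompleteness

/-! ### Finiteness over power series from finiteness modulo the variable -/

section FiniteOverPowerSeries

open PowerSeries

/-- A ring over `R⟦X⟧` that is separated for the image of `X` is finite if its reduction modulo `X`
is finite over `R`. -/
theorem finite_powerSeries_ringHom {R : Type*} {M : Type*} [CommRing R] [CommRing M]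
    (τ : PowerSeries R →+* M) [IsHausdorff (Ideal.span {τ X}) M]
    (h : ((Ideal.Quotient.mk (Ideal.span {τ X})).comp (τ.comp C)).Finite) : τ.Finite := by
  let := τ.toAlgebra
  let := (τ.comp C).toAlgebra
  have : IsScalarTower R (PowerSeries R) M := IsScalarTower.of_algebraMap_eq fun _ ↦ rfl
  have hmap : (Ideal.span {(X : PowerSeries R)}).map (algebraMap (PowerSeries R) M) =
      Ideal.span {τ X} := by
    rw [Ideal.map_span, Set.image_singleton]
    rfl
  have : IsHausdorff (Ideal.span {(X : PowerSeries R)}) M :=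
    IsHausdorff.map_algebraMap_iff.1 (by rw [hmap]; infer_instance)
  have hsub : (Ideal.span {(X : PowerSeries R)} • ⊤ : Submodule (PowerSeries R) M) =
      (Ideal.span {τ X}).restrictScalars (PowerSeries R) := by
    rw [← hmap, Ideal.smul_top_eq_map]
  have h1 : Module.Finite R (M ⧸ Ideal.span {τ X}) := h
  have h2 : Module.Finite (PowerSeries R) (M ⧸ Ideal.span {τ X}) :=
    Module.Finite.of_restrictScalars_finite R _ _
  have : Module.Finite (PowerSeries R)
      (M ⧸ (Ideal.span {(X : PowerSeries R)} • ⊤ : Submodule (PowerSeries R) M)) := by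
    rw [hsub]
    exact h2
  exact finite_of_finite_quotient (Ideal.span {(X : PowerSeries R)}) M

end FiniteOverPowerSeries

/-! ### Complete surfaces and their parameters -/

section CompleteSurface

/-- `J` is an ideal of definition of a complete Noetherian ring, finite modulo `J` over the field
`F`, all of whose chains of primes starting with `⊥` have length at most two and, if they have
length two, end in a prime that contains `J`. -/
structure IsCompleteSurface (F : Type*) {A : Type*} [Field F] [CommRing A] [Algebra F A]
    (J : Ideal A) : Prop where
  isNoetherianRing : IsNoetherianRing A
  isAdicComplete : IsAdicComplete J A
  finite_quotient : Module.Finite F (A ⧸ J)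
  le_of_lt : ∀ 𝔯 Q : Ideal A, 𝔯.IsPrime → Q.IsPrime → 𝔯 ≠ ⊥ → 𝔯 < Q → J ≤ Q

open PowerSeries

variable {F : Type*} {A : Type*} [Field F] [CommRing A] [Algebra F A] {J : Ideal A}

/-- The hypothesis puts `J` in the radical of the ideal generated by `I` and `σ X`, so modulo this
ideal the ring is killed by a power of `J` and is finite over `F`. Finiteness modulo the variable
then lifts to finiteness over `F⟦X⟧`. -/
theorem IsCompleteSurface.finite_mk_comp (h : IsCompleteSurface F J)
    {σ : PowerSeries F →+* A} (hσ : ∀ c, σ (C c) = algebraMap F A c) (hz : σ X ∈ J) {I : Ideal A}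
    (hI : ∀ Q : Ideal A, Q.IsPrime → I ≤ Q → σ X ∈ Q → J ≤ Q) :
    ((Ideal.Quotient.mk I).comp σ).Finite := by
  have := h.isNoetherianRing
  have := h.isAdicComplete
  have := h.finite_quotient
  have hspan : Ideal.span {σ X} ≤ J := (Ideal.span_singleton_le_iff_mem _).2 hz
  have : IsHausdorff (Ideal.span {σ X}) (A ⧸ I) :=
    .of_le_jacobson _ _ (hspan.trans (IsAdicComplete.le_jacobson_bot J))
  have hmap : (Ideal.span {σ X}).map (algebraMap A (A ⧸ I)) =
      Ideal.span {((Ideal.Quotient.mk I).comp σ) X} := by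
    rw [Ideal.map_span, Set.image_singleton]
    rfl
  have : IsHausdorff (Ideal.span {((Ideal.Quotient.mk I).comp σ) X}) (A ⧸ I) := by
    rw [← hmap]
    exact IsHausdorff.map_algebraMap_iff.2 inferInstance
  refine finite_powerSeries_ringHom _ ?_
  rw [← hmap]
  obtain ⟨n, hn⟩ : ∃ n, J ^ n ≤ I ⊔ Ideal.span {σ X} := by
    refine Ideal.exists_pow_le_of_le_radical_of_fg ?_ (IsNoetherian.noetherian J)
    rw [Ideal.radical_eq_sInf]
    refine le_sInf fun Q ⟨hQ, hQp⟩ ↦ hI Q hQp (le_sup_left.trans hQ) ?_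
    exact hQ (Ideal.mem_sup_right (Ideal.mem_span_singleton_self _))
  let N := (A ⧸ I) ⧸ (Ideal.span {σ X}).map (algebraMap A (A ⧸ I))
  have hsurj : Function.Surjective (algebraMap A N) :=
    Ideal.Quotient.mk_surjective.comp Ideal.Quotient.mk_surjective
  have : Module.Finite A N := Module.Finite.of_surjective (Algebra.linearMap A N) hsurj
  have hzero : ∀ a ∈ I ⊔ Ideal.span {σ X}, algebraMap A N a = 0 := by
    change I ⊔ Ideal.span {σ X} ≤ RingHom.ker (algebraMap A N)
    refine sup_le (fun a ha ↦ ?_) (fun a ha ↦ ?_)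
    · change Ideal.Quotient.mk _ (Ideal.Quotient.mk I a) = 0
      rw [Ideal.Quotient.eq_zero_iff_mem.2 ha, map_zero]
    · exact Ideal.Quotient.eq_zero_iff_mem.2 (Ideal.mem_map_of_mem _ ha)
  have h1 : Module.Finite F N := by
    refine finite_of_pow_smul_eq_bot J n N ?_
    rw [eq_bot_iff, Submodule.smul_le]
    intro a ha m _
    rw [Submodule.mem_bot]
    exact (Algebra.smul_def a m).trans (by rw [hzero a (hn ha), zero_mul])
  have h2 : ((Ideal.Quotient.mk ((Ideal.span {σ X}).map (algebraMap A (A ⧸ I)))).comp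
      (((Ideal.Quotient.mk I).comp σ).comp C)) = algebraMap F N := by
    refine RingHom.ext fun c ↦ ?_
    change algebraMap A N (σ (C c)) = _
    rw [hσ, ← IsScalarTower.algebraMap_apply]
  rw [h2]
  exact RingHom.finite_algebraMap.2 h1

theorem IsCompleteSurface.le_of_mem (h : IsCompleteSurface F J) {𝔯 Q : Ideal A} (h𝔯 : 𝔯.IsPrime)
    (hQ : Q.IsPrime) (h0 : 𝔯 ≠ ⊥) (hle : 𝔯 ≤ Q) {z : A} (hz : z ∉ 𝔯) (hzQ : z ∈ Q) : J ≤ Q :=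
  h.le_of_lt 𝔯 Q h𝔯 hQ h0 (lt_of_le_of_ne hle fun he ↦ hz (he ▸ hzQ))

/-- The quotient by a one-dimensional prime is finite over the power series in any topologically
nilpotent element. -/
theorem IsCompleteSurface.finite_mk_comp_of_isPrime (h : IsCompleteSurface F J)
    {σ : PowerSeries F →+* A} (hσ : ∀ c, σ (C c) = algebraMap F A c) (hz : σ X ∈ J) {𝔭 : Ideal A}
    [𝔭.IsPrime] (h0 : 𝔭 ≠ ⊥) (hz𝔭 : σ X ∉ 𝔭) : ((Ideal.Quotient.mk 𝔭).comp σ).Finite :=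
  h.finite_mk_comp hσ hz fun _ hQ hle hzQ ↦ h.le_of_mem ‹_› hQ h0 hle hz𝔭 hzQ

/-- A prime not containing the ideal of definition has height one. -/
theorem IsCompleteSurface.height_eq_one [IsDomain A] (h : IsCompleteSurface F J) {𝔭 : Ideal A}
    [𝔭.IsPrime] (h0 : 𝔭 ≠ ⊥) (hJ : ¬ J ≤ 𝔭) : 𝔭.height = 1 := by
  have := h.isNoetherianRing
  obtain ⟨a, ha, ha0⟩ := Submodule.exists_mem_ne_zero_of_ne_bot h0
  have hmin : 𝔭 ∈ (Ideal.span {a}).minimalPrimes := by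
    refine ⟨⟨inferInstance, (Ideal.span_singleton_le_iff_mem _).2 ha⟩, fun 𝔯 h𝔯 hle ↦ ?_⟩
    by_contra hnot
    refine hJ (h.le_of_lt 𝔯 𝔭 h𝔯.1 inferInstance ?_ (lt_of_le_not_ge hle hnot))
    rintro rfl
    exact ha0 (by simpa using h𝔯.2)
  refine le_antisymm (Ideal.height_le_one_of_isPrincipal_of_mem_minimalPrimes _ _ hmin) ?_
  rw [Order.one_le_iff_pos, pos_iff_ne_zero]
  intro h1
  rw [Ideal.height_eq_zero_iff, IsDomain.minimalPrimes_eq_singleton_bot] at h1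
  exact h0 h1

/-- Prime avoidance tolerates a nonprime ideal, here `I'`; it will be the preimage of the square of
a maximal ideal. -/
theorem exists_mem_notMem_of_finite {A : Type*} [CommRing A] {I I' : Ideal A}
    {T : Set (Ideal A)} (hT : T.Finite) (hprime : ∀ Q ∈ T, Q.IsPrime) (hI' : ¬ I ≤ I')
    (hIT : ∀ Q ∈ T, ¬ I ≤ Q) : ∃ u ∈ I, u ∉ I' ∧ ∀ Q ∈ T, u ∉ Q := by
  classical
  by_contra! hcon
  have hsub : (I : Set A) ⊆ ⋃ i ∈ (↑(insert none (hT.toFinset.image some) :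
      Finset (Option (Ideal A))) : Set (Option (Ideal A))), ((i.elim I' id : Ideal A) : Set A) := by
    intro u hu
    by_cases hu' : u ∈ I'
    · exact Set.mem_biUnion (Finset.mem_coe.2 (Finset.mem_insert_self none _)) hu'
    · obtain ⟨Q, hQ, huQ⟩ := hcon u hu hu'
      exact Set.mem_biUnion (x := some Q) (Finset.mem_coe.2 (Finset.mem_insert_of_mem
        (Finset.mem_image_of_mem _ (hT.mem_toFinset.2 hQ)))) huQ
  rw [Ideal.subset_union_prime none none] at hsub
  · obtain ⟨i, hi, hle⟩ := hsub
    rw [Finset.mem_insert, Finset.mem_image] at hi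
    rcases hi with rfl | ⟨Q, hQ, rfl⟩
    · exact hI' hle
    · exact hIT Q (hT.mem_toFinset.1 hQ) hle
  · intro i hi hi1 _
    rw [Finset.mem_insert, Finset.mem_image] at hi
    rcases hi with rfl | ⟨Q, hQ, rfl⟩
    · exact absurd rfl hi1
    · exact hprime Q (hT.mem_toFinset.1 hQ)

/-- Locally at `𝔭` the ideal `J` is the unit ideal, so the inclusion would put the maximal ideal
into its square and Nakayama would give `𝔭 = ⊥`. -/
theorem not_mul_le_comap_maximalIdeal_sq {A : Type*} [CommRing A] [IsDomain A]
    [IsNoetherianRing A] {𝔭 J : Ideal A} [𝔭.IsPrime] (h0 : 𝔭 ≠ ⊥) (hJ : ¬ J ≤ 𝔭) :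
    ¬ 𝔭 * J ≤ (IsLocalRing.maximalIdeal (Localization.AtPrime 𝔭) ^ 2).comap
      (algebraMap A (Localization.AtPrime 𝔭)) := by
  intro hle
  obtain ⟨z, hzJ, hz⟩ := SetLike.not_le_iff_exists.1 hJ
  have h1 := Ideal.map_le_iff_le_comap.2 hle
  have h2 : J.map (algebraMap A (Localization.AtPrime 𝔭)) = ⊤ :=
    Ideal.eq_top_of_isUnit_mem _ (Ideal.mem_map_of_mem _ hzJ)
      (IsLocalization.map_units _ (⟨z, hz⟩ : 𝔭.primeCompl))
  rw [Ideal.map_mul, h2, Ideal.mul_top, Localization.AtPrime.map_eq_maximalIdeal] at h1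
  have h3 : IsLocalRing.maximalIdeal (Localization.AtPrime 𝔭) = ⊥ := by
    refine Submodule.eq_bot_of_le_smul_of_le_jacobson_bot _ _ (IsNoetherian.noetherian _) ?_
      (IsLocalRing.maximalIdeal_le_jacobson _)
    rwa [smul_eq_mul, ← pow_two]
  refine h0 (eq_bot_iff.2 fun a ha ↦ ?_)
  have h4 : algebraMap A (Localization.AtPrime 𝔭) a ∈ IsLocalRing.maximalIdeal _ := by
    rw [← Localization.AtPrime.map_eq_maximalIdeal]
    exact Ideal.mem_map_of_mem _ ha
  rw [h3, Ideal.mem_bot] at h4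
  exact (IsLocalization.injective (Localization.AtPrime 𝔭)
    𝔭.primeCompl_le_nonZeroDivisors) (h4.trans (map_zero _).symm)

/-- An element of a height one prime that generates it locally and avoids the one-dimensional
primes above another element. -/
theorem IsCompleteSurface.exists_uniformizer [IsDomain A] (h : IsCompleteSurface F J)
    {𝔭 : Ideal A} [𝔭.IsPrime] (h0 : 𝔭 ≠ ⊥) {z : A} (hzJ : z ∈ J) (hz : z ∉ 𝔭) :
    ∃ u ∈ 𝔭, u ∈ J ∧ algebraMap A (Localization.AtPrime 𝔭) u ∉
        IsLocalRing.maximalIdeal (Localization.AtPrime 𝔭) ^ 2 ∧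
      ∀ Q : Ideal A, Q.IsPrime → u ∈ Q → z ∈ Q → J ≤ Q := by
  have := h.isNoetherianRing
  have hz0 : z ≠ 0 := fun h ↦ hz (h ▸ 𝔭.zero_mem)
  have hmem : ∀ 𝔯 ∈ (Ideal.span {z}).minimalPrimes, z ∈ 𝔯 := fun 𝔯 h𝔯 ↦
    h𝔯.1.2 (Ideal.mem_span_singleton_self z)
  have hfin : {𝔯 ∈ (Ideal.span {z}).minimalPrimes | ¬ J ≤ 𝔯}.Finite :=
    (Ideal.finite_minimalPrimes_of_isNoetherianRing A _).subset fun _ h ↦ h.1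
  -- Within `𝔭 * J`, `u` avoids the preimage of the squared maximal ideal, to be a uniformiser, and
  -- the minimal primes of `z` not containing `J`, so that primes containing both `u` and `z`
  -- contain `J`.
  obtain ⟨u, hu, hu₂, huT⟩ := exists_mem_notMem_of_finite hfin (fun 𝔯 h𝔯 ↦ h𝔯.1.1.1)
    (not_mul_le_comap_maximalIdeal_sq h0 fun hJ ↦ hz (hJ hzJ)) fun 𝔯 h𝔯 hle ↦ by
      rcases (h𝔯.1.1.1.mul_le).1 hle with h1 | h1
      · exact h𝔯.2 (h.le_of_mem ‹_› h𝔯.1.1.1 h0 h1 hz (hmem 𝔯 h𝔯.1))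
      · exact h𝔯.2 h1
  obtain ⟨hu𝔭, huJ⟩ : u ∈ 𝔭 ∧ u ∈ J := Ideal.mem_inf.1 (Ideal.mul_le_inf hu)
  refine ⟨u, hu𝔭, huJ, fun h ↦ hu₂ (Ideal.mem_comap.2 h), fun Q hQ huQ hzQ ↦ ?_⟩
  obtain ⟨𝔯, h𝔯, hle⟩ := Ideal.exists_minimalPrimes_le ((Ideal.span_singleton_le_iff_mem Q).2 hzQ)
  by_cases hJ𝔯 : J ≤ 𝔯
  · exact hJ𝔯.trans hle
  · refine h.le_of_mem h𝔯.1.1 hQ ?_ hle (huT 𝔯 (Set.mem_sep h𝔯 hJ𝔯)) huQ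
    intro h𝔯0
    exact hz0 ((Submodule.mem_bot A).1 (h𝔯0 ▸ hmem 𝔯 h𝔯))

end CompleteSurface

/-! ### Étale lifting for finite algebras over a domain -/

section UnramifiedLift

/-- A finite torsion-free module over a Noetherian domain is flat after inverting an element outside
a given prime that is locally principal. -/
theorem exists_flat_localizedModule {E : Type*} [CommRing E] [IsDomain E] [IsNoetherianRing E]
    (M : Type*) [AddCommGroup M] [Module E M] [Module.Finite E M] [Module.IsTorsionFree E M]
    (P : Ideal E) [P.IsPrime] (hP : ∃ u, P = Ideal.span {u}) :
    ∃ r ∉ P, Module.Flat E (LocalizedModule (.powers r) M) := by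
  have : IsNoetherianRing (Localization.AtPrime P) :=
    IsLocalization.isNoetherianRing P.primeCompl _ inferInstance
  -- Over the local ring at a principal prime a finite torsion-free module is free, and freeness
  -- spreads out to a basic open set.
  have : IsPrincipalIdealRing (Localization.AtPrime P) := by
    refine ((tfae_of_isNoetherianRing_of_isLocalRing_of_isDomain
      (Localization.AtPrime P)).out 0 4).2 ?_
    obtain ⟨u, hu⟩ := hP
    refine ⟨algebraMap E _ u, ?_⟩
    rw [← Localization.AtPrime.map_eq_maximalIdeal]
    refine (congrArg (Ideal.map (algebraMap E (Localization.AtPrime P))) hu).trans ?_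
    exact (Ideal.map_span _ _).trans (by rw [Set.image_singleton])
  have : Module.IsTorsionFree (Localization.AtPrime P) (LocalizedModule P.primeCompl M) :=
    inferInstance
  have : Module.Finite (Localization.AtPrime P) (LocalizedModule P.primeCompl M) := inferInstance
  have : Module.Free (Localization.AtPrime P) (LocalizedModule P.primeCompl M) :=
    Module.free_of_finite_type_torsion_free'
  have := Module.finitePresentation_of_finite E M
  obtain ⟨r, hr, hfree, -⟩ := Module.FinitePresentation.exists_free_localizedModule_powers
    P.primeCompl (LocalizedModule.mkLinearMap P.primeCompl M) (Localization.AtPrime P)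
  have : Module.Flat E (Localization (Submonoid.powers r)) := IsLocalization.flat _ (.powers r)
  exact ⟨r, hr, Module.Flat.trans E (Localization (.powers r)) _⟩

/-- Points of a finite algebra over a domain can be moved along with points of the base at an
unramified prime lying over a principal prime. -/
theorem exists_tendsto_of_isUnramifiedAt {k : Type*} {ℓ : Type*} [Field k] [Field ℓ] [Algebra k ℓ]
    [Algebra.IsAlgebraic k ℓ] {O : ValuationSubring k} [HenselianLocalRing O]
    {O' : ValuationSubring ℓ} (h : O'.comap (algebraMap k ℓ) = O) {E A : Type*} [CommRing E]
    [IsDomain E] [IsNoetherianRing E] [CommRing A] [IsDomain A] [Algebra E A] [Module.Finite E A]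
    [FaithfulSMul E A] (φ₀ : A →+* ℓ) {𝔭 : Ideal A} [𝔭.IsPrime] (h𝔭 : RingHom.ker φ₀ = 𝔭)
    [Algebra.IsUnramifiedAt E 𝔭] (hP : ∃ u, 𝔭.under E = Ideal.span {u}) {ι : Type*} {l : Filter ι}
    {ρ : ι → E →+* ℓ} (hρ : ∀ e, Tendsto (fun i ↦ ρ i e) l
      (@nhds _ (valuationTopology O') (φ₀ (algebraMap E A e)))) :
    ∃ φ : ι → A →+* ℓ, (∀ᶠ i in l, (φ i).comp (algebraMap E A) = ρ i) ∧
      ∀ a, Tendsto (fun i ↦ φ i a) l (@nhds _ (valuationTopology O') (φ₀ a)) := by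
  have : Module.IsTorsionFree E A := inferInstance
  obtain ⟨r, hr, hflat⟩ := exists_flat_localizedModule A (𝔭.under E) hP
  -- Inverting `r` makes the algebra flat; flat and unramified at the prime means étale there.
  let B := Localization (Algebra.algebraMapSubmonoid A (.powers r))
  have hunit : ∀ s : Algebra.algebraMapSubmonoid A (Submonoid.powers r), IsUnit (φ₀ s) := by
    rintro ⟨_, _, ⟨n, rfl⟩, rfl⟩
    refine IsUnit.mk0 _ fun h0 ↦ hr ?_
    have : algebraMap E A (r ^ n) ∈ 𝔭 := by rw [← h𝔭]; exact h0
    rw [map_pow] at this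
    exact ‹𝔭.IsPrime›.mem_of_pow_mem n this
  let φ₁ : B →+* ℓ := IsLocalization.lift (M := Algebra.algebraMapSubmonoid A (.powers r)) hunit
  have hφ₁ : φ₁.comp (algebraMap A B) = φ₀ :=
    IsLocalization.lift_comp (M := Algebra.algebraMapSubmonoid A (.powers r)) hunit
  have : Module.Flat E B := by
    have : IsLocalizedModule (Submonoid.powers r) (IsScalarTower.toAlgHom E A B).toLinearMap :=
      isLocalizedModule_iff_isLocalization.2 inferInstance
    exact Module.Flat.of_linearEquiv
      (IsLocalizedModule.iso (Submonoid.powers r) (IsScalarTower.toAlgHom E A B).toLinearMap).symm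
  have : Algebra.FiniteType A B := by
    have h1 : Algebra.algebraMapSubmonoid A (.powers r) = .powers (algebraMap E A r) :=
      Algebra.algebraMapSubmonoid_powers r
    have : Monoid.FG (Algebra.algebraMapSubmonoid A (.powers r)) := by
      rw [h1]
      infer_instance
    exact IsLocalization.finiteType_of_monoid_fg (Algebra.algebraMapSubmonoid A (.powers r)) B
  have : Algebra.FiniteType E B := Algebra.FiniteType.trans (S := A) inferInstance inferInstance
  have : Algebra.FinitePresentation E B := Algebra.FinitePresentation.of_finiteType.1 inferInstance
  have hq : (RingHom.ker φ₁).IsPrime := RingHom.ker_isPrime φ₁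
  have hcomap : (RingHom.ker φ₁).comap (algebraMap A B) = 𝔭 := by
    rw [RingHom.comap_ker, hφ₁, h𝔭]
  have : Algebra.IsUnramifiedAt E (RingHom.ker φ₁) := by
    have h1 := IsLocalization.isLocalization_isLocalization_atPrime_isLocalization
      (Algebra.algebraMapSubmonoid A (.powers r)) (Localization.AtPrime (RingHom.ker φ₁))
      (RingHom.ker φ₁)
    have h2 : IsLocalization 𝔭.primeCompl (Localization.AtPrime (RingHom.ker φ₁)) := by
      convert! h1
      exact hcomap.symm
    exact Algebra.FormallyUnramified.of_equiv ((IsLocalization.algEquiv 𝔭.primeCompl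
      (Localization.AtPrime 𝔭) (Localization.AtPrime (RingHom.ker φ₁))).restrictScalars E)
  have : Algebra.IsEtaleAt E (RingHom.ker φ₁) := Algebra.IsEtaleAt.of_isUnramifiedAt_of_flat _
  have hφ₁' : ∀ a, φ₁ (algebraMap A B a) = φ₀ a := RingHom.congr_fun hφ₁
  obtain ⟨φ, h1, h2⟩ := exists_tendsto_of_isEtaleAt h φ₁ (l := l) (ρ := ρ) (fun e ↦ by
    rw [IsScalarTower.algebraMap_apply E A B, hφ₁']
    exact hρ e)
  refine ⟨fun i ↦ (φ i).comp (algebraMap A B), h1.mono fun i hi ↦ ?_, fun a ↦ ?_⟩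
  · rw [← hi, IsScalarTower.algebraMap_eq E A B, RingHom.comp_assoc]
  · rw [← hφ₁']
    exact h2 _

theorem isSeparable_of_ringHom {F₀ F₁ k ℓ : Type*} [Field F₀] [Field F₁] [Field k] [Field ℓ]
    [Algebra F₀ F₁] [Algebra k ℓ] [Algebra.IsSeparable k ℓ] (g : k →+* F₀) (e : F₁ →+* ℓ)
    (h : ∀ c, e (algebraMap F₀ F₁ (g c)) = algebraMap k ℓ c) : Algebra.IsSeparable F₀ F₁ := by
  refine ⟨fun x ↦ ?_⟩
  have hx := Algebra.IsSeparable.isSeparable k (e x)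
  refine (Polynomial.Separable.map hx (f := g)).of_dvd (minpoly.dvd _ _ ?_)
  refine e.injective ?_
  rw [Polynomial.aeval_def, Polynomial.eval₂_map, Polynomial.hom_eval₂, map_zero]
  have h2 : e.comp ((algebraMap F₀ F₁).comp g) = algebraMap k ℓ := RingHom.ext h
  rw [h2]
  exact minpoly.aeval k (e x)

/-- A criterion for a prime, given as the kernel of a homomorphism into a field, to be
unramified. -/
theorem isUnramifiedAt_of_ringHom {S k ℓ : Type*} [CommRing S] [Field k] [Algebra S k]
    [IsFractionRing S k] [Field ℓ] [Algebra k ℓ] [Algebra.IsSeparable k ℓ] {E A : Type*}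
    [CommRing E] [CommRing A] [Algebra E A] [Algebra.EssFiniteType E A] {φ₀ : A →+* ℓ}
    {𝔭 : Ideal A} [𝔭.IsPrime] (h𝔭 : RingHom.ker φ₀ = 𝔭) (f : S →+* E)
    (hf : ∀ c, φ₀ (algebraMap E A (f c)) = algebraMap k ℓ (algebraMap S k c))
    (hmax : (𝔭.under E).map (algebraMap E (Localization.AtPrime 𝔭)) =
      IsLocalRing.maximalIdeal (Localization.AtPrime 𝔭)) : Algebra.IsUnramifiedAt E 𝔭 := by
  let := Localization.AtPrime.algebraOfLiesOver (𝔭.under E) 𝔭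
  rw [Algebra.isUnramifiedAt_iff_map_eq E (𝔭.under E) 𝔭]
  refine ⟨?_, hmax⟩
  have hunit : 𝔭.primeCompl ≤ Submonoid.comap φ₀ (IsUnit.submonoid ℓ) := by
    intro a ha
    refine IsUnit.mk0 _ fun h0 ↦ ha ?_
    rw [← h𝔭]
    exact h0
  let e : 𝔭.ResidueField →+* ℓ := Ideal.ResidueField.lift 𝔭 φ₀ h𝔭.ge hunit
  have he : ∀ a, e (algebraMap A _ a) = φ₀ a := fun a ↦ Ideal.ResidueField.lift_algebraMap ..
  have hcomp : ∀ c, e (algebraMap (𝔭.under E).ResidueField 𝔭.ResidueField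
      (algebraMap E _ (f c))) = algebraMap k ℓ (algebraMap S k c) := by
    intro c
    rw [← IsScalarTower.algebraMap_apply, IsScalarTower.algebraMap_apply E A, he, hf]
  have hinj : Function.Injective ((algebraMap E (𝔭.under E).ResidueField).comp f) := by
    intro c c' hcc
    have h1 := hcomp c
    have h2 : algebraMap E (𝔭.under E).ResidueField (f c) = algebraMap E _ (f c') := hcc
    rw [h2, hcomp] at h1
    exact IsFractionRing.injective S k ((algebraMap k ℓ).injective h1.symm)
  have : IsDomain S := (IsFractionRing.injective S k).isDomain
  -- The residue field of the contracted prime contains `k`, so separability of `ℓ` over `k` passes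
  -- to the extension of residue fields.
  let g : k →+* (𝔭.under E).ResidueField := IsFractionRing.lift hinj
  refine isSeparable_of_ringHom g e fun c ↦ ?_
  have h3 : (e.comp (algebraMap _ 𝔭.ResidueField)).comp g = algebraMap k ℓ := by
    refine IsLocalization.ringHom_ext (nonZeroDivisors S) (RingHom.ext fun c ↦ ?_)
    change e (algebraMap _ _ (g (algebraMap S k c))) = _
    rw [IsFractionRing.lift_algebraMap]
    exact hcomp c
  exact RingHom.congr_fun h3 c

end UnramifiedLift

/-! ### The henselian valuation ring of Laurent series -/

section LaurentValuation

variable (F : Type*) [Field F]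

theorem mem_laurentValuationRing_iff {f : LaurentSeries F} :
    f ∈ laurentValuationRing F ↔ ∃ g, algebraMap (PowerSeries F) (LaurentSeries F) g = f :=
  LaurentSeries.val_le_one_iff_eq_coe F f

/-- The valuation ring of `F((X))` is `F⟦X⟧`. -/
def laurentValuationRingEquiv : PowerSeries F ≃+* laurentValuationRing F :=
  RingEquiv.ofBijective ((algebraMap (PowerSeries F) (LaurentSeries F)).codRestrict
    (laurentValuationRing F).toSubring fun g ↦ (mem_laurentValuationRing_iff F).2 ⟨g, rfl⟩) <| by
    refine ⟨fun g g' h ↦ ?_, fun ⟨f, hf⟩ ↦ ?_⟩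
    · exact IsFractionRing.injective (PowerSeries F) (LaurentSeries F) (congrArg Subtype.val h)
    · obtain ⟨g, rfl⟩ := (mem_laurentValuationRing_iff F).1 hf
      exact ⟨g, rfl⟩

/-- Completeness is transported from `F⟦X⟧`, and complete rings are henselian. -/
instance : HenselianLocalRing (laurentValuationRing F) := by
  let e := laurentValuationRingEquiv F
  have h1 : (IsLocalRing.maximalIdeal (PowerSeries F)).map e =
      IsLocalRing.maximalIdeal (laurentValuationRing F) :=
    IsLocalRing.eq_maximalIdeal (Ideal.map_isMaximal_of_equiv e)
  have h2 : IsAdicComplete (IsLocalRing.maximalIdeal (PowerSeries F)) (PowerSeries F) := by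
    rw [PowerSeries.maximalIdeal_eq_span_X]
    infer_instance
  have h3 : IsAdicComplete (IsLocalRing.maximalIdeal (laurentValuationRing F))
      (laurentValuationRing F) := by
    rw [← h1]
    exact (IsAdicComplete.congr_ringEquiv _ e).2 h2
  have h4 : HenselianRing (laurentValuationRing F)
      (IsLocalRing.maximalIdeal (laurentValuationRing F)) := inferInstance
  refine ⟨fun f hf a₀ h₁ h₂ ↦ h4.is_henselian f hf a₀ h₁ ?_⟩
  exact h₂.map _

theorem inv_X_notMem_laurentValuationRing :
    (algebraMap (PowerSeries F) (LaurentSeries F) PowerSeries.X)⁻¹ ∉ laurentValuationRing F := by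
  intro h1
  obtain ⟨g, hg⟩ := (mem_laurentValuationRing_iff F).1 h1
  have h2 : g * PowerSeries.X = 1 := by
    refine IsFractionRing.injective (PowerSeries F) (LaurentSeries F) ?_
    rw [map_mul, hg, map_one]
    exact inv_mul_cancel₀ ((map_ne_zero_iff _ (IsFractionRing.injective _ _)).2
      PowerSeries.X_ne_zero)
  exact PowerSeries.X_prime.not_isUnit (IsUnit.of_mul_eq_one_right _ h2)

end LaurentValuation

/-! ### Limits along powers of the parameter -/

section LaurentLimits

variable {F : Type*} [Field F] {ℓ : Type*} [Field ℓ] [Algebra (LaurentSeries F) ℓ]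
  {O' : ValuationSubring ℓ}

/-- The image of `F⟦X⟧` in an extension of `F((X))`. -/
def powerSeriesMap (F : Type*) [Field F] (ℓ : Type*) [Field ℓ] [Algebra (LaurentSeries F) ℓ] :
    PowerSeries F →+* ℓ :=
  (algebraMap (LaurentSeries F) ℓ).comp (algebraMap (PowerSeries F) (LaurentSeries F))

theorem powerSeriesMap_injective : Function.Injective (powerSeriesMap F ℓ) :=
  (algebraMap (LaurentSeries F) ℓ).injective.comp
    (IsFractionRing.injective (PowerSeries F) (LaurentSeries F))

theorem powerSeriesMap_mem (h : O'.comap (algebraMap (LaurentSeries F) ℓ) = laurentValuationRing F)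
    (f : PowerSeries F) : powerSeriesMap F ℓ f ∈ O' := by
  have : algebraMap (PowerSeries F) (LaurentSeries F) f ∈ laurentValuationRing F :=
    (mem_laurentValuationRing_iff F).2 ⟨f, rfl⟩
  rw [← h] at this
  exact this

/-- Perturbations by multiples of high powers of the parameter converge. -/
theorem tendsto_add_X_pow [Algebra.IsAlgebraic (LaurentSeries F) ℓ]
    (h : O'.comap (algebraMap (LaurentSeries F) ℓ) = laurentValuationRing F)
    (y : ℓ) (g : ℕ → PowerSeries F) :
    Tendsto (fun n ↦ y + powerSeriesMap F ℓ (PowerSeries.X ^ n * g n)) atTop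
      (@nhds _ (valuationTopology O') y) := by
  let := Valued.mk' O'.valuation
  refine ((nhds_valuationTopology_hasBasis O' y).tendsto_right_iff).2 fun c hc ↦ ?_
  obtain ⟨d, hd0, hd⟩ := exists_valuation_algebraMap_le h hc
  obtain ⟨a, b, hb, rfl⟩ := IsFractionRing.div_surjective (A := PowerSeries F) d
  have ha0 : a ≠ 0 := by
    rintro rfl
    simp at hd0
  have hb0 : powerSeriesMap F ℓ b ≠ 0 :=
    (map_ne_zero_iff _ powerSeriesMap_injective).2 (nonZeroDivisors.ne_zero hb)
  -- The numerator alone serves as radius, since the denominator has value at most `1`.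
  have hle : O'.valuation (powerSeriesMap F ℓ a) ≤ O'.valuation c := by
    refine le_trans ?_ hd
    rw [map_div₀ (algebraMap (LaurentSeries F) ℓ), map_div₀]
    change _ ≤ _ / O'.valuation (powerSeriesMap F ℓ b)
    have hb1 : O'.valuation (powerSeriesMap F ℓ b) ≤ 1 :=
      (O'.valuation_le_one_iff _).2 (powerSeriesMap_mem h b)
    rw [le_div_iff₀ (zero_lt_iff.2 ((O'.valuation.ne_zero_iff).2 hb0))]
    exact mul_le_of_le_one_right' hb1
  -- Beyond the order of `a`, the power `X ^ n` is a multiple of `a * X` and so strictly smaller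
  -- than `a`.
  filter_upwards [eventually_gt_atTop a.order.toNat] with n hn
  refine lt_of_lt_of_le ?_ hle
  rw [add_sub_cancel_left]
  obtain ⟨m, rfl⟩ := Nat.exists_eq_add_of_lt hn
  have hu : IsUnit a.divXPowOrder := by
    rw [PowerSeries.isUnit_iff_constantCoeff, isUnit_iff_ne_zero]
    rw [ne_eq, PowerSeries.constantCoeff_divXPowOrder_eq_zero_iff]
    exact ha0
  obtain ⟨w, hw⟩ := hu.exists_right_inv
  have hX : O'.valuation (powerSeriesMap F ℓ PowerSeries.X) < 1 := by
    refine lt_of_le_of_ne ((O'.valuation_le_one_iff _).2 (powerSeriesMap_mem h _)) fun h1 ↦ ?_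
    have h2 : (powerSeriesMap F ℓ PowerSeries.X)⁻¹ ∈ O' := by
      rw [← O'.valuation_le_one_iff, map_inv₀, h1, inv_one]
    rw [powerSeriesMap, RingHom.comp_apply, ← map_inv₀] at h2
    have h3 : (algebraMap (PowerSeries F) (LaurentSeries F) PowerSeries.X)⁻¹ ∈
        laurentValuationRing F := by
      rw [← h]
      exact h2
    exact inv_X_notMem_laurentValuationRing F h3
  have heq : ∀ G, PowerSeries.X ^ (a.order.toNat + m + 1) * G =
      a * PowerSeries.X * (PowerSeries.X ^ m * w * G) := by
    intro G
    conv_rhs => rw [← PowerSeries.X_pow_order_mul_divXPowOrder (f := a)]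
    rw [pow_add, pow_add, pow_one]
    linear_combination (-(PowerSeries.X ^ a.order.toNat * PowerSeries.X ^ m * PowerSeries.X *
      G)) * hw
  have ha' : 0 < O'.valuation (powerSeriesMap F ℓ a) :=
    zero_lt_iff.2 ((O'.valuation.ne_zero_iff).2
      ((map_ne_zero_iff _ powerSeriesMap_injective).2 ha0))
  rw [heq, map_mul, map_mul, map_mul, map_mul]
  refine lt_of_le_of_lt (mul_le_of_le_one_right'
    ((O'.valuation_le_one_iff _).2 (powerSeriesMap_mem h _))) ?_
  exact mul_lt_of_lt_one_right ha' hX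

end LaurentLimits

/-! ### Discrete valuation rings on a normal complete surface -/

section Uniformizer

/-- In a principal ideal domain that is local, an element of the maximal ideal outside its square
generates the maximal ideal. -/
theorem span_singleton_eq_maximalIdeal {R : Type*} [CommRing R] [IsLocalRing R]
    [IsPrincipalIdealRing R] {u : R} (hu : u ∈ IsLocalRing.maximalIdeal R)
    (hu₂ : u ∉ IsLocalRing.maximalIdeal R ^ 2) :
    Ideal.span {u} = IsLocalRing.maximalIdeal R := by
  obtain ⟨π, hπ⟩ := (IsPrincipalIdealRing.principal (IsLocalRing.maximalIdeal R)).principal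
  have hπ : IsLocalRing.maximalIdeal R = Ideal.span {π} := hπ
  obtain ⟨w, rfl⟩ := Ideal.mem_span_singleton'.1 (hπ ▸ hu)
  have hw : IsUnit w := by
    by_contra hw
    refine hu₂ ?_
    rw [pow_two]
    exact Ideal.mul_mem_mul hw (hπ ▸ Ideal.mem_span_singleton_self π)
  rw [hπ, Ideal.span_singleton_mul_left_unit hw]

variable {F : Type*} [Field F] {A : Type*} [CommRing A] [IsDomain A] [Algebra F A] {J : Ideal A}

/-- The local ring is normal, and of dimension at most one because a nonzero prime strictly inside
`𝔭` would force `J ≤ 𝔭`. -/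
theorem IsCompleteSurface.isPrincipalIdealRing_localization [IsIntegrallyClosed A]
    (h : IsCompleteSurface F J) {𝔭 : Ideal A} [𝔭.IsPrime] (hJ : ¬ J ≤ 𝔭) :
    IsPrincipalIdealRing (Localization.AtPrime 𝔭) := by
  have := h.isNoetherianRing
  have : IsNoetherianRing (Localization.AtPrime 𝔭) :=
    IsLocalization.isNoetherianRing 𝔭.primeCompl _ inferInstance
  have : IsIntegrallyClosed (Localization.AtPrime 𝔭) :=
    isIntegrallyClosed_of_isLocalization _ 𝔭.primeCompl 𝔭.primeCompl_le_nonZeroDivisors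
  have key : IsPrincipalIdealRing (Localization.AtPrime 𝔭) ↔
      IsIntegrallyClosed (Localization.AtPrime 𝔭) ∧ ∀ Q : Ideal (Localization.AtPrime 𝔭),
        Q ≠ ⊥ → Q.IsPrime → Q = IsLocalRing.maximalIdeal _ :=
    (tfae_of_isNoetherianRing_of_isLocalRing_of_isDomain (Localization.AtPrime 𝔭)).out 0 3
  refine key.2 ⟨this, fun Q hQ0 hQ ↦ ?_⟩
  have hle : Q.comap (algebraMap A (Localization.AtPrime 𝔭)) ≤ 𝔭 := by
    exact (Ideal.comap_mono (IsLocalRing.le_maximalIdeal hQ.ne_top)).trans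
      (Localization.AtPrime.under_maximalIdeal (I := 𝔭)).le
  have hne : Q.comap (algebraMap A (Localization.AtPrime 𝔭)) ≠ ⊥ := by
    intro h0
    refine hQ0 ?_
    rw [← IsLocalization.map_under 𝔭.primeCompl _ Q]
    exact (congrArg _ h0).trans Ideal.map_bot
  have heq : Q.comap (algebraMap A (Localization.AtPrime 𝔭)) = 𝔭 := by
    by_contra hne'
    exact hJ (h.le_of_lt _ _ (hQ.comap _) inferInstance hne (lt_of_le_of_ne hle hne'))
  rw [← IsLocalization.map_under 𝔭.primeCompl _ Q]
  exact (congrArg _ heq).trans Localization.AtPrime.map_eq_maximalIdeal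

end Uniformizer

/-! ### Approximating points on a normal complete surface -/

section Approximation

open PowerSeries

variable {F : Type*} [Field F] {A : Type*} [CommRing A] [IsDomain A] [Algebra F A] {J : Ideal A}

/-- On a normal complete surface, a one-dimensional point with separable residue field is the limit
of points whose values at some function are nonzero powers of the parameter. -/
theorem IsCompleteSurface.exists_tendsto [IsIntegrallyClosed A] (h : IsCompleteSurface F J)
    {ℓ : Type*} [Field ℓ] [Algebra (LaurentSeries F) ℓ] [Algebra.IsSeparable (LaurentSeries F) ℓ]
    {O' : ValuationSubring ℓ}
    (hO' : O'.comap (algebraMap (LaurentSeries F) ℓ) = laurentValuationRing F)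
    {σ : PowerSeries F →+* A} (hσ : ∀ c, σ (C c) = algebraMap F A c) (hz : σ X ∈ J)
    {φ₀ : A →+* ℓ} (hφ₀ : ∀ f, φ₀ (σ f) = powerSeriesMap F ℓ f) (h0 : RingHom.ker φ₀ ≠ ⊥) :
    ∃ (u : A) (φ : ℕ → A →+* ℓ), (∀ᶠ n in atTop, (∀ f, φ n (σ f) = powerSeriesMap F ℓ f) ∧
        φ n u = powerSeriesMap F ℓ (X ^ (n + 1))) ∧
      ∀ a, Tendsto (fun n ↦ φ n a) atTop (@nhds _ (valuationTopology O') (φ₀ a)) := by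
  have := h.isNoetherianRing
  have := h.isAdicComplete
  have : Algebra.IsAlgebraic (LaurentSeries F) ℓ := Algebra.IsSeparable.isAlgebraic _ _
  obtain ⟨𝔭, h𝔭⟩ : ∃ 𝔭, RingHom.ker φ₀ = 𝔭 := ⟨_, rfl⟩
  have h𝔭p : 𝔭.IsPrime := h𝔭 ▸ RingHom.ker_isPrime φ₀
  have hmem : ∀ {a}, a ∈ 𝔭 ↔ φ₀ a = 0 := by
    intro a
    rw [← h𝔭, RingHom.mem_ker]
  have hz𝔭 : σ X ∉ 𝔭 := by
    rw [hmem, hφ₀]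
    exact (map_ne_zero_iff _ powerSeriesMap_injective).2 X_ne_zero
  obtain ⟨u, hu𝔭, huJ, hu₂, huQ⟩ := h.exists_uniformizer (h𝔭 ▸ h0) hz hz𝔭
  have hu0 : u ≠ 0 := by
    rintro rfl
    rw [map_zero] at hu₂
    exact hu₂ (Submodule.zero_mem _)
  -- The two parameters `σ X` and `u` define a map from power series in two variables; `u ∈ J`
  -- allows the substitution.
  obtain ⟨τ, hτC, hτX⟩ := exists_powerSeries_ringHom σ J huJ
  have hτ₀ : ∀ e, φ₀ (τ e) = powerSeriesMap F ℓ (constantCoeff e) := by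
    intro e
    have h1 := congrArg (fun e ↦ φ₀ (τ e)) (sub_const_eq_X_mul_shift e)
    simp only [map_sub, map_mul, hτC, hτX, hmem.1 hu𝔭, zero_mul, hφ₀] at h1
    exact sub_eq_zero.1 h1
  have hτker : ∀ e, φ₀ (τ e) = 0 → constantCoeff e = 0 := fun e he ↦ by
    rw [hτ₀] at he
    exact (map_eq_zero_iff _ powerSeriesMap_injective).1 he
  have hfin : τ.Finite := by
    have : IsHausdorff (Ideal.span {τ X}) A := by
      refine .of_le_jacobson _ _ (le_trans ?_ (IsAdicComplete.le_jacobson_bot J))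
      rw [hτX]
      exact (Ideal.span_singleton_le_iff_mem _).2 huJ
    refine finite_powerSeries_ringHom τ ?_
    have h1 : τ.comp C = σ := RingHom.ext hτC
    rw [h1, hτX]
    exact h.finite_mk_comp hσ hz fun Q hQ hle hzQ ↦
      huQ Q hQ (hle (Ideal.mem_span_singleton_self u)) hzQ
  let := τ.toAlgebra
  have : Module.Finite (PowerSeries (PowerSeries F)) A := hfin
  -- After powers of the outer variable are removed, a nonzero series has nonzero constant term, and
  -- `φ₀ ∘ τ` sees exactly this term.
  have : FaithfulSMul (PowerSeries (PowerSeries F)) A := by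
    rw [faithfulSMul_iff_algebraMap_injective, injective_iff_map_eq_zero]
    intro e he
    by_contra he0
    have h1 : τ e = 0 := he
    rw [← X_pow_order_mul_divXPowOrder (f := e), map_mul, map_pow, hτX] at h1
    have h2 := (mul_eq_zero.1 h1).resolve_left (pow_ne_zero _ hu0)
    exact he0 (constantCoeff_divXPowOrder_eq_zero_iff.1 (hτker _ (by rw [h2, map_zero])))
  have hunder : 𝔭.under (PowerSeries (PowerSeries F)) = Ideal.span {X} := by
    ext e
    rw [Ideal.mem_span_singleton, X_dvd_iff, Ideal.under_def, Ideal.mem_comap, hmem]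
    exact ⟨hτker e, fun he ↦ by rw [← map_zero (powerSeriesMap F ℓ), ← he]; exact hτ₀ e⟩
  -- The element `u` generates the maximal ideal of the local ring at `𝔭`, and the residue extension
  -- is separable because `ℓ` is.
  have hunr : Algebra.IsUnramifiedAt (PowerSeries (PowerSeries F)) 𝔭 := by
    refine isUnramifiedAt_of_ringHom (S := PowerSeries F) (k := LaurentSeries F) (ℓ := ℓ) h𝔭 C
      (fun c ↦ ?_) ?_
    · have : algebraMap (PowerSeries (PowerSeries F)) A (C c) = σ c := hτC c
      rw [this, hφ₀]
      rfl
    · rw [hunder, Ideal.map_span, Set.image_singleton,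
        IsScalarTower.algebraMap_apply (PowerSeries (PowerSeries F)) A (Localization.AtPrime 𝔭)]
      have : algebraMap (PowerSeries (PowerSeries F)) A X = u := hτX
      rw [this]
      have := h.isPrincipalIdealRing_localization fun hJ ↦ hz𝔭 (hJ hz)
      refine span_singleton_eq_maximalIdeal ?_ hu₂
      rw [← Localization.AtPrime.map_eq_maximalIdeal]
      exact Ideal.mem_map_of_mem _ hu𝔭
  -- The base points fix `F⟦X⟧` and send the outer variable to `X ^ (n + 1)`; the exponent must be
  -- positive for the substitution.
  choose ρ hρC hρX using fun n : ℕ ↦ exists_powerSeries_ringHom (RingHom.id (PowerSeries F))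
    (Ideal.span {X}) (u := X ^ (n + 1)) (Ideal.pow_mem_of_mem _ (Ideal.mem_span_singleton_self X) _
      n.succ_pos)
  obtain ⟨φ, h1, h2⟩ := exists_tendsto_of_isUnramifiedAt hO' φ₀ h𝔭 (l := atTop)
    (ρ := fun n ↦ (powerSeriesMap F ℓ).comp (ρ n)) ⟨X, hunder⟩ (fun e ↦ by
      have h3 : φ₀ (algebraMap _ A e) = powerSeriesMap F ℓ (constantCoeff e) := hτ₀ e
      rw [h3]
      refine (tendsto_add_X_pow hO' (powerSeriesMap F ℓ (constantCoeff e)) fun n ↦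
        X * ρ n (PowerSeries.mk fun p ↦ coeff (p + 1) e)).congr fun n ↦ ?_
      have h4 := congrArg (ρ n) (sub_const_eq_X_mul_shift e)
      rw [map_sub, map_mul, hρC, hρX, sub_eq_iff_eq_add'] at h4
      rw [RingHom.comp_apply, h4, map_add, pow_succ, mul_assoc]
      rfl)
  refine ⟨u, φ, ?_, h2⟩
  filter_upwards [h1] with n hn
  refine ⟨fun f ↦ ?_, ?_⟩
  · have h3 := RingHom.congr_fun hn (C f)
    rw [← hτC]
    refine h3.trans ?_
    rw [RingHom.comp_apply, hρC]
    rfl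
  · have h3 := RingHom.congr_fun hn X
    rw [← hτX]
    refine h3.trans ?_
    rw [RingHom.comp_apply, hρX]

end Approximation

/-! ### Finiteness of integral closures from finiteness of Frobenius -/

section FrobeniusFinite

open PowerSeries

theorem finite_powerSeries_quotient_X_pow (R : Type*) [CommRing R] [IsNoetherianRing R] (n : ℕ) :
    Module.Finite R (PowerSeries R ⧸ (Ideal.span {(X : PowerSeries R) ^ n})) := by
  have : Module.Finite R (PowerSeries R ⧸ Ideal.span {(X : PowerSeries R)}) := by
    refine Module.Finite.of_surjective (Algebra.linearMap R _) fun y ↦ ?_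
    obtain ⟨f, rfl⟩ := Ideal.Quotient.mk_surjective y
    refine ⟨constantCoeff f, ?_⟩
    change Ideal.Quotient.mk _ (C (constantCoeff f)) = _
    rw [eq_comm, Ideal.Quotient.eq, Ideal.mem_span_singleton, X_dvd_iff]
    simp
  refine finite_of_pow_smul_eq_bot (Ideal.span {(X : PowerSeries R)}) n _ ?_
  rw [eq_bot_iff, Submodule.smul_le]
  intro a ha m _
  rw [Submodule.mem_bot]
  refine (Algebra.smul_def a m).trans ?_
  rw [Ideal.span_singleton_pow] at ha
  have : algebraMap (PowerSeries R) (PowerSeries R ⧸ (Ideal.span {(X : PowerSeries R) ^ n})) a = 0 :=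
    Ideal.Quotient.eq_zero_iff_mem.2 ha
  rw [this, zero_mul]

/-- The Frobenius of a power series ring is finite if that of the coefficients is. -/
theorem frobenius_powerSeries_finite (R : Type*) [CommRing R] [IsNoetherianRing R] [IsDomain R]
    (p : ℕ) [ExpChar R p] [ExpChar (PowerSeries R) p] (h : (frobenius R p).Finite) :
    (frobenius (PowerSeries R) p).Finite := by
  have hp : p ≠ 0 := (expChar_pos R p).ne'
  have hX : frobenius (PowerSeries R) p X = X ^ p := rfl
  have : IsHausdorff (Ideal.span {frobenius (PowerSeries R) p X}) (PowerSeries R) := by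
    refine IsHausdorff.of_isDomain _ ?_
    rw [hX, ne_eq, Ideal.span_singleton_eq_top, isUnit_pow_iff hp]
    exact X_prime.not_isUnit
  refine finite_powerSeries_ringHom _ ?_
  have h1 : (Ideal.Quotient.mk (Ideal.span {frobenius (PowerSeries R) p X})).comp
      ((frobenius (PowerSeries R) p).comp C) =
      (algebraMap R (PowerSeries R ⧸ Ideal.span {(X : PowerSeries R) ^ p})).comp
        (frobenius R p) := by
    refine RingHom.ext fun r ↦ ?_
    exact congrArg (Ideal.Quotient.mk (Ideal.span {(X : PowerSeries R) ^ p})) (map_pow C r p).symm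
  rw [h1]
  exact RingHom.Finite.comp
    (RingHom.finite_algebraMap.2 (finite_powerSeries_quotient_X_pow R p)) h

theorem iterateFrobenius_finite (R : Type*) [CommRing R] (p : ℕ) [ExpChar R p]
    (h : (frobenius R p).Finite) (n : ℕ) : (iterateFrobenius R p n).Finite := by
  induction n with
  | zero =>
    have : iterateFrobenius R p 0 = RingHom.id R := RingHom.ext fun x ↦ by simp
    rw [this]
    exact RingHom.Finite.id R
  | succ n ih =>
    have : iterateFrobenius R p (n + 1) = (iterateFrobenius R p n).comp (frobenius R p) :=
      RingHom.ext fun x ↦ by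
        rw [RingHom.comp_apply, iterateFrobenius_def, iterateFrobenius_def, frobenius_def, ← pow_mul,
          pow_succ, mul_comm]
    rw [this]
    exact ih.comp h

theorem finite_of_injective_ringHom {E A B : Type*} [CommRing E] [IsNoetherianRing E] [CommRing A]
    [Algebra E A] [CommRing B] {g : E →+* B} (hg : g.Finite) {f : A →+* B}
    (hf : Function.Injective f) (h : ∀ e, f (algebraMap E A e) = g e) : Module.Finite E A := by
  let := g.toAlgebra
  have : Module.Finite E B := hg
  let f' : A →ₐ[E] B := { f with commutes' := h }
  exact Module.Finite.of_injective f'.toLinearMap hf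

/-- A normal Noetherian domain with finite Frobenius has finite integral closures in finite
extensions of its field of fractions. -/
theorem finite_integralClosure (E Q K : Type*) [CommRing E] [IsDomain E] [IsNoetherianRing E]
    [IsIntegrallyClosed E] [Field Q] [Algebra E Q] [IsFractionRing E Q] [Field K] [Algebra E K]
    [Algebra Q K] [IsScalarTower E Q K] [FiniteDimensional Q K] (p : ℕ) [ExpChar E p]
    (hp : (frobenius E p).Finite) : Module.Finite E (integralClosure E K) := by
  have : ExpChar Q p := expChar_of_injective_ringHom (IsFractionRing.injective E Q) p
  have : ExpChar K p := expChar_of_injective_ringHom (algebraMap Q K).injective p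
  let S := separableClosure Q K
  have hfin : Module.Finite E (integralClosure E S) :=
    IsIntegralClosure.finite E Q S (integralClosure E S)
  -- One exponent serves all of `K`, which is finitely generated over the separable closure. The `p
  -- ^ n`-power map then embeds the integral closure in `K` into that in `S`, linearly over the
  -- iterated Frobenius.
  obtain ⟨n, hn⟩ : ∃ n, ∀ x : K, x ^ p ^ n ∈ S := by
    have h1 : ∀ x : K, ∃ n, x ^ p ^ n ∈ (algebraMap S K).range :=
      fun x ↦ IsPurelyInseparable.pow_mem S p x
    choose m hm using h1
    obtain ⟨t, ht⟩ : ∃ t : Finset K, Algebra.adjoin S (t : Set K) = ⊤ :=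
      (inferInstance : Algebra.FiniteType S K).out
    let n := t.sup m
    refine ⟨n, fun x ↦ ?_⟩
    have hx : x ∈ Algebra.adjoin S (t : Set K) := ht ▸ Algebra.mem_top
    induction hx using Algebra.adjoin_induction with
    | mem x hx =>
      obtain ⟨y, hy⟩ := hm x
      obtain ⟨d, hd⟩ := Nat.exists_eq_add_of_le (Finset.le_sup (f := m) hx)
      change x ^ p ^ t.sup m ∈ S
      rw [hd, pow_add, pow_mul, ← hy]
      exact pow_mem y.2 _
    | algebraMap s => exact pow_mem s.2 _
    | add x y _ _ hx hy => rw [add_pow_expChar_pow]; exact add_mem hx hy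
    | mul x y _ _ hx hy => rw [mul_pow]; exact mul_mem hx hy
  let B := integralClosure E S
  have hint : ∀ a : integralClosure E K, IsIntegral E (⟨_, hn a⟩ : S) := by
    intro a
    have h1 : IsIntegral E ((a : K) ^ p ^ n) := IsIntegral.pow a.2 _
    exact (isIntegral_algHom_iff (S.val.restrictScalars E) Subtype.val_injective).1 h1
  let f : integralClosure E K →+* B :=
    { toFun := fun a ↦ ⟨⟨_, hn a⟩, hint a⟩
      map_one' := Subtype.ext (Subtype.ext (one_pow _))
      map_zero' := Subtype.ext (Subtype.ext (zero_pow (expChar_pow_pos K p n).ne'))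
      map_add' := fun a b ↦ Subtype.ext (Subtype.ext (add_pow_expChar_pow (a : K) b p n))
      map_mul' := fun a b ↦ Subtype.ext (Subtype.ext (mul_pow (a : K) b _)) }
  refine finite_of_injective_ringHom (g := (algebraMap E B).comp (iterateFrobenius E p n))
    (RingHom.Finite.comp (RingHom.finite_algebraMap.2 hfin) (iterateFrobenius_finite E p hp n))
    (f := f) (fun a b hab ↦ ?_) fun e ↦ ?_
  · have h1 : (a : K) ^ p ^ n = (b : K) ^ p ^ n :=
      congrArg (fun x : B ↦ ((x : S) : K)) hab
    exact Subtype.ext (iterateFrobenius_inj K p n h1)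
  · refine Subtype.ext (Subtype.ext ?_)
    change (algebraMap E K e) ^ p ^ n = algebraMap E K (e ^ p ^ n)
    rw [map_pow]

end FrobeniusFinite

/-! ### Power series in two variables -/

section PowerSeries₂

open PowerSeries

variable (F : Type u) [Field F]

theorem algebraMap_powerSeries₂ (c : F) : algebraMap F (PowerSeries₂ F) c = C (C c) := by
  rw [PowerSeries.algebraMap_apply, PowerSeries.algebraMap_apply, Algebra.algebraMap_self_apply]

/-- The maximal ideal `(x, y)` of `F⟦x, y⟧`. -/
abbrev powerSeries₂Ideal : Ideal (PowerSeries₂ F) := powerSeriesIdeal (Ideal.span {X})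

theorem mem_powerSeries₂Ideal {f : PowerSeries₂ F} :
    f ∈ powerSeries₂Ideal F ↔ constantCoeff (constantCoeff f) = 0 := by
  rw [← pow_one (powerSeries₂Ideal F), mem_powerSeriesIdeal_pow]
  simp only [Nat.lt_one_iff, forall_eq, tsub_zero, pow_one, Ideal.mem_span_singleton, X_dvd_iff,
    coeff_zero_eq_constantCoeff]

theorem maximalIdeal_powerSeries₂ :
    IsLocalRing.maximalIdeal (PowerSeries₂ F) = powerSeries₂Ideal F := by
  ext f
  rw [mem_powerSeries₂Ideal, IsLocalRing.mem_maximalIdeal, mem_nonunits_iff,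
    isUnit_iff_constantCoeff, isUnit_iff_constantCoeff, isUnit_iff_ne_zero, not_not]

theorem finite_frobenius_powerSeries₂ [PerfectField F] (p : ℕ) [ExpChar F p]
    [ExpChar (PowerSeries₂ F) p] : (frobenius (PowerSeries₂ F) p).Finite := by
  have : ExpChar (PowerSeries F) p := expChar_of_injective_ringHom C_injective p
  have : PerfectRing F p := PerfectField.toPerfectRing p
  refine frobenius_powerSeries_finite _ p (frobenius_powerSeries_finite _ p ?_)
  exact RingHom.Finite.of_surjective _ (surjective_frobenius F p)

/-- Krull's height theorem for the two generators. -/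
theorem height_powerSeries₂Ideal_le : (powerSeries₂Ideal F).height ≤ 2 := by
  have h1 : powerSeries₂Ideal F = Ideal.span {C X, X} := by
    rw [Ideal.span_insert, powerSeries₂Ideal, powerSeriesIdeal, Ideal.map_span,
      Set.image_singleton]
  have h2 : (powerSeries₂Ideal F).IsPrime := by
    rw [← maximalIdeal_powerSeries₂]
    infer_instance
  refine (Ideal.height_le_card_of_mem_minimalPrimes_span (s := {C X, X}) (Set.toFinite _)
    ?_).trans ?_
  · rw [← h1]
    rw [Ideal.minimalPrimes_eq_subsingleton_self]
    rfl
  · exact_mod_cast Set.ncard_insert_le _ _ |>.trans (by rw [Set.ncard_singleton])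

/-- There is no chain of three nonzero primes in `F⟦x, y⟧`. -/
theorem eq_powerSeries₂Ideal_of_lt {𝔯 Q : Ideal (PowerSeries₂ F)} [𝔯.IsPrime] [Q.IsPrime]
    (h0 : 𝔯 ≠ ⊥) (hlt : 𝔯 < Q) : Q = powerSeries₂Ideal F := by
  have hmax := maximalIdeal_powerSeries₂ F
  have hle : Q ≤ powerSeries₂Ideal F := hmax ▸ IsLocalRing.le_maximalIdeal Ideal.IsPrime.ne_top'
  by_contra hne
  have : (powerSeries₂Ideal F).IsPrime := by
    rw [← maximalIdeal_powerSeries₂]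
    infer_instance
  have h1 := Ideal.height_add_one_le_of_lt_of_isPrime (lt_of_le_of_ne hle hne)
  have h2 := Ideal.height_add_one_le_of_lt_of_isPrime hlt
  have h3 := Ideal.height_add_one_le_of_lt_of_isPrime (I := ⊥) (bot_lt_iff_ne_bot.2 h0)
  have h4 : (3 : ℕ∞) ≤ 2 := calc
    (3 : ℕ∞) = 0 + 1 + 1 + 1 := by norm_num
    _ ≤ (⊥ : Ideal (PowerSeries₂ F)).height + 1 + 1 + 1 := by gcongr; exact zero_le
    _ ≤ 𝔯.height + 1 + 1 := by gcongr
    _ ≤ Q.height + 1 := by gcongr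
    _ ≤ (powerSeries₂Ideal F).height := h1
    _ ≤ 2 := height_powerSeries₂Ideal_le F
  exact absurd h4 (by decide)

theorem isAdicComplete_powerSeries₂Ideal :
    IsAdicComplete (powerSeries₂Ideal F) (PowerSeries₂ F) :=
  isAdicComplete_powerSeriesIdeal _

/-- Finite torsion-free algebras over `F⟦x, y⟧` are complete surfaces. -/
theorem isCompleteSurface_of_finite {A : Type*} [CommRing A] [IsDomain A]
    [Algebra (PowerSeries₂ F) A] [Module.Finite (PowerSeries₂ F) A] [Algebra F A]
    [IsScalarTower F (PowerSeries₂ F) A] :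
    IsCompleteSurface F ((powerSeries₂Ideal F).map (algebraMap (PowerSeries₂ F) A)) where
  isNoetherianRing := IsNoetherianRing.of_finite (PowerSeries₂ F) A
  isAdicComplete := by
    have := isAdicComplete_powerSeries₂Ideal F
    exact isAdicComplete_map_of_finite (powerSeries₂Ideal F) A
  finite_quotient := by
    have : Module.Finite F (PowerSeries₂ F ⧸ powerSeries₂Ideal F) := by
      refine Module.Finite.of_surjective (Algebra.linearMap F _) fun y ↦ ?_
      obtain ⟨f, rfl⟩ := Ideal.Quotient.mk_surjective y
      refine ⟨constantCoeff (constantCoeff f), ?_⟩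
      change Ideal.Quotient.mk _ (algebraMap F (PowerSeries₂ F) _) = _
      rw [algebraMap_powerSeries₂, eq_comm, Ideal.Quotient.eq, mem_powerSeries₂Ideal]
      simp
    refine finite_of_pow_smul_eq_bot (powerSeries₂Ideal F) 1 _ ?_
    rw [eq_bot_iff, Submodule.smul_le, pow_one]
    intro a ha m _
    rw [Submodule.mem_bot]
    refine (Algebra.smul_def a m).trans ?_
    have : algebraMap (PowerSeries₂ F)
        (A ⧸ (powerSeries₂Ideal F).map (algebraMap (PowerSeries₂ F) A)) a = 0 :=
      Ideal.Quotient.eq_zero_iff_mem.2 (Ideal.mem_map_of_mem _ ha)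
    rw [this, zero_mul]
  -- Contraction along an integral extension preserves strict inclusions of primes and nonzero
  -- primes, so the upper prime contracts to the maximal ideal.
  le_of_lt := fun 𝔯 Q h𝔯 hQ h0 hlt ↦ by
    have h1 := eq_powerSeries₂Ideal_of_lt F (Ideal.under_ne_bot (A := PowerSeries₂ F) h0)
      (Ideal.IsIntegral.comap_lt_comap (R := PowerSeries₂ F) hlt)
    rw [Ideal.map_le_iff_le_comap]
    exact h1.ge

end PowerSeries₂

/-! ### Separability in terms of `p`-th powers -/

section Separability

variable {k ℓ : Type*} [Field k] [Field ℓ] [Algebra k ℓ] {p : ℕ} [hp : Fact p.Prime]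

/-- The powers of an element that is not a `p`-th power are independent over the `p`-th powers. -/
theorem eq_zero_of_sum_pow_mul_pow_eq_zero [CharP ℓ p] {z : ℓ} (hz : ∀ y, y ^ p ≠ z)
    {y : Fin p → ℓ} (hy : ∑ j, y j ^ p * z ^ (j : ℕ) = 0) (j : Fin p) : y j = 0 := by
  let L₀ := (frobenius ℓ p).fieldRange
  have hmem : ∀ x : ℓ, x ^ p ∈ L₀ := fun x ↦ ⟨x, rfl⟩
  let a : L₀ := ⟨z ^ p, hmem z⟩
  -- Over the field of `p`-th powers, `X ^ p - z ^ p` is irreducible because `z` is not a `p`-th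
  -- power; so `z` has degree `p`.
  have hirr : Irreducible (Polynomial.X ^ p - Polynomial.C a) := by
    refine X_pow_sub_C_irreducible_of_prime hp.out ?_
    rintro ⟨_, ⟨y, rfl⟩⟩ hb
    refine hz y (frobenius_inj ℓ p ?_)
    exact congrArg Subtype.val hb
  have hmin : Polynomial.X ^ p - Polynomial.C a = minpoly L₀ z := by
    refine minpoly.eq_of_irreducible_of_monic hirr ?_ (Polynomial.monic_X_pow_sub_C _ hp.out.ne_zero)
    rw [map_sub, map_pow, Polynomial.aeval_X, Polynomial.aeval_C]
    exact sub_self _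
  let P : Polynomial L₀ := ∑ j : Fin p, Polynomial.C ⟨_, hmem (y j)⟩ * Polynomial.X ^ (j : ℕ)
  have hP : P = 0 := by
    by_contra hne
    have h1 := minpoly.degree_le_of_ne_zero L₀ z hne (by
      simp only [P, map_sum, map_mul, map_pow, Polynomial.aeval_X, Polynomial.aeval_C]
      exact hy)
    rw [← hmin, Polynomial.degree_X_pow_sub_C hp.out.pos] at h1
    exact absurd (Polynomial.degree_sum_fin_lt fun j ↦ (⟨_, hmem (y j)⟩ : L₀)) (not_lt.2 h1)
  have h2 : P.coeff j = ⟨_, hmem (y j)⟩ := by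
    simp [P, Polynomial.finsetSum_coeff, Polynomial.coeff_C_mul, Polynomial.coeff_X_pow,
      Fin.val_inj]
  rw [hP, Polynomial.coeff_zero] at h2
  exact pow_eq_zero_iff hp.out.ne_zero |>.1 (congrArg Subtype.val h2.symm)

omit hp in
/-- A finite extension spanned by `p`-th powers is separable. -/
theorem isSeparable_of_span_pow [CharP ℓ p] [FiniteDimensional k ℓ]
    (h : Submodule.span k (Set.range fun x : ℓ ↦ x ^ p) = ⊤) : Algebra.IsSeparable k ℓ := by
  -- Differentials of `p`-th powers vanish, so none survive when `p`-th powers span.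
  have hD : ∀ x : ℓ, KaehlerDifferential.D k ℓ x = 0 := by
    intro x
    have hx : x ∈ Submodule.span k (Set.range fun x : ℓ ↦ x ^ p) := h ▸ Submodule.mem_top
    induction hx using Submodule.span_induction with
    | mem x hx =>
      obtain ⟨y, rfl⟩ := hx
      rw [Derivation.leibniz_pow, ← Nat.cast_smul_eq_nsmul ℓ, CharP.cast_eq_zero, zero_smul]
    | zero => exact map_zero _
    | add x y _ _ hx hy => rw [map_add, hx, hy, add_zero]
    | smul c x _ hx => rw [(KaehlerDifferential.D k ℓ).map_smul, hx, smul_zero]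
  have : Algebra.FormallyUnramified k ℓ := by
    refine ⟨(Submodule.subsingleton_iff ℓ).1 (subsingleton_of_bot_eq_top ?_)⟩
    rw [← KaehlerDifferential.span_range_derivation k ℓ, eq_comm, eq_bot_iff, Submodule.span_le]
    rintro _ ⟨x, rfl⟩
    exact hD x
  exact Algebra.FormallyUnramified.isSeparable k ℓ

/-- Expanding coefficients in powers of `z` turns a linear relation among the `p`-th powers of a
basis into one of the form `∑ y j ^ p * z ^ j = 0`, which is trivial. So these `p`-th powers are
again a basis. -/
theorem isSeparable_of_forall_pow_ne [CharP ℓ p] [FiniteDimensional k ℓ] {z : k}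
    (hk : ∀ c : k, ∃ d : Fin p → k, c = ∑ j, d j ^ p * z ^ (j : ℕ))
    (hz : ∀ y : ℓ, y ^ p ≠ algebraMap k ℓ z) : Algebra.IsSeparable k ℓ := by
  let b := Module.finBasis k ℓ
  have hli : LinearIndependent k fun i ↦ b i ^ p := by
    rw [Fintype.linearIndependent_iff]
    intro c hc i
    choose d hd using fun i ↦ hk (c i)
    have h1 : ∑ j, (∑ i, d i j • b i) ^ p * algebraMap k ℓ z ^ (j : ℕ) = 0 := by
      rw [← hc]
      simp_rw [sum_pow_char p, Finset.sum_mul]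
      rw [Finset.sum_comm]
      refine Finset.sum_congr rfl fun i _ ↦ ?_
      conv_rhs => rw [hd i, Finset.sum_smul]
      refine Finset.sum_congr rfl fun j _ ↦ ?_
      rw [Algebra.smul_def, Algebra.smul_def, mul_pow, map_mul, map_pow, map_pow]
      ring
    have h2 : ∀ i j, d i j = 0 := fun i j ↦
      Fintype.linearIndependent_iff.1 b.linearIndependent (fun i ↦ d i j)
        (eq_zero_of_sum_pow_mul_pow_eq_zero hz h1 j) i
    rw [hd i]
    exact Finset.sum_eq_zero fun j _ ↦ by rw [h2, zero_pow hp.out.ne_zero, zero_mul]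
  refine isSeparable_of_span_pow (p := p) (eq_top_iff.2 ?_)
  rw [← hli.span_eq_top_of_card_eq_finrank' (by simp)]
  refine Submodule.span_mono ?_
  rintro _ ⟨i, rfl⟩
  exact ⟨b i, rfl⟩

/-- Fields with a finite extension whose elements are all `p`-th powers have the same property. -/
theorem exists_pow_eq_of_finiteDimensional [CharP ℓ p] [FiniteDimensional k ℓ]
    (h : ∀ y : ℓ, ∃ x, x ^ p = y) (c : k) : ∃ d, d ^ p = c := by
  let b := Module.finBasis k ℓ
  have hrepr : ∀ y : ℓ, y ^ p = ∑ i, b.repr y i ^ p • b i ^ p := by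
    intro y
    conv_lhs => rw [← b.sum_repr y, sum_pow_char p]
    exact Finset.sum_congr rfl fun i _ ↦ smul_pow ..
  have hli : LinearIndependent k fun i ↦ b i ^ p := by
    refine linearIndependent_of_top_le_span_of_card_eq_finrank (fun y _ ↦ ?_) (by simp)
    obtain ⟨x, rfl⟩ := h y
    rw [hrepr]
    exact Submodule.sum_mem _ fun i _ ↦ Submodule.smul_mem _ _ (Submodule.subset_span ⟨i, rfl⟩)
  have : Nonempty (Fin (Module.finrank k ℓ)) := ⟨⟨0, Module.finrank_pos⟩⟩
  let i₀ : Fin (Module.finrank k ℓ) := Classical.arbitrary _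
  -- The `p`-th powers of the basis form a basis, and comparing coefficients at `i₀` exhibits `c` as
  -- a `p`-th power.
  obtain ⟨x, hx⟩ := h (c • b i₀ ^ p)
  refine ⟨b.repr x i₀, ?_⟩
  have h1 : ∑ i, (b.repr x i ^ p - if i = i₀ then c else 0) • b i ^ p = 0 := by
    simp only [sub_smul, Finset.sum_sub_distrib, ite_smul, zero_smul, Finset.sum_ite_eq',
      Finset.mem_univ, if_true]
    rw [← hrepr, hx, sub_self]
  have h2 := Fintype.linearIndependent_iff.1 hli _ h1 i₀
  rwa [if_pos rfl, sub_eq_zero] at h2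

end Separability

/-! ### `p`-th powers in power series and Laurent series -/

section PthPowers

open PowerSeries

/-- Elements spanning a separated ring over `R⟦X⟧` modulo `X` span it. -/
theorem exists_sum_of_forall_quotient {R : Type*} {M : Type*} [CommRing R] [CommRing M]
    (τ : PowerSeries R →+* M) [IsHausdorff (Ideal.span {τ X}) M] {ι : Type*} [Fintype ι]
    (m : ι → M) (h : ∀ y, ∃ r : ι → R, y - ∑ i, τ (C (r i)) * m i ∈ Ideal.span {τ X}) (y : M) :
    ∃ s : ι → PowerSeries R, y = ∑ i, τ (s i) * m i := by
  let := τ.toAlgebra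
  have hmap : (Ideal.span {(X : PowerSeries R)}).map (algebraMap (PowerSeries R) M) =
      Ideal.span {τ X} := by
    rw [Ideal.map_span, Set.image_singleton]
    rfl
  have : IsHausdorff (Ideal.span {(X : PowerSeries R)}) M :=
    IsHausdorff.map_algebraMap_iff.1 (by rw [hmap]; infer_instance)
  have hsub : (Ideal.span {(X : PowerSeries R)} • ⊤ : Submodule (PowerSeries R) M) =
      (Ideal.span {τ X}).restrictScalars (PowerSeries R) := by
    rw [← hmap, Ideal.smul_top_eq_map]
  have := isPrecomplete_of_finite (Ideal.span {(X : PowerSeries R)}) (ι → PowerSeries R)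
  let f : (ι → PowerSeries R) →ₗ[PowerSeries R] M := Fintype.linearCombination _ m
  have hf : Function.Surjective f := by
    refine surjective_of_mkQ_comp_surjective (I := Ideal.span {(X : PowerSeries R)}) fun y ↦ ?_
    obtain ⟨y, rfl⟩ := Submodule.mkQ_surjective _ y
    obtain ⟨r, hr⟩ := h y
    refine ⟨fun i ↦ C (r i), ?_⟩
    rw [LinearMap.comp_apply, Submodule.mkQ_apply, Submodule.mkQ_apply, eq_comm,
      Submodule.Quotient.eq, hsub]
    exact hr
  obtain ⟨s, hs⟩ := hf y
  exact ⟨s, hs.symm⟩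

variable {F : Type*} [Field F] [PerfectField F] {p : ℕ} [hp : Fact p.Prime] [CharP F p]

theorem exists_sum_pow_mul_X_pow (f : PowerSeries F) :
    ∃ s : Fin p → PowerSeries F, f = ∑ j, s j ^ p * X ^ (j : ℕ) := by
  have : CharP (PowerSeries F) p := charP_of_injective_ringHom C_injective p
  have : PerfectRing F p := PerfectField.toPerfectRing p
  have hX : frobenius (PowerSeries F) p X = X ^ p := rfl
  have : IsHausdorff (Ideal.span {frobenius (PowerSeries F) p X}) (PowerSeries F) := by
    refine IsHausdorff.of_isDomain _ ?_
    rw [hX, ne_eq, Ideal.span_singleton_eq_top, isUnit_pow_iff hp.out.ne_zero]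
    exact X_prime.not_isUnit
  refine exists_sum_of_forall_quotient (frobenius (PowerSeries F) p) (fun j : Fin p ↦ X ^ (j : ℕ))
    (fun g ↦ ?_) f
  choose r hr using fun j : Fin p ↦ surjective_frobenius F p (coeff (j : ℕ) g)
  refine ⟨r, ?_⟩
  rw [hX, Ideal.mem_span_singleton, X_pow_dvd_iff]
  intro m hm
  have h1 : ∀ j : Fin p, frobenius (PowerSeries F) p (C (r j)) = C (coeff (j : ℕ) g) := by
    intro j
    rw [← hr, frobenius_def, frobenius_def, map_pow]
  simp_rw [h1]
  rw [map_sub, map_sum, Finset.sum_eq_single (⟨m, hm⟩ : Fin p)]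
  · simp
  · intro j _ hj
    rw [coeff_C_mul, coeff_X_pow, if_neg, mul_zero]
    rintro rfl
    exact hj rfl
  · simp

theorem exists_sum_pow_mul_X_pow_laurent (c : LaurentSeries F) :
    ∃ s : Fin p → LaurentSeries F,
      c = ∑ j, s j ^ p * (algebraMap (PowerSeries F) (LaurentSeries F) X) ^ (j : ℕ) := by
  obtain ⟨a, b, hb, rfl⟩ := IsFractionRing.div_surjective (A := PowerSeries F) c
  have hb0 : algebraMap (PowerSeries F) (LaurentSeries F) b ≠ 0 :=
    (map_ne_zero_iff _ (IsFractionRing.injective _ _)).2 (nonZeroDivisors.ne_zero hb)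
  -- Writing `a / b` as `a * b ^ (p - 1) / b ^ p` makes the denominator a `p`-th power.
  obtain ⟨s, hs⟩ := exists_sum_pow_mul_X_pow (p := p) (a * b ^ (p - 1))
  refine ⟨fun j ↦ algebraMap _ _ (s j) / algebraMap _ _ b, ?_⟩
  have h1 := congrArg (algebraMap (PowerSeries F) (LaurentSeries F)) hs
  rw [map_mul, map_pow, map_sum] at h1
  have h2 : ∀ x y : LaurentSeries F, y ≠ 0 → x / y = x * y ^ (p - 1) / y ^ p := by
    intro x y hy
    rw [div_eq_div_iff hy (pow_ne_zero _ hy), mul_assoc, ← pow_succ,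
      Nat.sub_add_cancel hp.out.one_le]
  rw [h2 _ _ hb0, h1, Finset.sum_div]
  refine Finset.sum_congr rfl fun j _ ↦ ?_
  rw [map_mul, map_pow, map_pow, div_pow]
  ring

omit [PerfectField F] [CharP F p] in
-- A `p`-th root of `X` would be integral over the normal ring `F⟦X⟧`, hence in it, but `X` is
-- irreducible.
theorem X_pow_ne_laurent (d : LaurentSeries F) :
    d ^ p ≠ algebraMap (PowerSeries F) (LaurentSeries F) X := by
  intro h
  have h1 : IsIntegral (PowerSeries F) (d ^ p) := h ▸ isIntegral_algebraMap
  obtain ⟨g, rfl⟩ := IsIntegrallyClosed.isIntegral_iff.1 (h1.of_pow hp.out.pos)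
  rw [← map_pow] at h
  have h2 := IsFractionRing.injective (PowerSeries F) (LaurentSeries F) h
  exact not_irreducible_pow hp.out.ne_one (h2 ▸ X_prime.irreducible)

end PthPowers

/-! ### A parameter with separable residue field -/

section Parameters

open PowerSeries

variable {F : Type*} [Field F] {A : Type*} [CommRing A] [Algebra F A] {J : Ideal A}
  {ℓ : Type*} [Field ℓ] {φ : A →+* ℓ}

omit [Algebra F A] in
theorem injective_comp_of_X_ne_zero {σ : PowerSeries F →+* A} (hX : φ (σ X) ≠ 0) :
    Function.Injective (φ.comp σ) := by
  rw [injective_iff_map_eq_zero]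
  intro f hf
  by_contra hf0
  rw [← X_pow_order_mul_divXPowOrder (f := f), map_mul, map_pow] at hf
  have hu : IsUnit f.divXPowOrder := by
    rw [isUnit_iff_constantCoeff, isUnit_iff_ne_zero, ne_eq,
      constantCoeff_divXPowOrder_eq_zero_iff]
    exact hf0
  rcases mul_eq_zero.1 hf with h | h
  · exact hX (pow_eq_zero_iff (n := f.order.toNat) (by rintro h0; simp [h0] at h) |>.1 h)
  · exact (hu.map (φ.comp σ)).ne_zero h

/-- The residue field of a one-dimensional point is finite over the Laurent series in any parameter
that does not vanish there. -/
theorem IsCompleteSurface.exists_laurent_finite (h : IsCompleteSurface F J)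
    {σ : PowerSeries F →+* A} (hσ : ∀ c, σ (C c) = algebraMap F A c) (hz : σ X ∈ J)
    (hX : φ (σ X) ≠ 0) (h0 : RingHom.ker φ ≠ ⊥) (hℓ : ∀ y, ∃ a b, φ b ≠ 0 ∧ y * φ b = φ a) :
    ∃ j : LaurentSeries F →+* ℓ,
      (∀ f, j (algebraMap (PowerSeries F) (LaurentSeries F) f) = φ (σ f)) ∧ j.Finite := by
  let j : LaurentSeries F →+* ℓ := IsFractionRing.lift (injective_comp_of_X_ne_zero hX)
  have hj : ∀ f, j (algebraMap (PowerSeries F) (LaurentSeries F) f) = φ (σ f) := fun f ↦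
    IsFractionRing.lift_algebraMap (injective_comp_of_X_ne_zero hX) f
  refine ⟨j, hj, ?_⟩
  have hprime : (RingHom.ker φ).IsPrime := RingHom.ker_isPrime φ
  have hfin := h.finite_mk_comp_of_isPrime (𝔭 := RingHom.ker φ) hσ hz h0 hX
  let := ((Ideal.Quotient.mk (RingHom.ker φ)).comp σ).toAlgebra
  let := j.toAlgebra
  have : Module.Finite (PowerSeries F) (A ⧸ RingHom.ker φ) := hfin
  obtain ⟨t, ht⟩ := (inferInstance : Module.Finite (PowerSeries F) (A ⧸ RingHom.ker φ)).1
  let q : A ⧸ RingHom.ker φ →+* ℓ := Ideal.Quotient.lift _ φ fun _ h ↦ h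
  have hq : ∀ c : PowerSeries F, q (algebraMap _ _ c) =
      algebraMap (LaurentSeries F) ℓ (algebraMap (PowerSeries F) (LaurentSeries F) c) :=
    fun c ↦ (hj c).symm
  -- Adjoining the values of module generators gives a finite algebra containing all values and
  -- their inverses, hence all of `ℓ`.
  let B := Algebra.adjoin (LaurentSeries F) (q '' (t : Set (A ⧸ RingHom.ker φ)))
  have hqB : ∀ x, q x ∈ B := by
    intro x
    have hx : x ∈ Submodule.span (PowerSeries F) (t : Set (A ⧸ RingHom.ker φ)) :=
      ht ▸ Submodule.mem_top
    induction hx using Submodule.span_induction with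
    | mem x hx => exact Algebra.subset_adjoin ⟨x, hx, rfl⟩
    | zero => rw [map_zero]; exact zero_mem _
    | add x y _ _ hx hy => rw [map_add]; exact add_mem hx hy
    | smul c x _ hx =>
      rw [Algebra.smul_def, map_mul, hq]
      exact mul_mem (Subalgebra.algebraMap_mem _ _) hx
  have hint : ∀ x, IsIntegral (LaurentSeries F) (q x) := by
    intro x
    obtain ⟨P, hP, hPx⟩ := (inferInstance :
      Algebra.IsIntegral (PowerSeries F) (A ⧸ RingHom.ker φ)).isIntegral x
    refine ⟨P.map (algebraMap (PowerSeries F) (LaurentSeries F)), hP.map _, ?_⟩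
    have h1 : (algebraMap (LaurentSeries F) ℓ).comp (algebraMap (PowerSeries F) (LaurentSeries F)) =
        q.comp (algebraMap _ _) := RingHom.ext fun c ↦ (hq c).symm
    rw [Polynomial.eval₂_map, h1, ← Polynomial.hom_eval₂, hPx, map_zero]
  have hBfin : Module.Finite (LaurentSeries F) B :=
    Algebra.finite_adjoin_of_finite_of_isIntegral (t.finite_toSet.image _) (by
      rintro _ ⟨x, -, rfl⟩
      exact hint x)
  have hBtop : B = ⊤ := by
    rw [eq_top_iff]
    intro y _
    obtain ⟨a, b, hb, hab⟩ := hℓ y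
    have h1 : q (Ideal.Quotient.mk _ b) = φ b := rfl
    have h2 : (q (Ideal.Quotient.mk _ b))⁻¹ ∈ B :=
      B.inv_mem_of_algebraic (x := ⟨_, hqB (Ideal.Quotient.mk _ b)⟩) (hint _).isAlgebraic
    have h3 : y = q (Ideal.Quotient.mk _ a) * (q (Ideal.Quotient.mk _ b))⁻¹ :=
      (eq_mul_inv_iff_mul_eq₀ hb).2 hab
    rw [h3]
    exact mul_mem (hqB _) h2
  have : Module.Finite (LaurentSeries F) (⊤ : Subalgebra (LaurentSeries F) ℓ) := hBtop ▸ hBfin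
  exact Module.Finite.equiv Subalgebra.topEquiv.toLinearEquiv

/-- The residue field of a one-dimensional point is separable over the Laurent series in a suitable
parameter. -/
theorem IsCompleteSurface.exists_laurent_separable [PerfectField F] (h : IsCompleteSurface F J)
    (h0 : RingHom.ker φ ≠ ⊥) (hJ : ¬ J ≤ RingHom.ker φ)
    (hℓ : ∀ y, ∃ a b, φ b ≠ 0 ∧ y * φ b = φ a) :
    ∃ (σ : PowerSeries F →+* A) (j : LaurentSeries F →+* ℓ), (∀ c, σ (C c) = algebraMap F A c) ∧
      σ X ∈ J ∧ (∀ f, j (algebraMap (PowerSeries F) (LaurentSeries F) f) = φ (σ f)) ∧ j.Finite ∧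
      (letI := j.toAlgebra; Algebra.IsSeparable (LaurentSeries F) ℓ) := by
  have := h.isAdicComplete
  obtain ⟨z₀, hz₀J, hz₀⟩ := SetLike.not_le_iff_exists.1 hJ
  have hex : ∀ z ∈ J, φ z ≠ 0 → ∃ (σ : PowerSeries F →+* A) (j : LaurentSeries F →+* ℓ),
      (∀ c, σ (C c) = algebraMap F A c) ∧ σ X = z ∧
      (∀ f, j (algebraMap (PowerSeries F) (LaurentSeries F) f) = φ (σ f)) ∧ j.Finite := by
    intro z hzJ hz
    obtain ⟨σ, hσ, hσX⟩ := exists_powerSeries_ringHom (algebraMap F A) J hzJ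
    obtain ⟨j, hj⟩ := h.exists_laurent_finite hσ (hσX ▸ hzJ) (hσX ▸ hz) h0 hℓ
    exact ⟨σ, j, hσ, hσX, hj⟩
  obtain ⟨p, hp⟩ := CharP.exists F
  rcases CharP.char_is_prime_or_zero F p with hp1 | rfl
  · have : Fact p.Prime := ⟨hp1⟩
    have hC : Function.Injective ((algebraMap (PowerSeries F) (LaurentSeries F)).comp C) :=
      (IsFractionRing.injective (PowerSeries F) (LaurentSeries F)).comp C_injective
    have hCL : CharP (LaurentSeries F) p := charP_of_injective_ringHom hC p
    have hCℓ : ∀ j : LaurentSeries F →+* ℓ, CharP ℓ p := fun j ↦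
      charP_of_injective_ringHom j.injective p
    -- If all values of elements of `J` were `p`-th powers, dividing by the value at `z₀` would make
    -- every element of `ℓ` a `p`-th power. The same would then hold in `F((X))`, against
    -- `X_pow_ne_laurent`.
    obtain ⟨z, hzJ, hz⟩ : ∃ z ∈ J, ∀ y : ℓ, y ^ p ≠ φ z := by
      by_contra! hcon
      have hall : ∀ y : ℓ, ∃ x, x ^ p = y := by
        have hA : ∀ a, ∃ x, x ^ p = φ a := by
          intro a
          obtain ⟨x, hx⟩ := hcon (a * z₀) (J.mul_mem_left a hz₀J)
          obtain ⟨x', hx'⟩ := hcon z₀ hz₀J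
          refine ⟨x / x', ?_⟩
          rw [div_pow, hx, hx', map_mul, mul_div_cancel_right₀ _ hz₀]
        intro y
        obtain ⟨a, b, hb, hab⟩ := hℓ y
        obtain ⟨x, hx⟩ := hA a
        obtain ⟨x', hx'⟩ := hA b
        refine ⟨x / x', ?_⟩
        rw [div_pow, hx, hx', div_eq_iff hb, hab]
      obtain ⟨σ, j, -, -, -, hfin⟩ := hex z₀ hz₀J hz₀
      let := j.toAlgebra
      have : FiniteDimensional (LaurentSeries F) ℓ := hfin
      have := hCℓ j
      obtain ⟨d, hd⟩ := exists_pow_eq_of_finiteDimensional (k := LaurentSeries F) hall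
        (algebraMap (PowerSeries F) (LaurentSeries F) X)
      exact X_pow_ne_laurent d hd
    have hz0 : φ z ≠ 0 := fun h0 ↦ hz 0 (by rw [h0, zero_pow hp1.ne_zero])
    obtain ⟨σ, j, hσ, hσX, hj, hfin⟩ := hex z hzJ hz0
    refine ⟨σ, j, hσ, hσX ▸ hzJ, hj, hfin, ?_⟩
    let := j.toAlgebra
    have : FiniteDimensional (LaurentSeries F) ℓ := hfin
    have := hCℓ j
    refine isSeparable_of_forall_pow_ne (p := p) exists_sum_pow_mul_X_pow_laurent fun y hy ↦
      hz y (hy.trans ?_)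
    rw [← hσX]
    exact hj X
  · obtain ⟨σ, j, hσ, hσX, hj, hfin⟩ := hex z₀ hz₀J hz₀
    refine ⟨σ, j, hσ, hσX ▸ hz₀J, hj, hfin, ?_⟩
    let := j.toAlgebra
    have : FiniteDimensional (LaurentSeries F) ℓ := hfin
    have hC : Function.Injective ((algebraMap (PowerSeries F) (LaurentSeries F)).comp C) :=
      (IsFractionRing.injective (PowerSeries F) (LaurentSeries F)).comp C_injective
    have : CharP (LaurentSeries F) 0 := charP_of_injective_ringHom hC 0
    have : CharZero (LaurentSeries F) := CharP.charP_to_charZero _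
    infer_instance

end Parameters

/-! ### Independence of the local ring from the presentation of the point -/

section PointRings

/-- Only the kernel enters the definition, so a place does not remember the parameter used to
construct it. -/
theorem pointRing_eq_of_forall {A : Type*} [CommRing A] {K : Type*} [Field K] [Algebra A K]
    {Ω Ω' : Type*} [Field Ω] [Field Ω'] {φ : A →+* Ω} {φ' : A →+* Ω'}
    (h : ∀ a, φ a = 0 ↔ φ' a = 0) : pointRing K φ = pointRing K φ' := by
  ext x
  simp only [mem_pointRing, ne_eq, h]

theorem pointRing_comp_algebraMap {A B : Type*} [CommRing A] [CommRing B] [Algebra A B]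
    (M : Submonoid A) [IsLocalization M B] {K : Type*} [Field K] [Algebra A K] [Algebra B K]
    [IsScalarTower A B K] {Ω : Type*} [Field Ω] (φ : B →+* Ω) :
    pointRing K (φ.comp (algebraMap A B)) = pointRing K φ := by
  ext x
  rw [mem_pointRing, mem_pointRing]
  constructor
  · rintro ⟨a, b, hb, hab⟩
    refine ⟨algebraMap A B a, algebraMap A B b, hb, ?_⟩
    rwa [← IsScalarTower.algebraMap_apply, ← IsScalarTower.algebraMap_apply]
  · rintro ⟨a, b, hb, hab⟩
    obtain ⟨⟨a', s⟩, ha⟩ := IsLocalization.surj M a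
    obtain ⟨⟨b', t⟩, hb'⟩ := IsLocalization.surj M b
    have ha' : algebraMap A B a' = a * algebraMap A B s := ha.symm
    replace hb' : algebraMap A B b' = b * algebraMap A B t := hb'.symm
    have hunit : ∀ s : M, φ (algebraMap A B s) ≠ 0 := fun s ↦
      ((IsLocalization.map_units B s).map φ).ne_zero
    refine ⟨a' * t, b' * s, ?_, ?_⟩
    · rw [RingHom.comp_apply, map_mul, map_mul, hb', map_mul]
      exact mul_ne_zero (mul_ne_zero hb (hunit t)) (hunit s)
    · rw [IsScalarTower.algebraMap_apply A B K, IsScalarTower.algebraMap_apply A B K, map_mul (algebraMap A B),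
        map_mul (algebraMap A B), hb', ha']
      simp only [map_mul]
      rw [← hab]
      ring

end PointRings

/-! ### Local constancy over a ring of power series -/

section LaurentConstancy

open PowerSeries

variable {F : Type*} [Field F] {ℓ : Type*} [Field ℓ] [Algebra (LaurentSeries F) ℓ]
  [FiniteDimensional (LaurentSeries F) ℓ] {O' : ValuationSubring ℓ} {A : Type*} [CommRing A]
  {K : Type v} [Field K] [Algebra A K] [FaithfulSMul A K] {L : Type w} [Field L] [Algebra K L]
  [FiniteDimensional K L] [IsGalois K L]

/-- Local constancy of decomposition groups along a convergent family of points of an algebra over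
`F⟦X⟧` with values in a finite extension of `F((X))`. -/
theorem eventually_conjDecomposition_of_powerSeries
    (h : O'.comap (algebraMap (LaurentSeries F) ℓ) = laurentValuationRing F)
    {σ : PowerSeries F →+* A} {φ₀ : A →+* ℓ} {ι : Type*} {l : Filter ι} {φ : ι → A →+* ℓ}
    (hσ₀ : ∀ f, φ₀ (σ f) = powerSeriesMap F ℓ f) (hσ : ∀ i f, φ i (σ f) = powerSeriesMap F ℓ f)
    (hφ : ∀ a, Tendsto (fun i ↦ φ i a) l (@nhds ℓ (valuationTopology O') (φ₀ a)))
    (hℓ : ∀ y, ∃ a b, φ₀ b ≠ 0 ∧ y * φ₀ b = φ₀ a) [IsNoetherianRing (pointRing K φ₀)]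
    (hR : UnramifiedIn L (pointRing K φ₀)) :
    ∀ᶠ i in l, ConjDecomposition L (pointRing K φ₀) (pointRing K (φ i)) := by
  -- Inverting `σ X` provides the structure map from the Laurent series field; the local rings are
  -- unchanged because `σ X` is nonzero at all points in question.
  let B := Localization.Away (σ X)
  have hX : powerSeriesMap F ℓ X ≠ 0 := (map_ne_zero_iff _ powerSeriesMap_injective).2 X_ne_zero
  have hK : IsUnit (algebraMap A K (σ X)) := by
    refine IsUnit.mk0 _ fun h0 ↦ hX ?_
    rw [← hσ₀, (map_eq_zero_iff _ (FaithfulSMul.algebraMap_injective A K)).1 h0, map_zero]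
  let iK : B →+* K := IsLocalization.Away.lift (σ X) hK
  let := iK.toAlgebra
  have : IsScalarTower A B K := IsScalarTower.of_algebraMap_eq fun a ↦
    (IsLocalization.Away.lift_eq (σ X) hK a).symm
  have : FaithfulSMul B K := by
    rw [faithfulSMul_iff_algebraMap_injective, injective_iff_map_eq_zero]
    intro b hb
    obtain ⟨⟨a, s⟩, hab⟩ := IsLocalization.surj (Submonoid.powers (σ X)) b
    have h1 := congrArg (algebraMap B K) hab
    rw [map_mul, hb, zero_mul, ← IsScalarTower.algebraMap_apply, eq_comm,
      map_eq_zero_iff _ (FaithfulSMul.algebraMap_injective A K)] at h1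
    simp only at h1
    rw [h1, map_zero] at hab
    exact (IsLocalization.map_units B s).mul_left_eq_zero.1 hab
  have hB : IsUnit ((algebraMap A B).comp σ X) := IsLocalization.Away.algebraMap_isUnit (σ X)
  let j : LaurentSeries F →+* B := IsLocalization.Away.lift (X : PowerSeries F) hB
  have hj : ∀ f, j (algebraMap (PowerSeries F) (LaurentSeries F) f) = algebraMap A B (σ f) :=
    IsLocalization.Away.lift_eq (X : PowerSeries F) hB
  have hunit : ∀ ψ : A →+* ℓ, (∀ f, ψ (σ f) = powerSeriesMap F ℓ f) → IsUnit (ψ (σ X)) :=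
    fun ψ hψ ↦ IsUnit.mk0 _ (by rwa [hψ])
  have hlift : ∀ (ψ : A →+* ℓ) (hψ : ∀ f, ψ (σ f) = powerSeriesMap F ℓ f) c,
      (IsLocalization.Away.lift (σ X) (hunit ψ hψ) : B →+* ℓ) (j c) =
        algebraMap (LaurentSeries F) ℓ c := by
    intro ψ hψ
    refine RingHom.congr_fun (f := (IsLocalization.Away.lift (σ X) (hunit ψ hψ) : B →+* ℓ).comp j)
      (IsLocalization.ringHom_ext (nonZeroDivisors (PowerSeries F)) (RingHom.ext fun f ↦ ?_))
    rw [RingHom.comp_apply, RingHom.comp_apply, hj, IsLocalization.Away.lift_eq, hψ]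
    rfl
  let ψ₀ : B →+* ℓ := IsLocalization.Away.lift (σ X) (hunit φ₀ hσ₀)
  let ψ : ι → B →+* ℓ := fun i ↦ IsLocalization.Away.lift (σ X) (hunit (φ i) (hσ i))
  have hψ₀ : ψ₀.comp (algebraMap A B) = φ₀ := IsLocalization.Away.lift_comp (σ X) _
  have hψ : ∀ i, (ψ i).comp (algebraMap A B) = φ i := fun i ↦
    IsLocalization.Away.lift_comp (σ X) _
  have h₀ : pointRing K ψ₀ = pointRing K φ₀ := by
    rw [← hψ₀, pointRing_comp_algebraMap (Submonoid.powers (σ X))]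
  have : IsNoetherianRing (pointRing K ψ₀) := by rw [h₀]; infer_instance
  have key := eventually_conjDecomposition_of_finite (K := K) (L := L) (j := j) (φ₀ := ψ₀)
    (φ := ψ) (l := l) h (hlift φ₀ hσ₀) (fun i ↦ hlift (φ i) (hσ i)) (fun b ↦ by
      let := Valued.mk' O'.valuation
      obtain ⟨⟨a, s, m, rfl⟩, hab⟩ := IsLocalization.surj (Submonoid.powers (σ X)) b
      have hval : ∀ ψ : B →+* ℓ, (∀ f, ψ (algebraMap A B (σ f)) = powerSeriesMap F ℓ f) →
          ψ b = ψ (algebraMap A B a) * (powerSeriesMap F ℓ X ^ m)⁻¹ := by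
        intro ψ hψ
        rw [eq_mul_inv_iff_mul_eq₀ (pow_ne_zero _ hX), ← hψ, ← hab, map_mul]
        simp only [map_pow]
      have h1 : ∀ a, ψ₀ (algebraMap A B a) = φ₀ a := RingHom.congr_fun hψ₀
      have h2 : ∀ i a, ψ i (algebraMap A B a) = φ i a := fun i ↦ RingHom.congr_fun (hψ i)
      rw [hval ψ₀ (by simp only [h1, hσ₀, implies_true]), h1]
      refine (((hφ a).mul_const ((powerSeriesMap F ℓ X ^ m)⁻¹))).congr fun i ↦ ?_
      rw [hval (ψ i) (by simp only [h2, hσ, implies_true]), h2]) (fun y ↦ by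
      obtain ⟨a, b, hb, hab⟩ := hℓ y
      rw [← hψ₀] at hb hab
      exact ⟨algebraMap A B a, algebraMap A B b, hb, hab⟩) (by rwa [h₀])
  rw [h₀] at key
  refine key.mono fun i hi ↦ ?_
  have h3 : pointRing K (ψ i) = pointRing K (φ i) := by
    rw [← hψ i, pointRing_comp_algebraMap (Submonoid.powers (σ X))]
  rwa [h3] at hi

end LaurentConstancy

/-! ### Infinitely many places on a normal complete surface -/

section InfinitelyMany

open PowerSeries

variable {F : Type*} [Field F] [PerfectField F] {A : Type*} [CommRing A] [IsDomain A]
  [IsIntegrallyClosed A] [Algebra F A] {J : Ideal A} {K : Type v} [Field K] [Algebra A K]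
  [FaithfulSMul A K] {L : Type w} [Field L] [Algebra K L] [FiniteDimensional K L] [IsGalois K L]

/-- Decomposition groups at unramified one-dimensional points of a normal complete surface occur
infinitely often. -/
theorem IsCompleteSurface.infinite_conjDecomposition (h : IsCompleteSurface F J)
    (𝔭 : PrimeSpectrum A) (h0 : 𝔭.asIdeal ≠ ⊥) (hJ : ¬ J ≤ 𝔭.asIdeal)
    [IsNoetherianRing (pointRing K (algebraMap A 𝔭.asIdeal.ResidueField))]
    (hR : UnramifiedIn L (pointRing K (algebraMap A 𝔭.asIdeal.ResidueField))) :
    {v : PrimeSpectrum A | v.asIdeal ≠ ⊥ ∧ ¬ J ≤ v.asIdeal ∧ ConjDecomposition L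
      (pointRing K (algebraMap A 𝔭.asIdeal.ResidueField))
      (pointRing K (algebraMap A v.asIdeal.ResidueField))}.Infinite := by
  let ℓ := 𝔭.asIdeal.ResidueField
  let φ₀ : A →+* ℓ := algebraMap A ℓ
  have hker : RingHom.ker φ₀ = 𝔭.asIdeal := Ideal.ker_algebraMap_residueField _
  have hk0 : RingHom.ker φ₀ ≠ ⊥ := by rwa [hker]
  have hkJ : ¬ J ≤ RingHom.ker φ₀ := by rwa [hker]
  have hℓ : ∀ y, ∃ a b, φ₀ b ≠ 0 ∧ y * φ₀ b = φ₀ a := by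
    intro y
    obtain ⟨a, b, hb, rfl⟩ := IsFractionRing.div_surjective (A := A ⧸ 𝔭.asIdeal) y
    obtain ⟨a, rfl⟩ := Ideal.Quotient.mk_surjective a
    obtain ⟨b, rfl⟩ := Ideal.Quotient.mk_surjective b
    have hb0 : φ₀ b ≠ 0 := by
      rw [ne_eq, ← RingHom.mem_ker, hker, ← Ideal.Quotient.eq_zero_iff_mem]
      exact nonZeroDivisors.ne_zero hb
    exact ⟨a, b, hb0, div_mul_cancel₀ _ hb0⟩
  obtain ⟨σ, j, hσ, hz, hj, hfin, hsep⟩ := h.exists_laurent_separable (φ := φ₀)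
    hk0 hkJ hℓ
  let := j.toAlgebra
  have : FiniteDimensional (LaurentSeries F) ℓ := hfin
  have : Algebra.IsSeparable (LaurentSeries F) ℓ := hsep
  obtain ⟨O', hO'⟩ := exists_valuationSubring_comap_eq (laurentValuationRing F) ℓ
  have hσ₀ : ∀ f, φ₀ (σ f) = powerSeriesMap F ℓ f := fun f ↦ (hj f).symm
  obtain ⟨u, φ, h1, h2⟩ := h.exists_tendsto hO' hσ hz hσ₀ hk0
  obtain ⟨N, hN⟩ := eventually_atTop.1 h1
  have key := eventually_conjDecomposition_of_powerSeries (K := K) (L := L) hO' hσ₀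
    (φ := fun n ↦ φ (n + N)) (l := atTop) (fun n ↦ (hN (n + N) (Nat.le_add_left N n)).1)
    (fun a ↦ (h2 a).comp (tendsto_add_atTop_nat N)) hℓ hR
  obtain ⟨M, hM⟩ := eventually_atTop.1 key
  have hX : powerSeriesMap F ℓ X ≠ 0 := (map_ne_zero_iff _ powerSeriesMap_injective).2 X_ne_zero
  let V : ℕ → PrimeSpectrum A := fun n ↦ ⟨RingHom.ker (φ (n + M + N)), RingHom.ker_isPrime _⟩
  have hV : ∀ n, (V n).asIdeal.IsPrime := fun n ↦ (V n).2
  have hφN := fun n ↦ hN (n + M + N) (Nat.le_add_left N (n + M))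
  -- If two kernels agree, an element of the form `u - σ (X ^ m)` vanishes at both points, and
  -- comparing orders recovers the index.
  have hinj : Function.Injective V := by
    intro n m hnm
    have h3 : RingHom.ker (φ (n + M + N)) = RingHom.ker (φ (m + M + N)) :=
      congrArg PrimeSpectrum.asIdeal hnm
    have h4 : u - σ (X ^ (n + M + N + 1)) ∈ RingHom.ker (φ (n + M + N)) := by
      rw [RingHom.mem_ker, map_sub, (hφN n).1, (hφN n).2, sub_self]
    rw [h3, RingHom.mem_ker, map_sub, (hφN m).1, (hφN m).2, sub_eq_zero] at h4
    have h5 := congrArg order (powerSeriesMap_injective h4)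
    rw [order_X_pow, order_X_pow, Nat.cast_inj] at h5
    omega
  have hinf : (Set.range V \ {⊥}).Infinite :=
    (Set.infinite_range_of_injective hinj).sdiff (Set.finite_singleton _)
  refine hinf.mono ?_
  rintro _ ⟨⟨n, rfl⟩, hn⟩
  refine ⟨fun h3 ↦ hn (PrimeSpectrum.ext h3), fun h3 ↦ hX ?_, ?_⟩
  · rw [← (hφN n).1]
    exact h3 hz
  · have h3 := hM (n + M) (Nat.le_add_left M n)
    have h4 : pointRing K (φ (n + M + N)) =
        pointRing K (algebraMap A (V n).asIdeal.ResidueField) :=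
      pointRing_eq_of_forall fun a ↦ by
        rw [← RingHom.mem_ker (f := algebraMap A _), Ideal.ker_algebraMap_residueField,
          ← RingHom.mem_ker]
    rwa [← h4]

end InfinitelyMany

/-! ### Translation between rings and affine schemes -/

section AffineSchemes

variable {R : Type u} [CommRing R]

variable (R) in
/-- The spectrum of a ring as an affine open of itself. -/
abbrev specTop : (Spec (CommRingCat.of R)).affineOpens := ⟨⊤, isAffineOpen_top _⟩

variable (R) in
/-- A ring is the ring of global sections of its spectrum. -/
def specSections : R ≃+* Γ(Spec (CommRingCat.of R), (specTop R).1) :=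
  (Scheme.ΓSpecIso (CommRingCat.of R)).symm.commRingCatIsoToRingEquiv

theorem mem_specTop (q : Spec (CommRingCat.of R)) : q ∈ (specTop R).1 := trivial

theorem mem_basicOpen_specSections {q : Spec (CommRingCat.of R)} {a : R} :
    q ∈ (Spec (CommRingCat.of R)).basicOpen (specSections R a) ↔ a ∉ q.asIdeal := by
  have h : (Spec (CommRingCat.of R)).basicOpen (specSections R a) =
      PrimeSpectrum.basicOpen a := basicOpen_eq_of_affine (R := CommRingCat.of R) a
  rw [h]
  exact PrimeSpectrum.mem_basicOpen a q

theorem affineMap_specTop {k : Type u} [Field k] (g : k →+* R) (c : k) :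
    affineMap (Spec.map (CommRingCat.ofHom g)) (specTop R) c = specSections R (g c) := by
  have h : (isAffineOpen_top (Spec (CommRingCat.of R))).fromSpec ≫
      Spec.map (CommRingCat.ofHom g) =
      Spec.map (CommRingCat.ofHom g ≫ (Scheme.ΓSpecIso (CommRingCat.of R)).inv) := by
    rw [IsAffineOpen.fromSpec_top, Scheme.isoSpec_Spec_inv, ← Spec.map_comp]
  unfold affineMap
  erw [h, Spec.preimage_map]
  rfl

theorem functionFieldLift_germToFunctionField {R : CommRingCat.{u}} [IsDomain R] {K : Type v}
    [Field K] (g : R →+* K) (hg : Function.Injective g) [Nonempty (⊤ : (Spec R).Opens)] (a : R) :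
    functionFieldLift R g hg ((Spec R).germToFunctionField ⊤ ((Scheme.ΓSpecIso R).inv a)) = g a :=
  IsFractionRing.lift_algebraMap (A := R) (K := (Spec R).functionField) hg a

theorem placeRing_functionFieldMap [IsDomain R] {K : Type v} [Field K] [Algebra R K]
    [FaithfulSMul R K] (q : Spec (CommRingCat.of R)) {Ω : Type*} [Field Ω] {φ : R →+* Ω}
    (hφ : ∀ a, φ a = 0 ↔ a ∈ q.asIdeal) :
    placeRing (functionFieldMap (K := K) R) q = pointRing K φ := by
  have : IsDomain (CommRingCat.of R) := inferInstanceAs (IsDomain R)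
  let e := specSections R
  have : Nonempty (specTop R).1 := ⟨⟨q, trivial⟩⟩
  let alg : Γ(Spec (CommRingCat.of R), (specTop R).1) →+* K := (functionFieldMap (K := K) R).comp
    ((Spec (CommRingCat.of R)).germToFunctionField (specTop R).1).hom
  let := alg.toAlgebra
  have halg : ∀ a, algebraMap Γ(Spec (CommRingCat.of R), (specTop R).1) K (e a) =
      algebraMap R K a := fun a ↦
    functionFieldLift_germToFunctionField (R := CommRingCat.of R) (algebraMap R K)
      (FaithfulSMul.algebraMap_injective R K) a
  rw [placeRing_eq_pointRing (functionFieldMap (K := K) R) (V := specTop R) rfl trivial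
    (φ := φ.comp e.symm.toRingHom) (fun b ↦ ?_)]
  · ext x
    rw [mem_pointRing, mem_pointRing]
    constructor
    · rintro ⟨a, b, hb, hx⟩
      refine ⟨e.symm a, e.symm b, hb, ?_⟩
      rwa [← halg, ← halg, e.apply_symm_apply, e.apply_symm_apply]
    · rintro ⟨a, b, hb, hx⟩
      refine ⟨e a, e b, ?_, by rwa [halg, halg]⟩
      change φ (e.symm (e b)) ≠ 0
      rwa [e.symm_apply_apply]
  · obtain ⟨b, rfl⟩ := e.surjective b
    rw [mem_basicOpen_specSections, ← hφ]
    change φ (e.symm (e b)) ≠ 0 ↔ _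
    rw [e.symm_apply_apply]

variable {k : Type u} [Field k] (g : k →+* R) (q : Spec (CommRingCat.of R))

/-- Evaluation at a point of the spectrum. -/
def specEval : R →+* (Spec (CommRingCat.of R)).residueField q :=
  (affineSelf (Spec.map (CommRingCat.ofHom g)) (specTop R) (mem_specTop q)).1.hom.comp
    (specSections R).toRingHom

theorem specEval_eq_zero_iff {a : R} : specEval g q a = 0 ↔ a ∈ q.asIdeal := by
  have h := (affineSelf (Spec.map (CommRingCat.ofHom g)) (specTop R)
    (mem_specTop q)).pt_mem_basicOpen_iff (specSections R a)
  rw [affineSelf_toResiduePoint, ResiduePoints.pt_self, mem_basicOpen_specSections] at h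
  exact (not_iff_not.1 h).symm

theorem specEval_surjective (y : (Spec (CommRingCat.of R)).residueField q) :
    ∃ a b, specEval g q b ≠ 0 ∧ y * specEval g q b = specEval g q a := by
  obtain ⟨a, b, hb, hab⟩ := affineSelf_surjective (s := Spec.map (CommRingCat.ofHom g))
    (specTop R) (mem_specTop q) y
  obtain ⟨a, rfl⟩ := (specSections R).surjective a
  obtain ⟨b, rfl⟩ := (specSections R).surjective b
  exact ⟨a, b, hb, hab⟩

theorem specEval_apply (c : k) :
    specEval g q (g c) = residueMap (Spec.map (CommRingCat.ofHom g)) q c := by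
  have h := (affinePoint_iff _).1
    (affineSelf (Spec.map (CommRingCat.ofHom g)) (specTop R) (mem_specTop q)).2 c
  rwa [affineMap_specTop] at h

/-- Convergent families of points on an affine scheme. -/
theorem infinite_of_tendsto_specEval
    {O : ValuationSubring ((Spec (CommRingCat.of R)).residueField q)}
    {ι : Type*} {l : Filter ι} [l.NeBot] {φ : ι → R →+* (Spec (CommRingCat.of R)).residueField q}
    (hφ : ∀ i c, φ i (g c) = residueMap (Spec.map (CommRingCat.ofHom g)) q c)
    (hlim : ∀ a, Tendsto (fun i ↦ φ i a) l (@nhds _ (valuationTopology O) (specEval g q a)))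
    {f : R} (hf : ∀ c, ∀ᶠ i in l, φ i f ≠ c)
    {U : Set (ResiduePoints (Spec.map (CommRingCat.ofHom g)) q)}
    (hU : IsOpenFor (Spec.map (CommRingCat.ofHom g)) q O U)
    (hq : ResiduePoints.self (Spec.map (CommRingCat.ofHom g)) q ∈ U) : U.Infinite := by
  let e := specSections R
  let Φ : ι → AffineResiduePoints (Spec.map (CommRingCat.ofHom g)) q (specTop R) := fun i ↦
    ⟨CommRingCat.ofHom (R := Γ(Spec (CommRingCat.of R), (specTop R).1))
      ((φ i).comp e.symm.toRingHom), by
      refine (affinePoint_iff _).2 fun c ↦ ?_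
      rw [affineMap_specTop, ← hφ i]
      exact congrArg (φ i) (e.symm_apply_apply _)⟩
  have hval : ∀ i a, (Φ i).1.hom (e a) = φ i a := fun i a ↦
    congrArg (φ i) (e.symm_apply_apply _)
  refine infinite_of_tendsto (l := l) (Φ := Φ) (f := e f) (V := specTop R)
    (φ := affineSelf (Spec.map (CommRingCat.ofHom g)) (specTop R) (mem_specTop q))
    ((tendsto_affineTopology_iff O).2 fun a ↦ ?_) (fun c ↦ ?_) hU
    (by rwa [affineSelf_toResiduePoint])
  · obtain ⟨a, rfl⟩ := e.surjective a
    exact @Tendsto.congr ι _ _ _ l _ (fun i ↦ (hval i a).symm) (hlim a)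
  · simpa only [hval] using hf c

end AffineSchemes

/-! ### Locality by lifting idempotents -/

section ConnectedSpecialFibre

variable {F : Type*} [Field F] {A : Type*} [CommRing A] [Algebra F A] {J : Ideal A}

/-- In the Artinian quotient `b ^ n = b ^ (n + 1) * c` for some `n` and `c`, so `b ^ (n + 1) * c ^
(n + 1)` is idempotent and acts as identity on `b ^ (n + 1)`. -/
theorem exists_idempotent_of_notMem {M M' : Ideal A} [M'.IsPrime] [IsArtinianRing (A ⧸ J)]
    (hJ' : J ≤ M') {b : A} (hb : b ∈ M) (hb' : b ∉ M') :
    ∃ e, e * e - e ∈ J ∧ e ∈ M ∧ e ∉ M' := by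
  obtain ⟨n, y, hy⟩ := IsArtinian.exists_pow_succ_smul_dvd (Ideal.Quotient.mk J b)
    (1 : A ⧸ J)
  obtain ⟨c, rfl⟩ := Ideal.Quotient.mk_surjective y
  simp only [smul_eq_mul, mul_one] at hy
  have hk : ∀ k, Ideal.Quotient.mk J (b ^ (n + 1) * (b * c) ^ k) =
      Ideal.Quotient.mk J (b ^ (n + 1)) := by
    intro k
    induction k with
    | zero => rw [pow_zero, mul_one]
    | succ k ih =>
      have h1 : b ^ (n + 1) * (b * c) ^ (k + 1) = b ^ (n + 1) * (b * c) ^ k * (b * c) := by ring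
      rw [h1, map_mul, ih, ← map_mul]
      have h2 : b ^ (n + 1) * (b * c) = b ^ (n + 1) * c * b := by ring
      rw [h2, map_mul, map_mul, map_pow, ← Nat.succ_eq_add_one, hy, pow_succ]
  have he : Ideal.Quotient.mk J (b ^ (n + 1) * (b ^ (n + 1) * c ^ (n + 1))) =
      Ideal.Quotient.mk J (b ^ (n + 1)) := by rw [← mul_pow b c, hk]
  refine ⟨b ^ (n + 1) * c ^ (n + 1), ?_, ?_, fun h ↦ hb' ?_⟩
  · rw [← Ideal.Quotient.eq]
    have h1 : b ^ (n + 1) * c ^ (n + 1) * (b ^ (n + 1) * c ^ (n + 1)) =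
        b ^ (n + 1) * (b ^ (n + 1) * c ^ (n + 1)) * c ^ (n + 1) := by ring
    rw [h1, map_mul, he, ← map_mul]
  · exact M.mul_mem_right _ (M.pow_mem_of_mem hb _ n.succ_pos)
  · have h1 := hJ' (Ideal.Quotient.eq.1 he)
    have h2 : b ^ (n + 1) ∈ M' := by
      have h3 := M'.sub_mem (M'.mul_mem_left (b ^ (n + 1)) h) h1
      rwa [sub_sub_cancel] at h3
    exact Ideal.IsPrime.mem_of_pow_mem ‹_› _ h2

/-- Hensel's lemma for `X ^ 2 - X`: the derivative `2 * e - 1` is its own inverse modulo `J`. -/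
theorem exists_mul_self_eq [IsAdicComplete J A] {e : A} (he : e * e - e ∈ J) :
    ∃ a, a * a = a ∧ a - e ∈ J := by
  have hd : Polynomial.eval e (Polynomial.derivative
      (Polynomial.X ^ 2 - Polynomial.X : Polynomial A)) = 2 * e - 1 := by
    rw [Polynomial.derivative_sub, Polynomial.derivative_X_sq, Polynomial.derivative_X,
      Polynomial.eval_sub, Polynomial.eval_one, Polynomial.eval_mul, Polynomial.eval_X,
      Polynomial.eval_C]
  have hev : ∀ a : A, Polynomial.eval a (Polynomial.X ^ 2 - Polynomial.X) = a * a - a := by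
    intro a
    rw [Polynomial.eval_sub, Polynomial.eval_pow, Polynomial.eval_X, sq]
  have hmonic : (Polynomial.X ^ 2 - Polynomial.X : Polynomial A).Monic := by
    refine Polynomial.monic_X_pow_sub ((Polynomial.degree_X_le).trans_lt ?_)
    norm_num
  have hunit : IsUnit (Ideal.Quotient.mk J (Polynomial.eval e (Polynomial.derivative
      (Polynomial.X ^ 2 - Polynomial.X : Polynomial A)))) := by
    refine IsUnit.of_mul_eq_one (Ideal.Quotient.mk J (2 * e - 1)) ?_
    have h1 : (2 * e - 1) * (2 * e - 1) - 1 = 4 * (e * e - e) := by ring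
    rw [hd, ← map_mul, ← map_one (Ideal.Quotient.mk J), Ideal.Quotient.eq, h1]
    exact J.mul_mem_left _ he
  obtain ⟨a, ha, hae⟩ := HenselianRing.is_henselian (I := J) _ hmonic e (by rwa [hev]) hunit
  refine ⟨a, ?_, hae⟩
  rw [Polynomial.IsRoot, hev] at ha
  exact sub_eq_zero.1 ha

theorem IsCompleteSurface.isMaximal_of_le (h : IsCompleteSurface F J) {P : Ideal A} [P.IsPrime]
    (hP : J ≤ P) : P.IsMaximal := by
  have := h.finite_quotient
  have : Module.Finite F (A ⧸ P) :=
    Module.Finite.of_surjective (Ideal.Quotient.factorₐ F hP).toLinearMap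
      (Ideal.Quotient.factor_surjective hP)
  have : IsArtinianRing (A ⧸ P) := IsArtinianRing.of_finite F _
  exact Ideal.Quotient.maximal_of_isField _ (IsArtinianRing.isField_of_isDomain _)

/-- A complete surface which is a domain has only one maximal ideal. -/
theorem IsCompleteSurface.eq_of_le [IsDomain A] (h : IsCompleteSurface F J) {P P' : Ideal A}
    [P.IsPrime] [P'.IsPrime] (hP : J ≤ P) (hP' : J ≤ P') : P = P' := by
  by_contra hne
  have := h.isMaximal_of_le hP
  have := h.isMaximal_of_le hP'
  have := h.finite_quotient
  have : IsArtinianRing (A ⧸ J) := IsArtinianRing.of_finite F _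
  have hle : ¬ P ≤ P' := fun hle ↦ hne (Ideal.IsMaximal.eq_of_le ‹_› ‹P'.IsPrime›.ne_top hle)
  obtain ⟨b, hb, hb'⟩ := SetLike.not_le_iff_exists.1 hle
  obtain ⟨e, he, heP, heP'⟩ := exists_idempotent_of_notMem (J := J) (M := P) (M' := P') hP' hb hb'
  have := h.isAdicComplete
  obtain ⟨a, ha, hae⟩ := exists_mul_self_eq he
  have ha' : a * (a - 1) = 0 := by rw [mul_sub, mul_one, ha, sub_self]
  rcases mul_eq_zero.1 ha' with h0 | h0
  · rw [h0, zero_sub] at hae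
    exact heP' (hP' (J.neg_mem_iff.1 hae))
  · rw [sub_eq_zero.1 h0] at hae
    refine ‹P.IsPrime›.ne_top ((Ideal.eq_top_iff_one P).2 ?_)
    have h1 := P.add_mem (hP hae) heP
    rwa [sub_add_cancel] at h1

end ConnectedSpecialFibre

/-! ### Height one primes do not contain the ideal of definition -/

section FiniteOverPowerSeries

open PowerSeries

variable {F : Type*} [Field F] {A : Type*} [CommRing A] [Algebra (PowerSeries₂ F) A]
  [Module.Finite (PowerSeries₂ F) A] [FaithfulSMul (PowerSeries₂ F) A]

variable (F A) in
-- Lying over, applied to the prime generated by the second variable. Such a prime shows that the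
-- dimension is at least two, and that inverting the first variable does not leave a field.
theorem exists_isPrime_ne_bot_notMem :
    ∃ Q : Ideal A, Q.IsPrime ∧ Q ≠ ⊥ ∧ algebraMap (PowerSeries₂ F) A (C X) ∉ Q := by
  have : (Ideal.span {(X : PowerSeries₂ F)}).IsPrime := span_X_isPrime
  have hinj := FaithfulSMul.algebraMap_injective (PowerSeries₂ F) A
  obtain ⟨Q, -, hQ, hcomap⟩ := Ideal.exists_ideal_over_prime_of_isIntegral
    (Ideal.span {(X : PowerSeries₂ F)}) (⊥ : Ideal A) (by
      rw [Ideal.comap_bot_of_injective _ hinj]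
      exact bot_le)
  refine ⟨Q, hQ, ?_, fun h ↦ ?_⟩
  · rintro rfl
    have h1 : (X : PowerSeries₂ F) ∈ (⊥ : Ideal A).comap (algebraMap (PowerSeries₂ F) A) := by
      rw [hcomap]
      exact Ideal.mem_span_singleton_self _
    rw [Ideal.comap_bot_of_injective _ hinj, Ideal.mem_bot] at h1
    exact X_ne_zero h1
  · have h1 : (C X : PowerSeries₂ F) ∈ Ideal.span {(X : PowerSeries₂ F)} := by
      rw [← hcomap]
      exact h
    rw [Ideal.mem_span_singleton, X_dvd_iff, constantCoeff_C] at h1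
    exact X_ne_zero h1

variable [IsDomain A] [Algebra F A] [IsScalarTower F (PowerSeries₂ F) A]

/-- By `eq_of_le` a prime containing the ideal of definition contains every other prime, in
particular a nonzero prime avoiding the first variable; so its height is at least two. -/
theorem not_le_of_height_eq_one {P : Ideal A} [P.IsPrime] (hP : P.height = 1) :
    ¬ (powerSeries₂Ideal F).map (algebraMap (PowerSeries₂ F) A) ≤ P := by
  intro hle
  have h := isCompleteSurface_of_finite F (A := A)
  obtain ⟨Q, hQ, hQ0, hxQ⟩ := exists_isPrime_ne_bot_notMem F A
  obtain ⟨M, hM, hQM⟩ := Q.exists_le_maximal hQ.ne_top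
  have := h.isAdicComplete
  have hJM : (powerSeries₂Ideal F).map (algebraMap (PowerSeries₂ F) A) ≤ M :=
    (IsAdicComplete.le_jacobson_bot _).trans (sInf_le ⟨bot_le, hM⟩)
  have := hM.isPrime
  rw [← h.eq_of_le hle hJM] at hQM
  have hxP : algebraMap (PowerSeries₂ F) A (C X) ∈ P := hle (Ideal.mem_map_of_mem _ (by
    rw [mem_powerSeries₂Ideal, constantCoeff_C, ← X_dvd_iff]))
  have hlt : Q < P := lt_of_le_of_ne hQM fun he ↦ hxQ (he ▸ hxP)
  have h1 := Ideal.height_add_one_le_of_lt_of_isPrime hlt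
  rw [hP] at h1
  have h2 : Q.height = 0 := by
    by_contra h0
    have h3 : 1 ≤ Q.height := Order.one_le_iff_pos.2 (pos_iff_ne_zero.2 h0)
    have h4 := (add_le_add_left h3 1).trans h1
    exact absurd h4 (by norm_num)
  exact hQ0 (Ideal.height_eq_zero_iff_eq_bot.1 h2)

end FiniteOverPowerSeries

/-! ### The scheme obtained by inverting the first variable -/

section GenericFibre

open PowerSeries

variable {A R : Type u} [CommRing A] [CommRing R] [Algebra A R]

theorem ker_specEval_comp {k : Type u} [Field k] {g : k →+* R} {q : Spec (CommRingCat.of R)} :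
    RingHom.ker ((specEval g q).comp (algebraMap A R)) = q.asIdeal.comap (algebraMap A R) := by
  ext a
  rw [RingHom.mem_ker, RingHom.comp_apply, specEval_eq_zero_iff, Ideal.mem_comap]

theorem specEval_comp_surjective (S : Submonoid A) [IsLocalization S R] {k : Type u} [Field k]
    (g : k →+* R) (q : Spec (CommRingCat.of R)) (y : (Spec (CommRingCat.of R)).residueField q) :
    ∃ a b, (specEval g q).comp (algebraMap A R) b ≠ 0 ∧
      y * (specEval g q).comp (algebraMap A R) b = (specEval g q).comp (algebraMap A R) a := by
  obtain ⟨a, b, hb, hab⟩ := specEval_surjective g q y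
  obtain ⟨⟨a', s⟩, ha⟩ := IsLocalization.surj S a
  obtain ⟨⟨b', t⟩, hb'⟩ := IsLocalization.surj S b
  have ha' : algebraMap A R a' = a * algebraMap A R s := ha.symm
  replace hb' : algebraMap A R b' = b * algebraMap A R t := hb'.symm
  have hunit : ∀ s : S, specEval g q (algebraMap A R s) ≠ 0 := fun s ↦
    ((IsLocalization.map_units R s).map (specEval g q)).ne_zero
  refine ⟨a' * t, b' * s, ?_, ?_⟩
  · rw [RingHom.comp_apply, map_mul, map_mul, hb', map_mul]
    exact mul_ne_zero (mul_ne_zero hb (hunit t)) (hunit s)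
  · rw [RingHom.comp_apply, RingHom.comp_apply, map_mul (algebraMap A R),
      map_mul (algebraMap A R), hb', ha']
    simp only [map_mul]
    rw [← hab]
    ring

theorem algebraMap_C_X_mem (F A : Type*) [Field F] [CommRing A]
    [Algebra (PowerSeries₂ F) A] : algebraMap (PowerSeries₂ F) A (C X) ∈
    (powerSeries₂Ideal F).map (algebraMap (PowerSeries₂ F) A) :=
  Ideal.mem_map_of_mem _ (by rw [mem_powerSeries₂Ideal, constantCoeff_C, ← X_dvd_iff])

variable {F : Type u} [Field F] [Algebra (PowerSeries₂ F) A]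

/-- The power series in the first variable, as elements of a finite algebra over the power series
in two variables. -/
abbrev firstVariableMap (F A : Type*) [Field F] [CommRing A] [Algebra (PowerSeries₂ F) A] :
    PowerSeries F →+* A :=
  (algebraMap (PowerSeries₂ F) A).comp C

theorem firstVariableMap_C [Algebra F A] [IsScalarTower F (PowerSeries₂ F) A] (c : F) : firstVariableMap F A (C c) = algebraMap F A c := by
  rw [IsScalarTower.algebraMap_apply F (PowerSeries₂ F) A, algebraMap_powerSeries₂]
  rfl

theorem specEval_firstVariableMap {g : LaurentSeries F →+* R} {q : Spec (CommRingCat.of R)}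
    (hg : ∀ f, g (algebraMap (PowerSeries F) (LaurentSeries F) f) =
      algebraMap A R (firstVariableMap F A f)) (f : PowerSeries F) :
    (specEval g q).comp (algebraMap A R) (firstVariableMap F A f) =
      residueMap (Spec.map (CommRingCat.ofHom g)) q
        (algebraMap (PowerSeries F) (LaurentSeries F) f) := by
  rw [RingHom.comp_apply, ← hg, specEval_apply]

variable [IsLocalization.Away (algebraMap (PowerSeries₂ F) A (C X)) R]

variable (F) in
theorem notMem_comap_algebraMap (P : Ideal R) [P.IsPrime] :
    algebraMap (PowerSeries₂ F) A (C X) ∉ P.comap (algebraMap A R) := fun h ↦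
  ‹P.IsPrime›.ne_top (Ideal.eq_top_of_isUnit_mem _ h (IsLocalization.Away.algebraMap_isUnit _))

variable (F) in
theorem not_le_comap_algebraMap (P : Ideal R) [P.IsPrime] :
    ¬ (powerSeries₂Ideal F).map (algebraMap (PowerSeries₂ F) A) ≤ P.comap (algebraMap A R) :=
  fun h ↦ notMem_comap_algebraMap F P (h (algebraMap_C_X_mem F A))

variable [Module.Finite (PowerSeries₂ F) A] [FaithfulSMul (PowerSeries₂ F) A]

/-- The zero ideal is not maximal: a nonzero prime of `A` avoiding the inverted element extends to a
proper nonzero ideal. -/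
theorem comap_algebraMap_ne_bot (F : Type u) [Field F] [Algebra (PowerSeries₂ F) A]
    [IsLocalization.Away (algebraMap (PowerSeries₂ F) A (C X)) R] [Module.Finite (PowerSeries₂ F) A]
    [FaithfulSMul (PowerSeries₂ F) A] (P : Ideal R)
    [P.IsMaximal] :
    P.comap (algebraMap A R) ≠ ⊥ := by
  intro h0
  let M := Submonoid.powers (algebraMap (PowerSeries₂ F) A (C X))
  obtain ⟨Q, hQ, hQ0, hxQ⟩ := exists_isPrime_ne_bot_notMem F A
  have hdisj : Disjoint (M : Set A) Q := (Ideal.disjoint_powers_iff_notMem _ hQ.isRadical).2 hxQ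
  have hprime := IsLocalization.isPrime_of_isPrime_disjoint M R Q hQ hdisj
  have hcomap := IsLocalization.under_map_of_isPrime_disjoint M R hQ hdisj
  have hP : P = ⊥ := by
    have h1 : P.under A = ⊥ := h0
    rw [← IsLocalization.map_under M R P, h1, Ideal.map_bot]
  have h1 := Ideal.IsMaximal.eq_of_le ‹P.IsMaximal› hprime.ne_top (hP ▸ bot_le)
  apply hQ0
  rw [← hcomap, ← h1]
  exact h0

/-- A strictly larger prime would contract to one containing the ideal of definition, hence the
inverted element. -/
theorem isMaximal_of_comap_ne_bot (F : Type u) [Field F] [Algebra (PowerSeries₂ F) A]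
    [IsLocalization.Away (algebraMap (PowerSeries₂ F) A (C X)) R] [Module.Finite (PowerSeries₂ F) A]
    [IsDomain A] [Algebra F A] [IsScalarTower F (PowerSeries₂ F) A] (P : Ideal R)
    [P.IsPrime] (hP : P.comap (algebraMap A R) ≠ ⊥) :
    P.IsMaximal := by
  obtain ⟨M, hM, hPM⟩ := P.exists_le_maximal (Ideal.IsPrime.ne_top ‹_›)
  have := hM.isPrime
  suffices h : P = M by rwa [h]
  by_contra hne
  have hlt : P.comap (algebraMap A R) < M.comap (algebraMap A R) := by
    refine lt_of_le_of_ne (Ideal.comap_mono hPM) fun he ↦ hne ?_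
    let S := Submonoid.powers (algebraMap (PowerSeries₂ F) A (C X))
    rw [← IsLocalization.map_under S R P, ← IsLocalization.map_under S R M]
    exact congrArg _ he
  exact not_le_comap_algebraMap F M ((isCompleteSurface_of_finite F (A := A)).le_of_lt _ _
    inferInstance inferInstance hP hlt)

variable [IsDomain A] [Algebra F A] [IsScalarTower F (PowerSeries₂ F) A]

variable {g : LaurentSeries F →+* R} {q : Spec (CommRingCat.of R)}
  (hg : ∀ f, g (algebraMap (PowerSeries F) (LaurentSeries F) f) =
    algebraMap A R (firstVariableMap F A f))
include hg

theorem residueMap_finite_of_isClosed (hq : IsClosed {q}) :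
    (residueMap (Spec.map (CommRingCat.ofHom g)) q).Finite := by
  have : q.asIdeal.IsMaximal := (PrimeSpectrum.isClosed_singleton_iff_isMaximal q).1 hq
  have h := isCompleteSurface_of_finite F (A := A)
  obtain ⟨j, hj, hfin⟩ := h.exists_laurent_finite (φ := (specEval g q).comp (algebraMap A R))
    (σ := firstVariableMap F A) firstVariableMap_C (algebraMap_C_X_mem F A) (fun h0 ↦ by
      rw [← RingHom.mem_ker, ker_specEval_comp] at h0
      exact notMem_comap_algebraMap F q.asIdeal h0) (by
      rw [ker_specEval_comp]
      exact comap_algebraMap_ne_bot F q.asIdeal) (specEval_comp_surjective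
        (Submonoid.powers (algebraMap (PowerSeries₂ F) A (C X))) g q)
  suffices hjr : residueMap (Spec.map (CommRingCat.ofHom g)) q = j by rwa [hjr]
  refine IsLocalization.ringHom_ext (nonZeroDivisors (PowerSeries F)) (RingHom.ext fun f ↦ ?_)
  rw [RingHom.comp_apply, RingHom.comp_apply, hj, specEval_firstVariableMap hg]

/-- Separability permits the given first variable as parameter. The approximating points extend to
`R` because they do not kill this variable, and `u` distinguishes them. -/
theorem infinite_of_isOpenFor_of_separable [IsIntegrallyClosed A] (hq : IsClosed {q})
    (hsep : SeparableResidueField (Spec.map (CommRingCat.ofHom g)) q)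
    {O' : ValuationSubring ((Spec (CommRingCat.of R)).residueField q)}
    (hO' : Extends (Spec.map (CommRingCat.ofHom g)) q (laurentValuationRing F) O')
    {U : Set (ResiduePoints (Spec.map (CommRingCat.ofHom g)) q)}
    (hU : IsOpenFor (Spec.map (CommRingCat.ofHom g)) q O' U)
    (hqU : ResiduePoints.self (Spec.map (CommRingCat.ofHom g)) q ∈ U) : U.Infinite := by
  have : q.asIdeal.IsMaximal := (PrimeSpectrum.isClosed_singleton_iff_isMaximal q).1 hq
  have h := isCompleteSurface_of_finite F (A := A)
  let ℓ := (Spec (CommRingCat.of R)).residueField q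
  let := (residueMap (Spec.map (CommRingCat.ofHom g)) q).toAlgebra
  have : Algebra.IsSeparable (LaurentSeries F) ℓ := hsep
  let φ₀ : A →+* ℓ := (specEval g q).comp (algebraMap A R)
  have hφ₀ : ∀ f, φ₀ (firstVariableMap F A f) = powerSeriesMap F ℓ f :=
    specEval_firstVariableMap hg
  have hX : powerSeriesMap F ℓ X ≠ 0 := (map_ne_zero_iff _ powerSeriesMap_injective).2 X_ne_zero
  obtain ⟨u, φ, h1, h2⟩ := h.exists_tendsto hO' firstVariableMap_C (algebraMap_C_X_mem F A) hφ₀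
    (by
      rw [ker_specEval_comp]
      exact comap_algebraMap_ne_bot F q.asIdeal)
  obtain ⟨N, hN⟩ := eventually_atTop.1 h1
  have hφN := fun n ↦ hN (n + N) (Nat.le_add_left N n)
  have hunit : ∀ n, IsUnit (φ (n + N) (algebraMap (PowerSeries₂ F) A (C X))) := fun n ↦
    IsUnit.mk0 _ (by
      have h3 := (hφN n).1 X
      rw [RingHom.comp_apply] at h3
      rwa [h3])
  let ψ : ℕ → R →+* ℓ := fun n ↦ IsLocalization.Away.lift _ (hunit n)
  have hψ : ∀ n a, ψ n (algebraMap A R a) = φ (n + N) a := fun n a ↦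
    IsLocalization.Away.lift_eq _ (hunit n) a
  refine infinite_of_tendsto_specEval g q (φ := ψ) (l := atTop) (f := algebraMap A R u)
    (fun n ↦ ?_) (fun b ↦ ?_) (fun c ↦ ?_) hU hqU
  · refine RingHom.congr_fun (f := (ψ n).comp g) (IsLocalization.ringHom_ext
      (nonZeroDivisors (PowerSeries F)) (RingHom.ext fun f ↦ ?_))
    rw [RingHom.comp_apply, RingHom.comp_apply, hg, hψ, (hφN n).1]
    rfl
  · let := Valued.mk' O'.valuation
    obtain ⟨⟨a, s, m, rfl⟩, hab⟩ := IsLocalization.surj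
      (Submonoid.powers (algebraMap (PowerSeries₂ F) A (C X))) b
    have hval : ∀ χ : R →+* ℓ, χ (algebraMap A R (firstVariableMap F A X)) =
        powerSeriesMap F ℓ X → χ b = χ (algebraMap A R a) * (powerSeriesMap F ℓ X ^ m)⁻¹ := by
      intro χ hχ
      rw [eq_mul_inv_iff_mul_eq₀ (pow_ne_zero _ hX), ← hχ, ← hab, map_mul]
      simp only [map_pow]
      rfl
    rw [hval (specEval g q) (hφ₀ X)]
    refine (((h2 a).comp (tendsto_add_atTop_nat N)).mul_const _).congr fun n ↦ ?_
    rw [hval (ψ n) (by rw [hψ, (hφN n).1]), hψ]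
    rfl
  · by_cases hc : ∃ n, ψ n (algebraMap A R u) = c
    · obtain ⟨n, rfl⟩ := hc
      filter_upwards [eventually_gt_atTop n] with m hm he
      rw [hψ, hψ, (hφN m).2, (hφN n).2] at he
      have h5 := congrArg order (powerSeriesMap_injective he)
      rw [order_X_pow, order_X_pow, Nat.cast_inj] at h5
      omega
    · exact Eventually.of_forall fun n hn ↦ hc ⟨n, hn⟩

end GenericFibre

/-! ### Infinitely many closed points of the scheme and of the punctured spectrum -/

section InfinitelyManyPlaces

open PowerSeries

/-- These primes are minimal over `z`: a smaller prime containing `z` is nonzero and would force `J`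
into the larger one. -/
theorem IsCompleteSurface.finite_setOf_mem {F : Type*} [Field F] {A : Type*} [CommRing A]
    [Algebra F A] {J : Ideal A} (h : IsCompleteSurface F J) {z : A} (hz : z ≠ 0) :
    {v : PrimeSpectrum A | ¬ J ≤ v.asIdeal ∧ z ∈ v.asIdeal}.Finite := by
  have := h.isNoetherianRing
  refine Set.Finite.of_finite_image ((Ideal.span {z}).finite_minimalPrimes_of_isNoetherianRing.subset
    ?_) (f := PrimeSpectrum.asIdeal) fun v _ w _ hvw ↦ PrimeSpectrum.ext hvw
  rintro _ ⟨v, ⟨hJ, hzv⟩, rfl⟩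
  refine ⟨⟨v.2, (Ideal.span_singleton_le_iff_mem _).2 hzv⟩, fun 𝔯 h𝔯 hle ↦ ?_⟩
  by_contra hnot
  refine hJ (h.le_of_lt 𝔯 v.asIdeal h𝔯.1 v.2 ?_ (lt_of_le_not_ge hle hnot))
  rintro rfl
  exact hz (by simpa using h𝔯.2)

variable {A : Type u} [CommRing A] [IsDomain A] {K : Type v} [Field K] [Algebra A K]
  [FaithfulSMul A K] {R : Type u} [CommRing R] [IsDomain R] [Algebra A R] [Algebra R K]
  [FaithfulSMul R K] [IsScalarTower A R K]

theorem placeRing_comap (M : Submonoid A) [IsLocalization M R] (v : PrimeSpectrum R) :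
    placeRing (functionFieldMap (K := K) A) (v.comap (algebraMap A R)) =
      placeRing (functionFieldMap (K := K) R) v := by
  rw [placeRing_functionFieldMap (φ := algebraMap R v.asIdeal.ResidueField) v fun a ↦
      Ideal.algebraMap_residueField_eq_zero,
    ← pointRing_comp_algebraMap (A := A) M]
  exact placeRing_functionFieldMap (R := A) (v.comap (algebraMap A R)) fun a ↦
    Ideal.algebraMap_residueField_eq_zero

variable {F : Type u} [Field F] [PerfectField F] [IsIntegrallyClosed A] [Algebra F A] {J : Ideal A}
  {L : Type w} [Field L] [Algebra K L] [FiniteDimensional K L] [IsGalois K L]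

theorem IsCompleteSurface.infinite_placeRing (h : IsCompleteSurface F J)
    {q : Spec (CommRingCat.of A)} (h0 : q.asIdeal ≠ ⊥) (hJ : ¬ J ≤ q.asIdeal)
    (hR : UnramifiedIn L (placeRing (functionFieldMap (K := K) A) q)) :
    {v : Spec (CommRingCat.of A) | v.asIdeal ≠ ⊥ ∧ ¬ J ≤ v.asIdeal ∧ ConjDecomposition L
      (placeRing (functionFieldMap (K := K) A) q)
      (placeRing (functionFieldMap (K := K) A) v)}.Infinite := by
  have := h.isNoetherianRing
  have : IsNoetherianRing (CommRingCat.of A) := inferInstanceAs (IsNoetherianRing A)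
  have : IsDomain (CommRingCat.of A) := inferInstanceAs (IsDomain A)
  have hplace : ∀ v : PrimeSpectrum A, placeRing (functionFieldMap (K := K) A) v =
      pointRing K (algebraMap A v.asIdeal.ResidueField) := fun v ↦
    placeRing_functionFieldMap v fun a ↦ Ideal.algebraMap_residueField_eq_zero
  have hnoeth := isNoetherianRing_placeRing (functionFieldMap (K := K) A) q
  rw [hplace q] at hR hnoeth
  refine (h.infinite_conjDecomposition (K := K) (L := L) q h0 hJ hR).mono ?_
  rintro v ⟨hv0, hvJ, hv⟩
  refine ⟨hv0, hvJ, ?_⟩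
  rw [hplace v, hplace q]
  exact hv

theorem infinite_setOf_height_eq_one (F : Type u) [Field F] [PerfectField F] [Algebra F A]
    [Algebra (PowerSeries₂ F) A] [Module.Finite (PowerSeries₂ F) A]
    [IsScalarTower F (PowerSeries₂ F) A] [FaithfulSMul (PowerSeries₂ F) A]
    {q : Spec (CommRingCat.of A)} (hq : q.asIdeal.height = 1)
    (hR : UnramifiedIn L (placeRing (functionFieldMap (K := K) A) q)) :
    {v : Spec (CommRingCat.of A) | v.asIdeal.height = 1 ∧ ConjDecomposition L
      (placeRing (functionFieldMap (K := K) A) q)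
      (placeRing (functionFieldMap (K := K) A) v)}.Infinite := by
  have h := isCompleteSurface_of_finite F (A := A)
  have hprime : ∀ v : PrimeSpectrum A, v.asIdeal.IsPrime := fun v ↦ v.2
  have := hprime q
  have h0 : q.asIdeal ≠ ⊥ := Ideal.ne_bot_of_height_eq_one hq
  refine (h.infinite_placeRing h0 (not_le_of_height_eq_one hq) hR).mono ?_
  rintro v ⟨hv0, hJ, hv⟩
  have := hprime v
  exact ⟨h.height_eq_one hv0 hJ, hv⟩

theorem infinite_setOf_isClosed (F : Type u) [Field F] [PerfectField F] [Algebra F A]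
    [Algebra (PowerSeries₂ F) A] [Module.Finite (PowerSeries₂ F) A]
    [IsScalarTower F (PowerSeries₂ F) A] [FaithfulSMul (PowerSeries₂ F) A]
    [IsLocalization.Away (algebraMap (PowerSeries₂ F) A (C X)) R]
    {q : Spec (CommRingCat.of R)} (hq : IsClosed {q})
    (hR : UnramifiedIn L (placeRing (functionFieldMap (K := K) R) q)) :
    {v : Spec (CommRingCat.of R) | IsClosed {v} ∧ ConjDecomposition L
      (placeRing (functionFieldMap (K := K) R) q)
      (placeRing (functionFieldMap (K := K) R) v)}.Infinite := by
  have h := isCompleteSurface_of_finite F (A := A)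
  have : q.asIdeal.IsMaximal := (PrimeSpectrum.isClosed_singleton_iff_isMaximal q).1 hq
  let x := algebraMap (PowerSeries₂ F) A (C X)
  have hx : x ≠ 0 := by
    rw [ne_eq, map_eq_zero_iff _ (FaithfulSMul.algebraMap_injective _ A),
      map_eq_zero_iff _ C_injective]
    exact X_ne_zero
  let π : PrimeSpectrum R → PrimeSpectrum A := PrimeSpectrum.comap (algebraMap A R)
  have hplace : ∀ v : PrimeSpectrum R, placeRing (functionFieldMap (K := K) A) (π v) =
    placeRing (functionFieldMap (K := K) R) v := 
    placeRing_comap (Submonoid.powers x)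
  have hq' : placeRing (functionFieldMap (K := K) R) q =
    placeRing (functionFieldMap (K := K) A) (π q) := (hplace q).symm
  rw [hq'] at hR ⊢
  -- Approximation may use any parameter, so primes containing `x` can occur; removing these
  -- finitely many leaves primes that come from `R`.
  have key := (h.infinite_placeRing (q := π q) (comap_algebraMap_ne_bot F q.asIdeal)
    (not_le_comap_algebraMap F q.asIdeal) hR).sdiff (h.finite_setOf_mem hx)
  refine Set.Infinite.of_image π (key.mono ?_)
  rintro v ⟨⟨hv0, hvJ, hv⟩, hvx⟩
  replace hvx : x ∉ v.asIdeal := fun hxv ↦ hvx ⟨hvJ, hxv⟩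
  have hdisj : Disjoint (Submonoid.powers x : Set A) (v.asIdeal : Set A) :=
    (Ideal.disjoint_powers_iff_notMem _ (PrimeSpectrum.isPrime v).isRadical).2 hvx
  have hprime := IsLocalization.isPrime_of_isPrime_disjoint (Submonoid.powers x) R _ v.2 hdisj
  have hcomap := IsLocalization.under_map_of_isPrime_disjoint (Submonoid.powers x) R v.2 hdisj
  let v' : PrimeSpectrum R := ⟨_, hprime⟩
  have hv' : π v' = v := PrimeSpectrum.ext hcomap
  refine ⟨v', ⟨(PrimeSpectrum.isClosed_singleton_iff_isMaximal v').2
    (isMaximal_of_comap_ne_bot (A := A) F _ ?_), ?_⟩, hv'⟩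
  · exact fun h0 ↦ hv0 (hcomap.symm.trans h0)
  · have hv'' : placeRing (functionFieldMap (K := K) R) v' =
      placeRing (functionFieldMap (K := K) A) v := by rw [← hv']; exact (hplace v').symm
    rwa [hv'']

end InfinitelyManyPlaces

/-! ### The integral closure `A` and the ring `A[x⁻¹]` -/

section IntegralClosure

open PowerSeries

variable (k₀ : Type u) [Field k₀] (K : Type u) [Field K] [Algebra (PowerSeries₂ k₀) K]
  [Algebra (Laurent₂ k₀) K] [IsScalarTower (PowerSeries₂ k₀) (Laurent₂ k₀) K]

theorem finite_intRing [PerfectField k₀] [FiniteDimensional (Laurent₂ k₀) K] :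
    Module.Finite (PowerSeries₂ k₀) (IntRing k₀ K) := by
  -- The exponential characteristic covers characteristic zero as `p = 1`.
  obtain ⟨p, hp⟩ := ExpChar.exists k₀
  have : ExpChar (PowerSeries₂ k₀) p :=
    expChar_of_injective_ringHom (f := (C.comp C : k₀ →+* PowerSeries₂ k₀))
      (C_injective.comp C_injective) p
  exact finite_integralClosure (PowerSeries₂ k₀) (Laurent₂ k₀) K p
    (finite_frobenius_powerSeries₂ k₀ p)

theorem isIntegrallyClosed_intRing [FiniteDimensional (Laurent₂ k₀) K] :
    IsIntegrallyClosed (IntRing k₀ K) :=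
  integralClosure.isIntegrallyClosedOfFiniteExtension (Laurent₂ k₀)

theorem faithfulSMul_powerSeries₂ : FaithfulSMul (PowerSeries₂ k₀) K :=
  FaithfulSMul.trans (PowerSeries₂ k₀) (Laurent₂ k₀) K

theorem isLocalization_intRingX :
    IsLocalization.Away (algebraMap (PowerSeries₂ k₀) (IntRing k₀ K) (C X)) (IntRingX k₀ K) := by
  have := faithfulSMul_powerSeries₂ k₀ K
  have hx : varX k₀ K ≠ 0 := by
    refine (map_ne_zero_iff _ (FaithfulSMul.algebraMap_injective (PowerSeries₂ k₀) K)).2 ?_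
    exact (map_ne_zero_iff _ C_injective).2 X_ne_zero
  let x : IntRing k₀ K := algebraMap (PowerSeries₂ k₀) (IntRing k₀ K) (C X)
  have hsurj : ∀ z ∈ Algebra.adjoin (IntRing k₀ K) {(varX k₀ K)⁻¹}, ∃ (n : ℕ) (a : IntRing k₀ K),
      z * varX k₀ K ^ n = a := by
    intro z hz
    induction hz using Algebra.adjoin_induction with
    | mem z hz =>
      refine ⟨1, 1, ?_⟩
      rw [Set.mem_singleton_iff.1 hz, pow_one, inv_mul_cancel₀ hx]
      rfl
    | algebraMap a => exact ⟨0, a, by rw [pow_zero, mul_one]; rfl⟩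
    | add y z _ _ hy hz =>
      obtain ⟨n, a, ha⟩ := hy
      obtain ⟨m, b, hb⟩ := hz
      refine ⟨n + m, a * x ^ m + b * x ^ n, ?_⟩
      push_cast
      rw [← ha, ← hb]
      change _ = y * varX k₀ K ^ n * varX k₀ K ^ m + z * varX k₀ K ^ m * varX k₀ K ^ n
      ring
    | mul y z _ _ hy hz =>
      obtain ⟨n, a, ha⟩ := hy
      obtain ⟨m, b, hb⟩ := hz
      refine ⟨n + m, a * b, ?_⟩
      push_cast
      rw [← ha, ← hb]
      ring
  refine ⟨?_, ?_, ?_⟩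
  · rintro ⟨_, n, rfl⟩
    simp only [map_pow]
    exact (isUnit_powerSeriesToIntRingX k₀ K).pow n
  · rintro ⟨z, hz⟩
    obtain ⟨n, a, ha⟩ := hsurj z hz
    exact ⟨⟨a, x ^ n, n, rfl⟩, Subtype.ext ha⟩
  · intro a b hab
    refine ⟨1, ?_⟩
    have hab' : (a : K) = b :=
      congrArg (fun z : Algebra.adjoin (IntRing k₀ K) {(varX k₀ K)⁻¹} ↦ (z : K)) hab
    rw [Subtype.ext hab']

end IntegralClosure

end Reocurrence

end
-- The main theorem
open Reocurrence CategoryTheory AlgebraicGeometry in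
theorem theorem3p1 :
    -- Type (a): function fields of curves over a henselian valued field
    (∀ (k : Type u) [Field k] (O : ValuationSubring k) [HenselianLocalRing O]
      (C : Scheme.{u}) (s : C ⟶ Spec (CommRingCat.of k))
      [IsIntegral C] [IsProper s] [SmoothOfRelativeDimension 1 s]
      (K : Type v) [Field K] (i : C.functionField ≃+* K)
      (L : Type w) [Field L] [Algebra K L] [FiniteDimensional K L] [IsGalois K L]
      (v₀ : C), IsClosed ({v₀} : Set C) → UnramifiedIn L (placeRing i.toRingHom v₀) →
      (∀ O' : ValuationSubring (C.residueField v₀), Extends s v₀ O O' →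
        ∃ U : Set (ResiduePoints s v₀), IsOpenFor s v₀ O' U ∧ ResiduePoints.self s v₀ ∈ U ∧
          ∀ P ∈ U, ConjDecomposition L
            (placeRing i.toRingHom v₀) (placeRing i.toRingHom P.pt)) ∧
      (O ≠ ⊤ →
        (∀ O' : ValuationSubring (C.residueField v₀), Extends s v₀ O O' →
          ∀ U : Set (ResiduePoints s v₀), IsOpenFor s v₀ O' U → ResiduePoints.self s v₀ ∈ U →
            U.Infinite) ∧
        {v : C | IsClosed ({v} : Set C) ∧ ConjDecomposition L
          (placeRing i.toRingHom v₀) (placeRing i.toRingHom v)}.Infinite)) ∧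
    -- Type (b): finite extensions of `k₀((x, y))`
    (∀ (k₀ : Type u) [Field k₀] [PerfectField k₀]
      (K : Type u) [Field K] [Algebra (PowerSeries₂ k₀) K] [Algebra (Laurent₂ k₀) K]
      [IsScalarTower (PowerSeries₂ k₀) (Laurent₂ k₀) K] [FiniteDimensional (Laurent₂ k₀) K]
      (L : Type w) [Field L] [Algebra K L] [FiniteDimensional K L] [IsGalois K L],
      (∀ v₀ : laurentScheme k₀ K, IsClosed ({v₀} : Set (laurentScheme k₀ K)) →
        UnramifiedIn L (placeRing (functionFieldMap (K := K) (IntRingX k₀ K)) v₀) →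
        (∀ O' : ValuationSubring ((laurentScheme k₀ K).residueField v₀),
          Extends (laurentStructure k₀ K) v₀ (laurentValuationRing k₀) O' →
          (∃ U : Set (ResiduePoints (laurentStructure k₀ K) v₀),
            IsOpenFor (laurentStructure k₀ K) v₀ O' U ∧
            ResiduePoints.self (laurentStructure k₀ K) v₀ ∈ U ∧
            ∀ P ∈ U, ConjDecomposition L
              (placeRing (functionFieldMap (K := K) (IntRingX k₀ K)) v₀)
              (placeRing (functionFieldMap (K := K) (IntRingX k₀ K)) P.pt)) ∧
          (SeparableResidueField (laurentStructure k₀ K) v₀ →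
            ∀ U : Set (ResiduePoints (laurentStructure k₀ K) v₀),
              IsOpenFor (laurentStructure k₀ K) v₀ O' U →
              ResiduePoints.self (laurentStructure k₀ K) v₀ ∈ U → U.Infinite)) ∧
        {v : laurentScheme k₀ K | IsClosed ({v} : Set (laurentScheme k₀ K)) ∧
          ConjDecomposition L
            (placeRing (functionFieldMap (K := K) (IntRingX k₀ K)) v₀)
            (placeRing (functionFieldMap (K := K) (IntRingX k₀ K)) v)}.Infinite) ∧
      -- all closed points of the punctured spectrum of `A`, including those above `x`
      (∀ v₀ : Spec (CommRingCat.of (IntRing k₀ K)), v₀.asIdeal.height = 1 →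
        UnramifiedIn L (placeRing (functionFieldMap (K := K) (IntRing k₀ K)) v₀) →
        {v : Spec (CommRingCat.of (IntRing k₀ K)) | v.asIdeal.height = 1 ∧
          ConjDecomposition L
            (placeRing (functionFieldMap (K := K) (IntRing k₀ K)) v₀)
            (placeRing (functionFieldMap (K := K) (IntRing k₀ K)) v)}.Infinite)) := by
  refine ⟨?_, ?_⟩
  · intro k _ O _ C s _ _ _ K _ i L _ _ _ _ v₀ hv₀ hR
    have : IsLocallyNoetherian C := LocallyOfFiniteType.isLocallyNoetherian s
    have := isNoetherianRing_placeRing i.toRingHom v₀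
    have hfin := residueMap_finite (s := s) hv₀
    refine ⟨fun O' h ↦ exists_isOpenFor_conjDecomposition i.toRingHom h hfin hR, fun hO ↦ ⟨?_, ?_⟩⟩
    · intro O' h U hU hp
      exact infinite_of_isOpenFor_of_smooth hO h hfin.to_isIntegral hU hp
    · exact infinite_setOf_conjDecomposition i.toRingHom hO hfin hR
  · intro k₀ _ _ K _ _ _ _ _ L _ _ _ _
    have := finite_intRing k₀ K
    have := isIntegrallyClosed_intRing k₀ K
    have := faithfulSMul_powerSeries₂ k₀ K
    have : FaithfulSMul (PowerSeries₂ k₀) (IntRing k₀ K) := inferInstance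
    have := isLocalization_intRingX k₀ K
    let : Algebra k₀ (IntRing k₀ K) :=
      ((algebraMap (PowerSeries₂ k₀) (IntRing k₀ K)).comp (algebraMap k₀ _)).toAlgebra
    have : IsScalarTower k₀ (PowerSeries₂ k₀) (IntRing k₀ K) := .of_algebraMap_eq fun _ ↦ rfl
    have hg : ∀ f, laurentToIntRingX k₀ K (algebraMap (PowerSeries k₀) (LaurentSeries k₀) f) =
        algebraMap (IntRing k₀ K) (IntRingX k₀ K) (firstVariableMap k₀ (IntRing k₀ K) f) :=
      IsLocalization.Away.lift_eq _ (isUnit_powerSeriesToIntRingX k₀ K)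
    have : IsNoetherianRing (IntRing k₀ K) := IsNoetherianRing.of_finite (PowerSeries₂ k₀) _
    have : IsNoetherianRing (CommRingCat.of (IntRingX k₀ K)) :=
      IsLocalization.isNoetherianRing (Submonoid.powers
        (algebraMap (PowerSeries₂ k₀) (IntRing k₀ K) (PowerSeries.C PowerSeries.X))) _ inferInstance
    have : IsDomain (CommRingCat.of (IntRingX k₀ K)) := inferInstanceAs (IsDomain (IntRingX k₀ K))
    refine ⟨fun v₀ hv₀ hR ↦ ⟨fun O' hO' ↦ ⟨?_, fun hsep U hU hself ↦ ?_⟩, ?_⟩, fun v₀ hv₀ hR ↦ ?_⟩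
    · have := isNoetherianRing_placeRing (functionFieldMap (K := K) (IntRingX k₀ K)) v₀
      exact exists_isOpenFor_conjDecomposition _ hO' (residueMap_finite_of_isClosed hg hv₀) hR
    · exact infinite_of_isOpenFor_of_separable hg hv₀ hsep hO' hU hself
    · exact infinite_setOf_isClosed (A := IntRing k₀ K) k₀ hv₀ hR
    · exact infinite_setOf_height_eq_one k₀ hv₀ hR
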